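/- **Conventions.** For $0<s<1$, $1\le p<\infty$, a measurable set $U\subset\mathbb R^n$ and $F\subset\mathbb R^m$, $W^{s,p}(U;F)$ is the set of measurable $u:U\to\mathbb R^m$ with $u(x)\in F$ for a.e. $x\in U$ and finite norm $$\|u\|_{W^{s,p}(U)}=\|u\|_{L^p(U)}+\Big(\int_U\int_U\frac{|u(x)-u(y)|^p}{|x-y|^{n+sp}}\,dx\,dy\Big)^{1/p}.$$ A *finite mesh* $\mathscr C$ in $\mathbb R^n$ is a finite union of closed cubes of a grid $\{T+2\varepsilon K+[-\varepsilon,\varepsilon]^n : K\in\mathbb Z^n\}$, with $T\in\mathbb R^n$, $\varepsilon>0$; its $j$-skeleton is the union of the $j$-dimensional faces of its cubes. A map $h$ on $\mathscr C$ is *piecewise $j$-homogeneous* if it is the $j$-homogeneous extension of its restriction to the $j$-skeleton, obtained by extending successively to the faces of dimension $j+1,\dots,n$: if $Q$ is a face, of dimension $>j$ and with centre $c$, of a cube of $\mathscr C$, then $$h(x)=h\Big(c+\varepsilon\frac{x-c}{|x-c|_\infty}\Big)\qquad\text{for all }x\in Q\setminus\{c\},$$ where $|\cdot|_\infty$ is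 the sup norm (the values at the centres $c$ are arbitrary). **Theorem.** Let $0<s<1$, $1\le p<\infty$ and $1\le sp<n$. Let $N\subset\mathbb R^m$ be a compact smooth embedded submanifold without boundary. Let $\Omega,\omega\subset\mathbb R^n$ be bounded open sets with $\overline\Omega\subset\omega$, let $f\in W^{s,p}(\omega;N)$, and let $j=[sp]$ be the integer part of $sp$. Then there exist a sequence $\{\mathscr C^k\}$ of finite meshes with $\overline\Omega\subset\mathscr C^k\subset\omega$ and a sequence of maps $f_k:\mathscr C^k\to N$ such that: a) each $f_k$ is piecewise $j$-homogeneous on $\mathscr C^k$; b) each $f_k$ belongs to $W^{s,p}(\mathscr C^k;N)$; c) $f_k\to f$ in $W^{s,p}(\Omega)$ as $k\to\infty$; d) for each $k$, the restriction of $f_k$ to the $j$-skeleton $\mathscr S^k$ of $\mathscr C^k$ is Lipschitz. -/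

import Mathlib

noncomputable section

namespace FracSobolev

open MeasureTheory Set
open scoped ENNReal ContDiff

/-- `ℝⁿ` with the Euclidean norm. -/
abbrev E (n : ℕ) : Type := EuclideanSpace ℝ (Fin n)

/-! ### Fractional Sobolev spaces, `0 < s < 1`, `1 ≤ p < ∞` -/

/-- The `p`-th power of the Gagliardo seminorm,
`∫_U ∫_U |u(x) - u(y)|^p / |x - y|^(n + s p) dx dy`. -/
def gagliardoEnergy {n m : ℕ} (s p : ℝ) (U : Set (E n)) (u : E n → E m) : ℝ≥0∞ :=
  ∫⁻ x in U, ∫⁻ y in U, ‖u x - u y‖ₑ ^ p / ‖x - y‖ₑ ^ ((n : ℝ) + s * p)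

/-- The norm `‖u‖_{L^p(U)} + |u|_{W^{s,p}(U)}`, with values in `[0, ∞]`. -/
def wspNorm {n m : ℕ} (s p : ℝ) (U : Set (E n)) (u : E n → E m) : ℝ≥0∞ :=
  eLpNorm u (ENNReal.ofReal p) (volume.restrict U) + gagliardoEnergy s p U u ^ (1 / p)

/-- `u` (restricted to `U`) belongs to `W^{s,p}(U ; F)`: it is measurable with finite norm, and
takes its values in `F` almost everywhere in `U`. -/
def MemWsp {n m : ℕ} (s p : ℝ) (U : Set (E n)) (F : Set (E m)) (u : E n → E m) : Prop :=
  AEStronglyMeasurable u (volume.restrict U) ∧ wspNorm s p U u < ⊤ ∧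
    ∀ᵐ x ∂(volume.restrict U), u x ∈ F

/-! ### Embedded submanifolds -/

/-- `N` is a smooth embedded submanifold without boundary, of dimension `d`, of `ℝᵐ`: around each
of its points there is a smooth diffeomorphism between open subsets of `ℝᵐ` that straightens `N`
to `{z | z_i = 0 for all i ≥ d}` (coordinates are numbered from `0`). -/
def IsSmoothSubmanifold {m : ℕ} (d : ℕ) (N : Set (E m)) : Prop :=
  ∀ x ∈ N, ∃ Φ : OpenPartialHomeomorph (E m) (E m),
    x ∈ Φ.source ∧ ContDiffOn ℝ ∞ Φ Φ.source ∧ ContDiffOn ℝ ∞ Φ.symm Φ.target ∧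
    ∀ y ∈ Φ.source, y ∈ N ↔ ∀ i : Fin m, d ≤ (i : ℕ) → Φ y i = 0

/-! ### Finite cubical meshes and homogeneous extensions -/

/-- A finite mesh of `ℝⁿ`: finitely many cubes of the grid of the cubes
`T + 2 ε K + [-ε, ε]ⁿ`, `K ∈ ℤⁿ`. -/
structure Mesh (n : ℕ) where
  /-- the centre of one of the cubes of the grid -/
  T : E n
  /-- half of the side length -/
  ε : ℝ
  ε_pos : 0 < ε
  /-- the indices of the cubes that form the mesh -/
  cells : Finset (Fin n → ℤ)

namespace Mesh

variable {n : ℕ}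

/-- The closed faces of the cube `T + 2 ε K + [-ε, ε]ⁿ` are indexed by sign vectors `e`: the
coordinates with `e i = 0` are free, the others are fixed at the end point given by the sign.
This is the centre `T + 2 ε K + ε e` of the face. -/
def faceCenter (M : Mesh n) (K : Fin n → ℤ) (e : Fin n → SignType) : E n :=
  WithLp.toLp 2 fun i => M.T i + 2 * M.ε * (K i : ℝ) + M.ε * ((e i : SignType) : ℝ)

/-- The closed face with index `e` of the cube with index `K`; for `e = 0` it is the closed cube
itself. -/
def face (M : Mesh n) (K : Fin n → ℤ) (e : Fin n → SignType) : Set (E n) :=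
  {x | ∀ i, if e i = 0 then |x i - M.faceCenter K e i| ≤ M.ε else x i = M.faceCenter K e i}

/-- The dimension of the face with index `e`. -/
def faceDim (e : Fin n → SignType) : ℕ := (Finset.univ.filter fun i => e i = 0).card

/-- The union of the closed cubes of the mesh. -/
def carrier (M : Mesh n) : Set (E n) := ⋃ K ∈ M.cells, M.face K 0

/-- The `j`-dimensional skeleton: the union of the `j`-dimensional faces of the cubes. -/
def skeleton (M : Mesh n) (j : ℕ) : Set (E n) :=
  ⋃ K ∈ M.cells, ⋃ e ∈ {e : Fin n → SignType | faceDim e = j}, M.face K e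

/-- The radial projection of the face with index `e` of the cube with index `K` onto the relative
boundary of that face, `x ↦ c + ε (x - c) / |x - c|`, where `c` is the centre of the face and
`| |` is the sup norm. -/
def radialProj (M : Mesh n) (K : Fin n → ℤ) (e : Fin n → SignType) (x : E n) : E n :=
  M.faceCenter K e +
    (M.ε / ‖WithLp.ofLp (x - M.faceCenter K e)‖) • (x - M.faceCenter K e)

/-- `f` is piecewise `j`-homogeneous on the mesh, that is, `f = H_n (⋯ (H_{j+1} (f|_{j-skeleton})))`,
where `H_ℓ` extends a map from the `(ℓ-1)`-skeleton to the `ℓ`-skeleton by homogeneity on each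
`ℓ`-dimensional face: on each face of dimension `> j`, the value of `f` at a point other than the
centre (where the homogeneous extension is not defined) is its value at the radial projection of
the point onto the boundary of the face. -/
def IsPiecewiseHomogeneous {m : ℕ} (M : Mesh n) (j : ℕ) (f : E n → E m) : Prop :=
  ∀ K ∈ M.cells, ∀ e : Fin n → SignType, j < faceDim e →
    ∀ x ∈ M.face K e, x ≠ M.faceCenter K e → f x = f (M.radialProj K e x)

end Mesh

end FracSobolev

end

noncomputable section
namespace FracSobolev
open MeasureTheory Set
open scoped ENNReal ContDiff

/-! ### Lipschitz retraction onto a compact submanifold -/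

section Retraction

open scoped RealInnerProductSpace Topology

variable {m : ℕ}

/-! Write σ = s p, so that j ≤ σ < j + 1. The approximant is g = π ∘ u ∘ P. Here P is the
homogeneous retraction onto the j-skeleton of a grid of size ε, u is a mollification at scale ρ of a
globally defined map F that agrees with f near Ω, and π is the nearest point projection onto N.
Composition with P makes g piecewise j-homogeneous, and g = π ∘ u is Lipschitz on the skeleton as
soon as u maps the skeleton into the region where π is Lipschitz. The position of the grid is
random, given by a translation τ in a period cell, and everything reduces to averages over τ.

Energy (`exists_lintegral_cell_energy_le`). P is Lipschitz with constant of order 1 / depth, where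
the depth measures the distance to the dual skeleton, of codimension j + 1. Averaging over τ costs
the integral of depth ^ (-σ), which is finite because σ < j + 1. Hence the energy of u ∘ P on pairs
at distance less than δ is, on average, at most a constant times the energy of F on pairs at
distance at most δ + 2√n ε. Mollification does not increase that energy (`localEnergy_mollify_le`),
and it tends to 0 with the distance (`exists_localEnergy_lt`).

Distance to N (`infEDist_mollify_rpow_le`). The distance of u x to N is controlled by the energy
density of F on the ball of radius ρ about x. For x in the skeleton this ball lies in a
neighbourhood of the skeleton that covers a fraction of order (ρ / ε) ^ (n - j) of space. For fixed
ε the powers of ρ combine to ρ ^ (σ - j), which is bounded because j ≤ σ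
(`exists_mollifier_const_le`). The remaining factor, the energy of F on pairs at distance at most
2ρ, tends to 0, so u is uniformly close to N on a suitably placed skeleton, even when σ = j.

Convergence. No continuity of the composition with π in the fractional norm is needed. For near
pairs, g and F have small energy separately. For far pairs the energy of g - F is controlled by its
L^p norm (`gagliardoEnergy_le`), and ‖π v - F‖ ≤ 2 ‖v - F‖ when F takes values in N. The scales are
chosen in the order δ, ε, ρ, then τ (`exists_grid`). The compactness and smoothness of N enter
through `exists_lipschitz_retraction`. -/

lemma taylor_bound_of_lipschitzOn_fderiv {Ψ : E m → E m} {a : E m} {r : ℝ} {κ : NNReal}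
    (hd : ∀ z ∈ Metric.ball a r, DifferentiableAt ℝ Ψ z)
    (hL : LipschitzOnWith κ (fderiv ℝ Ψ) (Metric.ball a r))
    {b c : E m} (hb : b ∈ Metric.ball a r) (hc : c ∈ Metric.ball a r) :
    ‖Ψ c - Ψ b - fderiv ℝ Ψ b (c - b)‖ ≤ κ * ‖c - b‖ ^ 2 := by
  have hseg : segment ℝ b c ⊆ Metric.ball a r := (convex_ball a r).segment_subset hb hc
  have h := Convex.norm_image_sub_le_of_norm_hasFDerivWithin_le' (𝕜 := ℝ) (f := Ψ)
    (f' := fderiv ℝ Ψ) (C := κ * ‖c - b‖) (φ := fderiv ℝ Ψ b) (s := segment ℝ b c)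
    (x := b) (y := c)
    (fun z hz => (hd z (hseg hz)).hasFDerivAt.hasFDerivWithinAt)
    (fun z hz => by
      have h1 := hL.dist_le_mul z (hseg hz) b hb
      rw [dist_eq_norm, dist_eq_norm] at h1
      refine h1.trans ?_
      gcongr
      obtain ⟨t, ht, rfl⟩ := (segment_eq_image' ℝ b c ▸ hz : z ∈ _)
      simp only [add_sub_cancel_left, norm_smul, Real.norm_eq_abs, abs_of_nonneg ht.1]
      exact mul_le_of_le_one_left (norm_nonneg _) ht.2)
    (convex_segment b c) (left_mem_segment ℝ b c) (right_mem_segment ℝ b c)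
  calc _ ≤ _ := h
    _ = _ := by ring

lemma nonpos_of_forall_le_mul {a b : ℝ} (h : ∀ t : ℝ, 0 < t → t ≤ 1 → a ≤ t * b) : a ≤ 0 := by
  by_contra! ha
  have h1 := h 1 one_pos le_rfl
  have hb : 0 < b := by linarith
  have h2 := h (a / (2 * b)) (by positivity) (by
    rw [div_le_one (by positivity)]; linarith)
  have : a / (2 * b) * b = a / 2 := by field_simp
  linarith

/-- First variation at a nearest point: expanding ‖y - γ t‖² to first order along the curve and
dividing by t leaves an error of order t. Only t > 0 is available, hence an inequality and not
orthogonality. -/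
lemma inner_nonpos_of_forall_norm_le {y a V : E m} {γ : ℝ → E m} {c : ℝ} (hc : 0 ≤ c)
    (hγ : ∀ t : ℝ, 0 < t → t ≤ 1 → ‖γ t - a - t • V‖ ≤ c * t ^ 2)
    (hmin : ∀ t : ℝ, 0 < t → t ≤ 1 → ‖y - a‖ ≤ ‖y - γ t‖) : ⟪y - a, V⟫ ≤ 0 := by
  apply nonpos_of_forall_le_mul (b := ‖y - a‖ * c + (‖V‖ + c) ^ 2)
  intro t ht0 ht1
  have hR := hγ t ht0 ht1
  have hm := hmin t ht0 ht1
  generalize γ t = g at hR hm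
  obtain ⟨R, hga⟩ : ∃ R, g - a = t • V + R := ⟨g - a - t • V, by abel⟩
  rw [hga, add_sub_cancel_left] at hR
  have hR' : ‖R‖ ≤ t * c := hR.trans (by nlinarith [mul_nonneg hc ht0.le])
  have h2 : 2 * ⟪y - a, g - a⟫ ≤ ‖g - a‖ ^ 2 := by
    have e : y - g = (y - a) - (g - a) := by abel
    have := norm_sub_sq_real (y - a) (g - a)
    rw [← e] at this
    have h3 : ‖y - a‖ ^ 2 ≤ ‖y - g‖ ^ 2 := by gcongr
    linarith
  have hgn : ‖g - a‖ ≤ t * (‖V‖ + c) := by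
    rw [hga]
    refine (norm_add_le _ _).trans ?_
    rw [norm_smul, Real.norm_eq_abs, abs_of_pos ht0, mul_add]
    gcongr
  have h4 : ‖g - a‖ ^ 2 ≤ (t * (‖V‖ + c)) ^ 2 := by gcongr
  have h5 : ⟪y - a, g - a⟫ = t * ⟪y - a, V⟫ + ⟪y - a, R⟫ := by
    rw [hga, inner_add_right, inner_smul_right]
  have h6 : -(‖y - a‖ * ‖R‖) ≤ ⟪y - a, R⟫ :=
    (abs_le.1 (abs_real_inner_le_norm (y - a) R)).1
  have h7 : ‖y - a‖ * ‖R‖ ≤ ‖y - a‖ * (c * t ^ 2) := by gcongr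
  have h9 : 0 ≤ (t * (‖V‖ + c)) ^ 2 := sq_nonneg _
  have h8 : t * ⟪y - a, V⟫ ≤ t * (t * (‖y - a‖ * c + (‖V‖ + c) ^ 2)) := by linarith
  exact le_of_mul_le_mul_left h8 ht0

/-- In a straightening chart the segment from `Φ a` to `Φ b` stays in the flat set, so its preimage
is a curve in N starting at a. The first variation applies to its initial velocity, which differs
from b - a by a quadratic Taylor remainder. -/
lemma exists_nhds_inner_le {d : ℕ} {N : Set (E m)} (hN : IsSmoothSubmanifold d N) {x : E m}
    (hx : x ∈ N) :
    ∃ U ∈ 𝓝 x, ∃ κ : ℝ, 0 ≤ κ ∧ ∀ a ∈ N ∩ U, ∀ b ∈ N ∩ U, ∀ y : E m,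
      (∀ z ∈ N, ‖y - a‖ ≤ ‖y - z‖) → ⟪y - a, b - a⟫ ≤ κ * ‖y - a‖ * ‖b - a‖ ^ 2 := by
  obtain ⟨Φ, hxs, hΦ, hΨ, hflat⟩ := hN x hx
  have hxt : Φ x ∈ Φ.target := Φ.map_source hxs
  have hΨat : ContDiffAt ℝ ∞ Φ.symm (Φ x) := hΨ.contDiffAt (Φ.open_target.mem_nhds hxt)
  have hΦat : ContDiffAt ℝ ∞ Φ x := hΦ.contDiffAt (Φ.open_source.mem_nhds hxs)
  have hDΨ : ContDiffAt ℝ 1 (fderiv ℝ Φ.symm) (Φ x) :=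
    hΨat.fderiv_right (m := 1) (by norm_cast)
  obtain ⟨κ₁, t₁, ht₁, hL₁⟩ := hDΨ.exists_lipschitzOnWith
  obtain ⟨κ₂, t₂, ht₂, hL₂⟩ := (hΦat.of_le (m := 1) (by norm_cast)).exists_lipschitzOnWith
  obtain ⟨r, hr, hball⟩ := Metric.mem_nhds_iff.1
    (Filter.inter_mem ht₁ (Φ.open_target.mem_nhds hxt))
  have hd : ∀ z ∈ Metric.ball (Φ x) r, DifferentiableAt ℝ Φ.symm z := fun z hz =>
    (hΨ.contDiffAt (Φ.open_target.mem_nhds (hball hz).2)).differentiableAt (by simp)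
  have hL : LipschitzOnWith κ₁ (fderiv ℝ Φ.symm) (Metric.ball (Φ x) r) :=
    hL₁.mono fun z hz => (hball hz).1
  refine ⟨t₂ ∩ (Φ.source ∩ Φ ⁻¹' Metric.ball (Φ x) r), Filter.inter_mem ht₂
    (Filter.inter_mem (Φ.open_source.mem_nhds hxs)
      (hΦat.continuousAt.preimage_mem_nhds (Metric.ball_mem_nhds _ hr))),
    κ₁ * κ₂ ^ 2, mul_nonneg κ₁.coe_nonneg (sq_nonneg _), ?_⟩
  rintro a ⟨haN, ha₂, has, hab⟩ b ⟨hbN, hb₂, hbs, hbb⟩ y hy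
  change Φ a ∈ Metric.ball (Φ x) r at hab
  change Φ b ∈ Metric.ball (Φ x) r at hbb
  obtain ⟨v, hv⟩ : ∃ v, v = Φ b - Φ a := ⟨_, rfl⟩
  have hvle : ‖v‖ ≤ κ₂ * ‖b - a‖ := by
    have := hL₂.dist_le_mul b hb₂ a ha₂
    rwa [dist_eq_norm, dist_eq_norm, ← hv] at this
  have hT := taylor_bound_of_lipschitzOn_fderiv hd hL hab hbb
  rw [Φ.left_inv has, Φ.left_inv hbs, ← hv] at hT
  have key : ⟪y - a, fderiv ℝ Φ.symm (Φ a) v⟫ ≤ 0 := by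
    have hmem : ∀ t : ℝ, 0 < t → t ≤ 1 → Φ a + t • v ∈ Metric.ball (Φ x) r := fun t ht0 ht1 => by
      rw [hv]
      exact (convex_ball _ _).add_smul_sub_mem hab hbb ⟨ht0.le, ht1⟩
    refine inner_nonpos_of_forall_norm_le (γ := fun t => Φ.symm (Φ a + t • v))
      (c := κ₁ * ‖v‖ ^ 2) (mul_nonneg κ₁.coe_nonneg (sq_nonneg _)) (fun t ht0 ht1 => ?_)
      fun t ht0 ht1 => hy _ ?_
    · have h := taylor_bound_of_lipschitzOn_fderiv hd hL hab (hmem t ht0 ht1)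
      rw [Φ.left_inv has, add_sub_cancel_left, map_smul, norm_smul, Real.norm_eq_abs,
        abs_of_pos ht0, mul_pow] at h
      exact h.trans_eq (by ring)
    · have htgt := (hball (hmem t ht0 ht1)).2
      rw [hflat _ (Φ.map_target htgt)]
      intro i hi
      have h1 := (hflat a has).1 haN i hi
      have h2 := (hflat b hbs).1 hbN i hi
      rw [Φ.right_inv htgt]
      simp [hv, h1, h2]
  generalize fderiv ℝ Φ.symm (Φ a) v = V at hT key
  have e : ⟪y - a, b - a⟫ = ⟪y - a, V⟫ + ⟪y - a, b - a - V⟫ := by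
    rw [← inner_add_right]; congr 1; abel
  have h1 := real_inner_le_norm (y - a) (b - a - V)
  have h2 : (κ₁ : ℝ) * ‖v‖ ^ 2 ≤ κ₁ * (κ₂ * ‖b - a‖) ^ 2 := by gcongr
  calc ⟪y - a, b - a⟫ ≤ ‖y - a‖ * ‖b - a - V‖ := by linarith
    _ ≤ ‖y - a‖ * (κ₁ * (κ₂ * ‖b - a‖) ^ 2) := by
      gcongr
      exact hT.trans h2
    _ = _ := by ring

/-- A compact submanifold has positive reach. -/
lemma exists_inner_le {d : ℕ} {N : Set (E m)} (hNc : IsCompact N)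
    (hN : IsSmoothSubmanifold d N) :
    ∃ κ : ℝ, 0 < κ ∧ ∀ a ∈ N, ∀ b ∈ N, ∀ y : E m,
      (∀ z ∈ N, ‖y - a‖ ≤ ‖y - z‖) → ⟪y - a, b - a⟫ ≤ κ * ‖y - a‖ * ‖b - a‖ ^ 2 := by
  choose! U hU κ hκ hin using fun x (hx : x ∈ N) => exists_nhds_inner_le hN hx
  obtain ⟨t, ht, hcov⟩ := hNc.elim_nhds_subcover (fun x => interior (U x))
    fun x hx => interior_mem_nhds.2 (hU x hx)
  -- Two points of N closer than the Lebesgue number r lie in a common neighbourhood, where the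
  -- local estimate holds. For the other pairs Cauchy–Schwarz suffices, since then ‖b - a‖ ≤ ‖b -
  -- a‖² / r; this accounts for the summand 1 / r of the constant.
  obtain ⟨r, hr, hleb⟩ := lebesgue_number_lemma_of_metric (c := fun x : t => interior (U x)) hNc
    (fun _ => isOpen_interior) (by simpa [iUnion_subtype] using hcov)
  refine ⟨∑ x ∈ t, κ x + 1 / r, ?_, ?_⟩
  · have : 0 ≤ ∑ x ∈ t, κ x := Finset.sum_nonneg fun x hx => hκ x (ht x hx)
    positivity
  intro a ha b hb y hy
  have hsum : 0 ≤ ∑ x ∈ t, κ x := Finset.sum_nonneg fun x hx => hκ x (ht x hx)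
  by_cases hab : ‖b - a‖ < r
  · obtain ⟨⟨x, hxt⟩, hx⟩ := hleb a ha
    have h := hin x (ht x hxt) a ⟨ha, interior_subset (hx (Metric.mem_ball_self hr))⟩ b
      ⟨hb, interior_subset (hx (by rwa [Metric.mem_ball, dist_eq_norm]))⟩ y hy
    refine h.trans ?_
    gcongr
    have := Finset.single_le_sum (f := κ) (fun x hx => hκ x (ht x hx)) hxt
    have : 0 < 1 / r := by positivity
    linarith
  · push Not at hab
    have h1 := real_inner_le_norm (y - a) (b - a)
    have h2 : ‖b - a‖ ≤ 1 / r * ‖b - a‖ ^ 2 := by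
      rw [one_div, inv_mul_eq_div, le_div_iff₀ hr, sq]
      gcongr
    calc _ ≤ ‖y - a‖ * ‖b - a‖ := h1
      _ ≤ ‖y - a‖ * (1 / r * ‖b - a‖ ^ 2) := by gcongr
      _ ≤ (∑ x ∈ t, κ x + 1 / r) * ‖y - a‖ * ‖b - a‖ ^ 2 := by
        have : 0 ≤ (∑ x ∈ t, κ x) * ‖y - a‖ * ‖b - a‖ ^ 2 := by positivity
        linarith

/-- The nearest point projection on a compact submanifold is Lipschitz near the submanifold. -/
theorem exists_lipschitz_retraction {d : ℕ} {N : Set (E m)} (hNc : IsCompact N)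
    (hne : N.Nonempty) (hN : IsSmoothSubmanifold d N) :
    ∃ δ : ℝ, 0 < δ ∧ ∃ π : E m → E m, Measurable π ∧ (∀ y, π y ∈ N) ∧
      LipschitzOnWith 2 π {y | Metric.infDist y N ≤ δ} ∧
      ∀ y, Metric.infDist y N ≤ δ → ∀ z ∈ N, ‖y - π y‖ ≤ ‖y - z‖ := by
  obtain ⟨κ, hκ, hin⟩ := exists_inner_le hNc hN
  have hex : ∀ y : E m, ∃ a ∈ N, ∀ z ∈ N, ‖y - a‖ ≤ ‖y - z‖ := fun y => by
    obtain ⟨a, ha, h⟩ := hNc.exists_isMinOn hne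
      (f := fun z => ‖y - z‖) (by fun_prop)
    exact ⟨a, ha, fun z hz => h hz⟩
  choose π₀ hπN hπmin using hex
  obtain ⟨o, ho⟩ := hne
  -- With this radius the two inner products below are at most ‖b - a‖² / 4 each; half of ‖b - a‖²
  -- survives in `h3`, which gives the Lipschitz constant 2.
  set δ := 1 / (4 * κ) with hδ
  have hδ0 : 0 < δ := by positivity
  set S : Set (E m) := {y | Metric.infDist y N ≤ δ} with hS
  have hScl : IsClosed S := isClosed_le (Metric.continuous_infDist_pt N) continuous_const
  have hdist : ∀ y ∈ S, ‖y - π₀ y‖ ≤ δ := fun y hy => by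
    refine le_trans ?_ hy
    refine (Metric.le_infDist ⟨o, ho⟩).2 fun z hz => ?_
    rw [dist_eq_norm]
    exact hπmin y z hz
  have hLip : LipschitzOnWith 2 π₀ S := by
    refine LipschitzOnWith.of_dist_le_mul fun y hy y' hy' => ?_
    rw [dist_eq_norm, dist_eq_norm, ← norm_neg, neg_sub, ← norm_neg (y - y'), neg_sub]
    set a := π₀ y
    set b := π₀ y'
    have h1 : ⟪y - a, b - a⟫ ≤ 1 / 4 * ‖b - a‖ ^ 2 := by
      refine (hin a (hπN y) b (hπN y') y (hπmin y)).trans ?_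
      gcongr
      calc κ * ‖y - a‖ ≤ κ * δ := by gcongr; exact hdist y hy
        _ = 1 / 4 := by rw [hδ]; field_simp
    have h2 : ⟪y' - b, a - b⟫ ≤ 1 / 4 * ‖b - a‖ ^ 2 := by
      rw [norm_sub_rev b a]
      refine (hin b (hπN y') a (hπN y) y' (hπmin y')).trans ?_
      gcongr
      calc κ * ‖y' - b‖ ≤ κ * δ := by gcongr; exact hdist y' hy'
        _ = 1 / 4 := by rw [hδ]; field_simp
    have h3 : ⟪y' - y, b - a⟫ = ‖b - a‖ ^ 2 - ⟪y' - b, a - b⟫ - ⟪y - a, b - a⟫ := by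
      have e1 : y' - y = (b - a) + (y' - b) - (y - a) := by abel
      have e2 : a - b = -(b - a) := by abel
      rw [e2, inner_neg_right, e1, inner_sub_left, inner_add_left, real_inner_self_eq_norm_sq]
      ring
    have h4 := real_inner_le_norm (y' - y) (b - a)
    have h5 : ‖b - a‖ * ‖b - a‖ ≤ (2 * ‖y' - y‖) * ‖b - a‖ := by nlinarith
    rcases (norm_nonneg (b - a)).eq_or_lt with h0 | h0
    · rw [← h0]; positivity
    · simpa using le_of_mul_le_mul_right h5 h0
  classical
  -- The nearest point was selected arbitrarily, but it is continuous on the closed set `S`. A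
  -- constant value elsewhere makes the map measurable.
  refine ⟨δ, hδ0, S.piecewise π₀ fun _ => o, ?_, ?_, ?_, ?_⟩
  · exact hLip.continuousOn.measurable_piecewise continuousOn_const hScl.measurableSet
  · intro y
    by_cases hy : y ∈ S <;> simp [hy, hπN, ho]
  · intro y hy y' hy'
    rw [piecewise_eq_of_mem _ _ _ hy, piecewise_eq_of_mem _ _ _ hy']
    exact hLip hy hy'
  · intro y hy z hz
    rw [piecewise_eq_of_mem S _ _ (show y ∈ S from hy)]
    exact hπmin y z hz

end Retraction

end FracSobolev
end

noncomputable section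
namespace FracSobolev
open MeasureTheory Set
open scoped ENNReal ContDiff

/-! ### The homogeneous retraction onto the skeleton of the grid `2 ℤⁿ + [-1, 1]ⁿ` -/

section Grid

/-- The truncation of a real number to `[-1, 1]`. -/
def clamp (x : ℝ) : ℝ := max (-1) (min 1 x)

lemma clamp_le_one (x : ℝ) : clamp x ≤ 1 := max_le (by norm_num) (min_le_left _ _)

lemma neg_one_le_clamp (x : ℝ) : -1 ≤ clamp x := le_max_left _ _

lemma clamp_of_one_le {x : ℝ} (h : 1 ≤ x) : clamp x = 1 := by simp [clamp, h]

lemma clamp_of_le_neg_one {x : ℝ} (h : x ≤ -1) : clamp x = -1 := by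
  rw [clamp, min_eq_right (by linarith), max_eq_left h]

lemma clamp_of_mem {x : ℝ} (h : -1 ≤ x) (h' : x ≤ 1) : clamp x = x := by
  rw [clamp, min_eq_right h', max_eq_right h]

lemma clamp_of_abs_le {x : ℝ} (h : |x| ≤ 1) : clamp x = x :=
  clamp_of_mem (abs_le.1 h).1 (abs_le.1 h).2

lemma clamp_neg (x : ℝ) : clamp (-x) = -clamp x := by
  rcases le_total x (-1) with h | h
  · rw [clamp_of_le_neg_one h, clamp_of_one_le (by linarith), neg_neg]
  rcases le_total x 1 with h' | h'
  · rw [clamp_of_mem h h', clamp_of_mem (by linarith) (by linarith)]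
  · rw [clamp_of_one_le h', clamp_of_le_neg_one (by linarith)]

lemma abs_clamp_sub_clamp_le (x y : ℝ) : |clamp x - clamp y| ≤ |x - y| := by
  unfold clamp
  refine (abs_max_sub_max_le_max _ _ _ _).trans ?_
  rw [sub_self, abs_zero]
  refine max_le (abs_nonneg _) ((abs_min_sub_min_le_max _ _ _ _).trans ?_)
  simp

lemma one_sub_clamp_div_le {x t : ℝ} (ht : 0 < t) (ht1 : t ≤ 1) (hx : x ≤ 1) :
    1 - clamp (x / t) ≤ (1 - x) / t := by
  rw [le_div_iff₀ ht]
  rcases le_total (x / t) (-1) with h | h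
  · rw [clamp_of_le_neg_one h]
    rw [div_le_iff₀ ht] at h
    linarith
  rcases le_total (x / t) 1 with h' | h'
  · rw [clamp_of_mem h h', sub_mul, div_mul_cancel₀ _ ht.ne']
    linarith
  · rw [clamp_of_one_le h']
    linarith

/-- The truncation makes the bound uniform in x: the quotient varies with the parameter only while
it is at most 1 in absolute value. Only r appears in the denominator, so that later only one of two
depths does. -/
lemma abs_clamp_div_sub_clamp_div_le {x t r : ℝ} (ht : 0 < t) (hr : 0 < r) :
    |clamp (x / t) - clamp (x / r)| ≤ |t - r| / r := by
  wlog hx : 0 ≤ x generalizing x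
  · have h := this (x := -x) (by linarith)
    rw [neg_div, neg_div, clamp_neg, clamp_neg] at h
    rwa [show clamp (x / t) - clamp (x / r) = -(-clamp (x / t) - -clamp (x / r)) by ring, abs_neg]
  have hpos : ∀ {c : ℝ}, 0 < c → -1 ≤ x / c := fun hc => by
    have : 0 ≤ x / _ := div_nonneg hx hc.le
    linarith
  rw [le_div_iff₀ hr]
  rcases le_total x t with h | h <;> rcases le_total x r with h' | h'
  · rw [clamp_of_mem (hpos ht) ((div_le_one ht).2 h), clamp_of_mem (hpos hr) ((div_le_one hr).2 h'),
      ← abs_of_pos hr, ← abs_mul, abs_of_pos hr,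
      show (x / t - x / r) * r = x / t * (r - t) by field_simp, abs_mul, abs_sub_comm r t]
    refine mul_le_of_le_one_left (abs_nonneg _) ?_
    rw [abs_of_nonneg (by positivity)]
    exact (div_le_one ht).2 h
  · rw [clamp_of_mem (hpos ht) ((div_le_one ht).2 h), clamp_of_one_le ((one_le_div hr).2 h')]
    have h1 : x / t ≤ 1 := (div_le_one ht).2 h
    rw [abs_of_nonpos (by linarith), abs_of_nonneg (by linarith)]
    have h2 : r / t ≤ x / t := by gcongr
    have h3 : r / t * t = r := by field_simp
    have h4 : 0 < r / t := by positivity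
    nlinarith
  · rw [clamp_of_one_le ((one_le_div ht).2 h), clamp_of_mem (hpos hr) ((div_le_one hr).2 h')]
    have h1 : x / r ≤ 1 := (div_le_one hr).2 h'
    rw [abs_of_nonneg (by linarith), abs_of_nonpos (by linarith)]
    have h3 : x / r * r = x := by field_simp
    nlinarith
  · rw [clamp_of_one_le ((one_le_div ht).2 h), clamp_of_one_le ((one_le_div hr).2 h')]
    simp

/-- The distance to the even integers. -/
def evenDist (a : ℝ) : ℝ := |a - 2 * round (a / 2)|

lemma evenDist_le (a : ℝ) (k : ℤ) : evenDist a ≤ |a - 2 * k| := by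
  have h := round_le (a / 2) k
  unfold evenDist
  have e : ∀ c : ℝ, a - 2 * c = 2 * (a / 2 - c) := fun c => by ring
  rw [e, e, abs_mul, abs_mul]
  gcongr

lemma evenDist_nonneg (a : ℝ) : 0 ≤ evenDist a := abs_nonneg _

lemma evenDist_le_one (a : ℝ) : evenDist a ≤ 1 := by
  have h := abs_sub_round (a / 2)
  unfold evenDist
  rw [show a - 2 * (round (a / 2) : ℝ) = 2 * (a / 2 - round (a / 2)) by ring, abs_mul,
    abs_two]
  linarith

lemma evenDist_le_add (a b : ℝ) : evenDist a ≤ evenDist b + |a - b| := by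
  refine (evenDist_le a (round (b / 2))).trans ?_
  unfold evenDist
  have := abs_add_le (b - 2 * round (b / 2)) (a - b)
  rwa [show b - 2 * (round (b / 2) : ℝ) + (a - b) = a - 2 * round (b / 2) by ring] at this

lemma evenDist_eq {a : ℝ} {k : ℤ} (h : |a - 2 * k| ≤ 1) : evenDist a = |a - 2 * k| := by
  refine le_antisymm (evenDist_le a k) ?_
  by_cases hk : k = round (a / 2)
  · rw [hk]; rfl
  have h1 : (1 : ℝ) ≤ |(k : ℝ) - round (a / 2)| := by
    have : (1 : ℤ) ≤ |k - round (a / 2)| := Int.one_le_abs (sub_ne_zero.2 hk)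
    exact_mod_cast this
  have h2 := abs_sub_abs_le_abs_sub (2 * ((k : ℝ) - round (a / 2))) (-(a - 2 * k))
  rw [show 2 * ((k : ℝ) - round (a / 2)) - -(a - 2 * k) = a - 2 * round (a / 2) by ring, abs_neg,
    abs_mul, abs_two] at h2
  unfold evenDist
  linarith

lemma evenDist_add (a : ℝ) (k : ℤ) : evenDist (a + 2 * k) = evenDist a := by
  unfold evenDist
  rw [show (a + 2 * k) / 2 = a / 2 + k by ring, round_add_intCast]
  push_cast
  congr 1
  ring

/-- On each interval `2k + [-1, 1]`, the dilation with centre `2k` and factor `t⁻¹`, truncated to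
take values in the same interval. -/
def gridStretch (t a : ℝ) : ℝ := 2 * round (a / 2) + clamp ((a - 2 * round (a / 2)) / t)

lemma gridStretch_add (t a : ℝ) (k : ℤ) : gridStretch t (a + 2 * k) = gridStretch t a + 2 * k := by
  unfold gridStretch
  rw [show (a + 2 * k) / 2 = a / 2 + k by ring, round_add_intCast]
  push_cast
  rw [show a + 2 * (k : ℝ) - 2 * (round (a / 2) + k) = a - 2 * round (a / 2) by ring]
  ring

/-- At an odd integer `round` chooses one of the two adjacent intervals. The formulas of both agree
there because the truncated dilation fixes the end points when t ≤ 1. -/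
lemma gridStretch_eq {t a : ℝ} (ht : 0 < t) (ht1 : t ≤ 1) {k : ℤ} (h : |a - 2 * k| ≤ 1) :
    gridStretch t a = 2 * k + clamp ((a - 2 * k) / t) := by
  have h' : |a - 2 * (round (a / 2) : ℝ)| ≤ 1 := evenDist_le_one a
  unfold gridStretch
  generalize round (a / 2) = l at h'
  rw [abs_le] at h h'
  have h1 : l ≤ k + 1 := by
    have : (l : ℝ) ≤ k + 1 := by linarith
    exact_mod_cast this
  have h2 : k ≤ l + 1 := by
    have : (k : ℝ) ≤ l + 1 := by linarith
    exact_mod_cast this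
  have hp : clamp (1 / t) = 1 := clamp_of_one_le ((one_le_div ht).2 ht1)
  have hm : clamp (-1 / t) = -1 := by rw [neg_div, clamp_neg, hp]
  obtain rfl | rfl | rfl : l = k ∨ l = k + 1 ∨ k = l + 1 := by omega
  · rfl
  · push_cast at *
    have e : a = 2 * k + 1 := by linarith
    rw [show a - 2 * ((k : ℝ) + 1) = -1 by linarith, show a - 2 * (k : ℝ) = 1 by linarith, hp, hm]
    ring
  · push_cast at *
    have e : a = 2 * l + 1 := by linarith
    rw [show a - 2 * ((l : ℝ) + 1) = -1 by linarith, show a - 2 * (l : ℝ) = 1 by linarith, hp, hm]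
    ring

lemma abs_gridStretch_sub_self_le {t : ℝ} (ht : 0 ≤ t) (ht1 : t ≤ 1) (a : ℝ) :
    |gridStretch t a - a| ≤ 1 := by
  have h' : |a - 2 * (round (a / 2) : ℝ)| ≤ 1 := evenDist_le_one a
  unfold gridStretch
  generalize round (a / 2) = l at h'
  rw [show 2 * (l : ℝ) + clamp ((a - 2 * l) / t) - a = clamp ((a - 2 * l) / t) - (a - 2 * l) by
    ring]
  generalize a - 2 * (l : ℝ) = x at h'
  -- For t = 0 division by zero returns 0, so the point goes to the centre of its interval; the
  -- displacement bound thus holds on the dual skeleton too.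
  rcases ht.eq_or_lt with rfl | ht
  · rw [div_zero, clamp_of_abs_le (by simp), zero_sub, abs_neg]
    exact h'
  rw [abs_le] at h'
  rcases le_total 0 x with hx | hx
  · have h1 : 0 ≤ clamp (x / t) := by
      have := div_nonneg hx ht.le
      simp [clamp, this]
    have h2 := clamp_le_one (x / t)
    rw [abs_le]; constructor <;> linarith
  · have h1 : clamp (x / t) ≤ 0 := by
      have := div_nonpos_of_nonpos_of_nonneg hx ht.le
      simp [clamp, this]
    have h2 := neg_one_le_clamp (x / t)
    rw [abs_le]; constructor <;> linarith

lemma abs_gridStretch_sub_le_left {t r : ℝ} (ht : 0 < t) (hr : 0 < r) (a : ℝ) :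
    |gridStretch t a - gridStretch r a| ≤ |t - r| / r := by
  unfold gridStretch
  rw [add_sub_add_left_eq_sub]
  exact abs_clamp_div_sub_clamp_div_le ht hr

/-- Inside one interval this is the Lipschitz bound of the dilation. Across intervals, the path from
a to b is cut at the fixed end points of the intervals, and the pieces between them are stretched by
1 ≤ 1 / t. -/
lemma abs_gridStretch_sub_le_right {t : ℝ} (ht : 0 < t) (ht1 : t ≤ 1) (a b : ℝ) :
    |gridStretch t a - gridStretch t b| ≤ |a - b| / t := by
  have ha : |a - 2 * (round (a / 2) : ℝ)| ≤ 1 := evenDist_le_one a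
  have hb : |b - 2 * (round (b / 2) : ℝ)| ≤ 1 := evenDist_le_one b
  unfold gridStretch
  generalize round (a / 2) = k at ha
  generalize round (b / 2) = l at hb
  wlog hkl : k ≤ l generalizing a b k l
  · rw [abs_sub_comm, abs_sub_comm a b]
    exact this b a l hb k ha (by omega)
  rcases hkl.eq_or_lt with rfl | hkl
  · rw [add_sub_add_left_eq_sub]
    refine (abs_clamp_sub_clamp_le _ _).trans_eq ?_
    rw [← sub_div, abs_div, abs_of_pos ht]
    congr 2
    ring
  have hkl' : (k : ℝ) + 1 ≤ l := by exact_mod_cast hkl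
  rw [abs_le] at ha hb
  have h1 := one_sub_clamp_div_le ht ht1 ha.2
  have h2 := one_sub_clamp_div_le (x := -(b - 2 * l)) ht ht1 (by linarith)
  rw [neg_div, clamp_neg] at h2
  have h3 := clamp_le_one ((a - 2 * k) / t)
  have h4 := neg_one_le_clamp ((b - 2 * l) / t)
  rw [abs_sub_comm, abs_sub_comm a b, abs_of_nonneg (by linarith : 0 ≤ b - a), abs_of_nonneg
    (by linarith)]
  have h5 : 2 * (l : ℝ) - 2 * k - 2 ≤ (2 * (l : ℝ) - 2 * k - 2) / t := by
    rw [le_div_iff₀ ht]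
    exact mul_le_of_le_one_right (by linarith) ht1
  calc _ = (1 - clamp ((a - 2 * k) / t)) + (1 - -clamp ((b - 2 * l) / t)) +
      (2 * (l : ℝ) - 2 * k - 2) := by ring
    _ ≤ (1 - (a - 2 * k)) / t + (1 - -(b - 2 * l)) / t + (2 * (l : ℝ) - 2 * k - 2) / t := by
      linarith
    _ = _ := by ring

variable {n : ℕ}

/-- The `(j+1)`-th smallest among the distances of the coordinates to the even integers: the
sup-norm distance to the dual skeleton, of codimension `j+1`. -/
def depth (j : ℕ) (z : Fin n → ℝ) : ℝ :=
  ⨅ A : {A : Finset (Fin n) // A.card = j + 1}, ⨆ i : A.1, evenDist (z i)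

variable {j : ℕ}

/-- The infimum and the supremum are over finite families and are attained. The hypothesis j < n
makes the first family nonempty; the size j + 1 does so for the second. -/
lemma depth_le_iff (hj : j < n) {z : Fin n → ℝ} {c : ℝ} :
    depth j z ≤ c ↔ ∃ A : Finset (Fin n), A.card = j + 1 ∧ ∀ i ∈ A, evenDist (z i) ≤ c := by
  have : Nonempty {A : Finset (Fin n) // A.card = j + 1} := by
    obtain ⟨A, -, hA⟩ := Finset.exists_subset_card_eq
      (s := (Finset.univ : Finset (Fin n))) (n := j + 1) (by simpa using hj)
    exact ⟨⟨A, hA⟩⟩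
  constructor
  · intro h
    obtain ⟨A, hA⟩ := exists_eq_ciInf_of_finite
      (f := fun A : {A : Finset (Fin n) // A.card = j + 1} => ⨆ i : A.1, evenDist (z i))
    refine ⟨A.1, A.2, fun i hi => le_trans ?_ (hA.le.trans h)⟩
    exact le_ciSup (f := fun i : A.1 => evenDist (z i)) (Set.finite_range _).bddAbove ⟨i, hi⟩
  · rintro ⟨A, hA, h⟩
    have : Nonempty A := (Finset.card_pos.1 (by omega)).to_subtype
    exact (ciInf_le (Set.finite_range _).bddBelow ⟨A, hA⟩).trans (ciSup_le fun i => h i i.2)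

lemma depth_nonneg (j : ℕ) (z : Fin n → ℝ) : 0 ≤ depth j z :=
  Real.iInf_nonneg fun _ => Real.iSup_nonneg fun _ => evenDist_nonneg _

lemma depth_le_one (hj : j < n) (z : Fin n → ℝ) : depth j z ≤ 1 := by
  obtain ⟨A, -, hA⟩ := Finset.exists_subset_card_eq
    (s := (Finset.univ : Finset (Fin n))) (n := j + 1) (by simpa using hj)
  exact (depth_le_iff hj).2 ⟨A, hA, fun i _ => evenDist_le_one _⟩

lemma depth_le_add (hj : j < n) {y z : Fin n → ℝ} {c : ℝ} (h : ∀ i, |y i - z i| ≤ c) :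
    depth j y ≤ depth j z + c := by
  obtain ⟨A, hA, hz⟩ := (depth_le_iff hj).1 (le_refl (depth j z))
  exact (depth_le_iff hj).2 ⟨A, hA, fun i hi =>
    (evenDist_le_add _ (z i)).trans (add_le_add (hz i hi) (h i))⟩

lemma abs_depth_sub_le (hj : j < n) {y z : Fin n → ℝ} {c : ℝ} (h : ∀ i, |y i - z i| ≤ c) :
    |depth j y - depth j z| ≤ c := by
  have h1 := depth_le_add hj h
  have h2 := depth_le_add hj (y := z) (z := y) (c := c) fun i => abs_sub_comm (y i) (z i) ▸ h i
  rw [abs_le]; constructor <;> linarith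

lemma depth_add (z : Fin n → ℝ) (k : Fin n → ℤ) :
    depth j (fun i => z i + 2 * k i) = depth j z := by
  simp only [depth, evenDist_add]

/-- Otherwise j + 1 coordinates lie strictly below the depth, and so does their maximum, which
bounds the depth from above. -/
lemma card_filter_depth_le (hj : j < n) (z : Fin n → ℝ) :
    n - j ≤ (Finset.univ.filter fun i => depth j z ≤ evenDist (z i)).card := by
  by_contra! h
  have hc := Finset.card_filter_add_card_filter_not (s := (Finset.univ : Finset (Fin n)))
    (fun i => depth j z ≤ evenDist (z i))
  rw [Finset.card_univ, Fintype.card_fin] at hc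
  obtain ⟨A, hAs, hA⟩ := Finset.exists_subset_card_eq
    (s := Finset.univ.filter fun i => ¬ depth j z ≤ evenDist (z i)) (n := j + 1) (by omega)
  have hne : A.Nonempty := Finset.card_pos.1 (by omega)
  obtain ⟨i, hi, hmax⟩ := A.exists_max_image (fun i => evenDist (z i)) hne
  have h1 : depth j z ≤ evenDist (z i) := (depth_le_iff hj).2 ⟨A, hA, hmax⟩
  have h2 := hAs hi
  simp only [Finset.mem_filter, Finset.mem_univ, true_and] at h2
  exact h2 h1

/-- If at least `n - j` coordinates are odd integers, the depth is `1`. -/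
lemma depth_eq_one (hj : j < n) {z : Fin n → ℝ} {B : Finset (Fin n)} (hB : n - j ≤ B.card)
    (h : ∀ i ∈ B, evenDist (z i) = 1) : depth j z = 1 := by
  refine le_antisymm (depth_le_one hj z) ?_
  obtain ⟨A, hA, hz⟩ := (depth_le_iff hj).1 (le_refl (depth j z))
  have : ¬ Disjoint A B := fun hd => by
    have h1 := Finset.card_union_of_disjoint hd
    have h2 := Finset.card_le_univ (A ∪ B)
    rw [Fintype.card_fin] at h2
    omega
  obtain ⟨i, hiA, hiB⟩ := Finset.not_disjoint_iff.1 this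
  exact (h i hiB).ge.trans (hz i hiA)

/-- The retraction onto the `j`-skeleton of the grid. -/
def skelProj (j : ℕ) (z : E n) : E n :=
  WithLp.toLp 2 fun i => gridStretch (depth j z) (z i)

lemma skelProj_apply (z : E n) (i : Fin n) :
    skelProj j z i = gridStretch (depth j z) (z i) := rfl

lemma abs_apply_le_norm (z : E n) (i : Fin n) : |z i| ≤ ‖z‖ := PiLp.norm_apply_le z i

lemma norm_le_sqrt_mul {z : E n} {c : ℝ} (hc : 0 ≤ c) (h : ∀ i, |z i| ≤ c) :
    ‖z‖ ≤ √n * c := by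
  rw [EuclideanSpace.norm_eq]
  calc √(∑ i, ‖z i‖ ^ 2) ≤ √(∑ _i : Fin n, c ^ 2) := by
        gcongr with i
        exact h i
    _ = √n * c := by
        rw [Finset.sum_const, Finset.card_univ, Fintype.card_fin, nsmul_eq_mul,
          Real.sqrt_mul (by positivity), Real.sqrt_sq hc]

lemma norm_skelProj_sub_self_le (hj : j < n) (z : E n) : ‖skelProj j z - z‖ ≤ √n := by
  have := norm_le_sqrt_mul (z := skelProj j z - z) zero_le_one fun i => by
    rw [PiLp.sub_apply, skelProj_apply]
    exact abs_gridStretch_sub_self_le (depth_nonneg _ _) (depth_le_one hj _) _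
  simpa using this

/-- The dilation parameter is changed first, at the point y, and then the point, at the parameter of
z. The first change is controlled because the depth is 1-Lipschitz, and both steps have the depth of
z alone in the denominator. -/
lemma norm_skelProj_sub_le (hj : j < n) {y z : E n} (hy : depth j y ≠ 0) (hz : depth j z ≠ 0) :
    ‖skelProj j y - skelProj j z‖ ≤ 2 * √n * ‖y - z‖ / depth j z := by
  have hy' : 0 < depth j y := (depth_nonneg _ _).lt_of_ne' hy
  have hz' : 0 < depth j z := (depth_nonneg _ _).lt_of_ne' hz
  refine (norm_le_sqrt_mul (c := 2 * ‖y - z‖ / depth j z) (by positivity) fun i => ?_).trans_eq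
    (by ring)
  have hi : |y i - z i| ≤ ‖y - z‖ := abs_apply_le_norm (y - z) i
  rw [PiLp.sub_apply, skelProj_apply, skelProj_apply]
  calc _ ≤ |gridStretch (depth j y) (y i) - gridStretch (depth j z) (y i)| +
        |gridStretch (depth j z) (y i) - gridStretch (depth j z) (z i)| := abs_sub_le _ _ _
    _ ≤ |depth j y - depth j z| / depth j z + |y i - z i| / depth j z :=
        add_le_add (abs_gridStretch_sub_le_left hy' hz' _)
          (abs_gridStretch_sub_le_right hz' (depth_le_one hj _) _ _)
    _ ≤ ‖y - z‖ / depth j z + ‖y - z‖ / depth j z := by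
        gcongr
        exact abs_depth_sub_le hj fun i => abs_apply_le_norm (y - z) i
    _ = _ := by ring

lemma skelProj_add (z : E n) (k : Fin n → ℤ) :
    skelProj j (z + WithLp.toLp 2 fun i => 2 * (k i : ℝ)) =
      skelProj j z + WithLp.toLp 2 fun i => 2 * (k i : ℝ) := by
  ext i
  rw [PiLp.add_apply, skelProj_apply, skelProj_apply]
  have : depth j (z + WithLp.toLp 2 fun i => 2 * (k i : ℝ) : E n) = depth j z := depth_add z k
  rw [this, PiLp.add_apply]
  exact gridStretch_add _ _ _

lemma continuous_depth (hj : j < n) : Continuous fun z : E n => depth j z :=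
  LipschitzWith.continuous (K := 1) <| LipschitzWith.of_dist_le_mul fun y z => by
    rw [NNReal.coe_one, one_mul, Real.dist_eq, dist_eq_norm]
    exact abs_depth_sub_le hj fun i => abs_apply_le_norm (y - z) i

lemma measurable_evenRound : Measurable fun a : ℝ => 2 * (round (a / 2) : ℝ) := by
  simp only [round_eq]
  fun_prop

lemma measurable_skelProj (hj : j < n) : Measurable (skelProj j : E n → E n) := by
  refine (WithLp.measurable_toLp 2 _).comp (measurable_pi_lambda _ fun i => ?_)
  have h1 : Measurable fun z : E n => depth j z := (continuous_depth hj).measurable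
  have h2 : Measurable fun z : E n => 2 * (round (z i / 2) : ℝ) :=
    measurable_evenRound.comp (by fun_prop)
  unfold gridStretch clamp
  fun_prop

lemma measurable_evenDist : Measurable evenDist :=
  measurable_id.sub measurable_evenRound |>.norm

end Grid

end FracSobolev
end

noncomputable section
namespace FracSobolev
open MeasureTheory Set
open scoped ENNReal ContDiff

/-! ### The homogeneous retraction onto the skeleton of a mesh -/

namespace Mesh

variable {n j : ℕ} (M : Mesh n)

/-- Coordinates in which the grid of the mesh is `2 ℤⁿ + [-1, 1]ⁿ`. -/
def coord (x : E n) : E n := M.ε⁻¹ • (x - M.T)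

/-- The retraction onto the `j`-skeleton of the grid of the mesh. -/
def proj (j : ℕ) (x : E n) : E n := M.T + M.ε • skelProj j (M.coord x)

lemma coord_apply (x : E n) (i : Fin n) : M.coord x i = (x i - M.T i) / M.ε := by
  simp [coord, div_eq_inv_mul]

lemma coord_proj (x : E n) : M.coord (M.proj j x) = skelProj j (M.coord x) := by
  simp [coord, proj, smul_smul, M.ε_pos.ne']

lemma coord_injective : Function.Injective M.coord := fun x y h => by
  have := congrArg (fun z => M.T + M.ε • z) h
  simpa [coord, smul_smul, M.ε_pos.ne'] using this

lemma coord_sub_coord (x y : E n) : M.coord x - M.coord y = M.ε⁻¹ • (x - y) := by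
  simp [coord, ← smul_sub]

lemma coord_faceCenter (K : Fin n → ℤ) (e : Fin n → SignType) (i : Fin n) :
    M.coord (M.faceCenter K e) i = 2 * K i + (e i : ℝ) := by
  have := M.ε_pos.ne'
  rw [coord_apply, faceCenter]
  field_simp
  ring

lemma mem_face_iff {K : Fin n → ℤ} {e : Fin n → SignType} {x : E n} :
    x ∈ M.face K e ↔ ∀ i, if e i = 0 then |M.coord x i - 2 * K i| ≤ 1
      else M.coord x i - 2 * K i = (e i : ℝ) := by
  have hε := M.ε_pos
  refine forall_congr' fun i => ?_
  have h := M.coord_faceCenter K e i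
  have h1 : x i - M.faceCenter K e i = M.ε * (M.coord x i - 2 * K i - (e i : ℝ)) := by
    rw [coord_apply] at h ⊢
    field_simp at h ⊢
    linarith
  split_ifs with he
  · rw [h1, he, abs_mul, abs_of_pos hε]
    simp [hε]
  · rw [← sub_eq_zero, h1, mul_eq_zero, or_iff_right hε.ne', sub_eq_zero]

lemma abs_coord_sub_le_one {K : Fin n → ℤ} {e : Fin n → SignType} {x : E n}
    (hx : x ∈ M.face K e) (i : Fin n) : |M.coord x i - 2 * K i| ≤ 1 := by
  have h := M.mem_face_iff.1 hx i
  split_ifs at h with he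
  · exact h
  · rw [h]
    cases e i <;> simp

lemma face_subset (K : Fin n → ℤ) (e : Fin n → SignType) : M.face K e ⊆ M.face K 0 := fun x hx =>
  M.mem_face_iff.2 fun i => by simpa using M.abs_coord_sub_le_one hx i

lemma skeleton_subset_carrier (j : ℕ) : M.skeleton j ⊆ M.carrier := by
  refine iUnion₂_mono fun K _ => iUnion₂_subset fun e _ => M.face_subset K e

lemma abs_sign_of_ne {a : SignType} (h : a ≠ 0) : |(a : ℝ)| = 1 := by
  cases a <;> simp_all

lemma exists_evenDist_eq_one_of_mem_skeleton {x : E n} (hx : x ∈ M.skeleton j) :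
    ∃ B : Finset (Fin n), B.card = n - j ∧ ∀ i ∈ B, evenDist (M.coord x i) = 1 := by
  simp only [skeleton, mem_iUnion, mem_ofPred_eq, exists_prop] at hx
  obtain ⟨K, -, e, he, hxe⟩ := hx
  refine ⟨Finset.univ.filter fun i => ¬ e i = 0, ?_, fun i hi => ?_⟩
  · have hc := Finset.card_filter_add_card_filter_not (s := (Finset.univ : Finset (Fin n)))
      (fun i => e i = 0)
    rw [Finset.card_univ, Fintype.card_fin] at hc
    unfold faceDim at he
    omega
  · rw [Finset.mem_filter] at hi
    have h := M.mem_face_iff.1 hxe i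
    rw [if_neg hi.2] at h
    rw [evenDist_eq (M.abs_coord_sub_le_one hxe i), h, abs_sign_of_ne hi.2]

lemma depth_coord_of_mem_skeleton (hj : j < n) {x : E n} (hx : x ∈ M.skeleton j) :
    depth j (M.coord x) = 1 := by
  obtain ⟨B, hB, h⟩ := M.exists_evenDist_eq_one_of_mem_skeleton hx
  exact depth_eq_one hj hB.ge h

lemma gridStretch_one (a : ℝ) : gridStretch 1 a = a := by
  unfold gridStretch
  rw [div_one, clamp_of_abs_le (evenDist_le_one a)]
  ring

lemma proj_of_mem_skeleton (hj : j < n) {x : E n} (hx : x ∈ M.skeleton j) : M.proj j x = x := by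
  apply M.coord_injective
  rw [coord_proj]
  ext i
  rw [skelProj_apply, M.depth_coord_of_mem_skeleton hj hx, gridStretch_one]

/-- At least n - j coordinates are at distance no less than the depth from the centre. Dividing by
the depth pushes them out to ±1, so they become the fixed coordinates of a j-dimensional face. -/
lemma proj_mem_skeleton (hj : j < n) {K : Fin n → ℤ} (hK : K ∈ M.cells) {x : E n}
    (hx : x ∈ M.face K 0) (hd : depth j (M.coord x) ≠ 0) : M.proj j x ∈ M.skeleton j := by
  have hd0 : 0 < depth j (M.coord x) := (depth_nonneg _ _).lt_of_ne' hd
  have hd1 := depth_le_one hj (M.coord x)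
  obtain ⟨B, hBs, hB⟩ := Finset.exists_subset_card_eq (card_filter_depth_le hj (M.coord x))
  classical
  -- With ties there may be more than n - j saturated coordinates; `B` keeps exactly n - j of them,
  -- so that the face has dimension j.
  let e : Fin n → SignType := fun i => if i ∈ B then SignType.sign (M.coord x i - 2 * K i) else 0
  have hlow : ∀ i ∈ B, depth j (M.coord x) ≤ |M.coord x i - 2 * K i| := fun i hi => by
    have := hBs hi
    rwa [Finset.mem_filter, evenDist_eq (M.abs_coord_sub_le_one hx i), and_iff_right
      (Finset.mem_univ i)] at this
  have hne : ∀ i ∈ B, M.coord x i - 2 * K i ≠ 0 := fun i hi h => by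
    have := hlow i hi
    rw [h, abs_zero] at this
    linarith
  have he0 : ∀ i, e i = 0 ↔ i ∉ B := fun i => by
    by_cases hi : i ∈ B
    · simp only [e, hi, if_true, not_true_eq_false, iff_false, sign_eq_zero_iff]
      exact hne i hi
    · simp [e, hi]
  simp only [skeleton, mem_iUnion, mem_ofPred_eq, exists_prop]
  refine ⟨K, hK, e, ?_, M.mem_face_iff.2 fun i => ?_⟩
  · have : (Finset.univ.filter fun i => e i = 0) = Bᶜ := by
      ext i; simp [he0]
    rw [faceDim, this, Finset.card_compl, hB, Fintype.card_fin]
    omega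
  · rw [coord_proj, skelProj_apply, gridStretch_eq hd0 hd1 (M.abs_coord_sub_le_one hx i),
      add_sub_cancel_left]
    split_ifs with h
    · exact abs_le.2 ⟨neg_one_le_clamp _, clamp_le_one _⟩
    · have hi : i ∈ B := by simpa [he0] using h
      simp only [e, hi, if_true]
      have hl := hlow i hi
      rcases lt_or_gt_of_ne (hne i hi) with h0 | h0
      · rw [abs_of_neg h0] at hl
        rw [sign_neg h0, clamp_of_le_neg_one]
        · simp
        · rw [div_le_iff₀ hd0]; linarith
      · rw [abs_of_pos h0] at hl
        rw [sign_pos h0, clamp_of_one_le]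
        · simp
        · rw [le_div_iff₀ hd0]; linarith

/-- Here r is the sup-norm distance to the centre of the face in mesh units. The fixed coordinates
agree with those of the centre, so they do not contribute to r and are not moved. -/
lemma coord_radialProj {K : Fin n → ℤ} {e : Fin n → SignType} {x : E n} (hx : x ∈ M.face K e)
    (hxc : x ≠ M.faceCenter K e) :
    ∃ r : ℝ, 0 < r ∧ r ≤ 1 ∧ (∀ i, e i = 0 → |M.coord x i - 2 * K i| ≤ r) ∧
      (∀ i, e i = 0 → M.coord (M.radialProj K e x) i - 2 * K i = (M.coord x i - 2 * K i) / r) ∧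
      ∀ i, e i ≠ 0 → M.coord (M.radialProj K e x) i = M.coord x i := by
  have hε := M.ε_pos
  have hpos : 0 < ‖WithLp.ofLp (x - M.faceCenter K e)‖ := by
    rw [norm_pos_iff]
    intro h
    apply hxc
    rw [← sub_eq_zero]
    ext i
    exact congrFun h i
  have hc : ∀ i, (x - M.faceCenter K e).ofLp i =
      M.ε * (M.coord x i - M.coord (M.faceCenter K e) i) := fun i => by
    have := congrArg (fun y : E n => M.ε * y i) (M.coord_sub_coord x (M.faceCenter K e))
    simp only [PiLp.sub_apply, PiLp.smul_apply, smul_eq_mul] at this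
    rw [this, mul_inv_cancel_left₀ hε.ne', PiLp.sub_apply]
  have hrad : ∀ i, M.coord (M.radialProj K e x) i = M.coord (M.faceCenter K e) i +
      (M.coord x i - M.coord (M.faceCenter K e) i) /
        (‖WithLp.ofLp (x - M.faceCenter K e)‖ / M.ε) := fun i => by
    have h := hc i
    rw [coord_apply, coord_apply, coord_apply, radialProj, PiLp.add_apply, PiLp.smul_apply,
      PiLp.sub_apply, smul_eq_mul]
    generalize ‖WithLp.ofLp (x - M.faceCenter K e)‖ = ν at hpos ⊢
    field_simp
    ring
  refine ⟨‖WithLp.ofLp (x - M.faceCenter K e)‖ / M.ε, by positivity, ?_, fun i hi => ?_,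
    fun i hi => ?_, fun i hi => ?_⟩
  · rw [div_le_one hε]
    refine (pi_norm_le_iff_of_nonneg hε.le).2 fun i => ?_
    rw [hc, M.coord_faceCenter, Real.norm_eq_abs, abs_mul, abs_of_pos hε]
    refine mul_le_of_le_one_right hε.le ?_
    have h := M.mem_face_iff.1 hx i
    split_ifs at h with hi
    · simpa [hi] using h
    · rw [← sub_sub, h]
      simp
  · rw [le_div_iff₀ hε]
    have h := norm_le_pi_norm (WithLp.ofLp (x - M.faceCenter K e)) i
    rw [hc, M.coord_faceCenter, hi, Real.norm_eq_abs, abs_mul, abs_of_pos hε] at h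
    rw [mul_comm]
    simpa using h
  · rw [hrad, M.coord_faceCenter, hi]
    simp
  · have h := M.mem_face_iff.1 hx i
    rw [if_neg hi] at h
    rw [hrad, M.coord_faceCenter, ← h]
    simp

/-- The depth is homogeneous on the faces of dimension larger than `j`. -/
lemma depth_coord_radialProj {K : Fin n → ℤ} {e : Fin n → SignType} (he : j < faceDim e)
    {x y : E n} (hx : ∀ i, |M.coord x i - 2 * K i| ≤ 1) {r : ℝ} (hr : 0 < r) (hr1 : r ≤ 1)
    (hxr : ∀ i, e i = 0 → |M.coord x i - 2 * K i| ≤ r)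
    (hy : ∀ i, e i = 0 → M.coord y i - 2 * K i = (M.coord x i - 2 * K i) / r)
    (hx' : ∀ i, e i ≠ 0 → |M.coord x i - 2 * K i| = 1)
    (hy' : ∀ i, e i ≠ 0 → M.coord y i = M.coord x i) :
    depth j (M.coord y) = depth j (M.coord x) / r := by
  have hj : j < n := he.trans_le (by
    unfold faceDim
    simpa using Finset.card_le_univ (Finset.univ.filter fun i => e i = 0))
  have hX : ∀ i, evenDist (M.coord x i) = |M.coord x i - 2 * K i| := fun i => evenDist_eq (hx i)
  have hY0 : ∀ i, e i = 0 → evenDist (M.coord y i) = evenDist (M.coord x i) / r := fun i hi => by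
    rw [hX, evenDist_eq (k := K i), hy i hi, abs_div, abs_of_pos hr]
    rw [hy i hi, abs_div, abs_of_pos hr, div_le_one hr]
    exact hxr i hi
  have hX1 : ∀ i, e i ≠ 0 → evenDist (M.coord x i) = 1 := fun i hi => (hX i).trans (hx' i hi)
  have hY1 : ∀ i, e i ≠ 0 → evenDist (M.coord y i) = 1 := fun i hi => by rw [hy' i hi, hX1 i hi]
  -- A face of dimension greater than j has at least j + 1 free coordinates, all at distance at most
  -- r. This settles the case below in which a minimising set contains a fixed coordinate.
  have hdr : depth j (M.coord x) ≤ r := by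
    obtain ⟨A, hAs, hA⟩ := Finset.exists_subset_card_eq (Nat.succ_le_of_lt he)
    refine (depth_le_iff hj).2 ⟨A, hA, fun i hi => ?_⟩
    have : e i = 0 := by simpa using hAs hi
    exact hX i ▸ hxr i this
  rw [eq_div_iff hr.ne']
  apply le_antisymm
  · rw [← le_div_iff₀ hr]
    obtain ⟨A, hA, hz⟩ := (depth_le_iff hj).1 (le_refl (depth j (M.coord x)))
    refine (depth_le_iff hj).2 ⟨A, hA, fun i hi => ?_⟩
    have h := hz i hi
    by_cases h0 : e i = 0
    · rw [hY0 i h0]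
      gcongr
    · rw [hX1 i h0] at h
      rw [hY1 i h0, one_le_div hr]
      linarith
  · obtain ⟨A, hA, hz⟩ := (depth_le_iff hj).1 (le_refl (depth j (M.coord y)))
    by_cases hA0 : ∀ i ∈ A, e i = 0
    · refine (depth_le_iff hj).2 ⟨A, hA, fun i hi => ?_⟩
      have h := hz i hi
      rwa [hY0 i (hA0 i hi), div_le_iff₀ hr] at h
    · push Not at hA0
      obtain ⟨i, hi, h0⟩ := hA0
      have h := hz i hi
      rw [hY1 i h0] at h
      exact hdr.trans (le_mul_of_one_le_left hr.le h)

/-- Composition with the retraction yields piecewise `j`-homogeneous maps. -/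
theorem isPiecewiseHomogeneous_comp_proj {m : ℕ} (j : ℕ) (g : E n → E m) (o : E m) :
    M.IsPiecewiseHomogeneous j
      (fun x => if depth j (M.coord x) = 0 then o else g (M.proj j x)) := by
  intro K _ e he x hx hxc
  have hj : j < n := he.trans_le (by
    unfold faceDim
    simpa using Finset.card_le_univ (Finset.univ.filter fun i => e i = 0))
  obtain ⟨r, hr, hr1, hxr, hy, hy'⟩ := M.coord_radialProj hx hxc
  set y := M.radialProj K e x
  have hx1 := M.abs_coord_sub_le_one hx
  have hx' : ∀ i, e i ≠ 0 → |M.coord x i - 2 * K i| = 1 := fun i hi => by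
    have h := M.mem_face_iff.1 hx i
    rw [if_neg hi] at h
    rw [h, abs_sign_of_ne hi]
  have hD := M.depth_coord_radialProj he hx1 hr hr1 hxr hy hx' hy'
  have hiff : depth j (M.coord y) = 0 ↔ depth j (M.coord x) = 0 := by
    rw [hD, div_eq_zero_iff, or_iff_left hr.ne']
  by_cases h0 : depth j (M.coord x) = 0
  · simp only [h0, hiff.2 h0, if_true]
  have h0' : ¬ depth j (M.coord y) = 0 := fun h => h0 (hiff.1 h)
  simp only [h0, h0', if_false]
  congr 1
  apply M.coord_injective
  rw [coord_proj, coord_proj]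
  have hx0 : 0 < depth j (M.coord x) := (depth_nonneg _ _).lt_of_ne' h0
  have hy0 : 0 < depth j (M.coord y) := (depth_nonneg _ _).lt_of_ne' h0'
  ext i
  rw [skelProj_apply, skelProj_apply]
  -- On a free coordinate the factor 1 / r cancels between the coordinate and the depth. A fixed
  -- coordinate is ±1 relative to the centre, and no truncated dilation with parameter at most 1
  -- moves it.
  by_cases hi : e i = 0
  · have hyi : |M.coord y i - 2 * K i| ≤ 1 := by
      rw [hy i hi, abs_div, abs_of_pos hr, div_le_one hr]
      exact hxr i hi
    rw [gridStretch_eq hx0 (depth_le_one hj _) (hx1 i),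
      gridStretch_eq hy0 (depth_le_one hj _) hyi, hy i hi, hD,
      div_div_div_cancel_right₀ hr.ne']
  · rw [hy' i hi, gridStretch_eq hx0 (depth_le_one hj _) (hx1 i),
      gridStretch_eq hy0 (depth_le_one hj _) (hx1 i)]
    have : ∀ t : ℝ, 0 < t → t ≤ 1 →
        clamp ((M.coord x i - 2 * K i) / t) = M.coord x i - 2 * K i := fun t ht ht1 => by
      rcases (abs_eq zero_le_one).1 (hx' i hi) with h | h <;> rw [h]
      · exact clamp_of_one_le ((one_le_div ht).2 ht1)
      · rw [neg_div, clamp_neg, clamp_of_one_le ((one_le_div ht).2 ht1)]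
    rw [this _ hx0 (depth_le_one hj _), this _ hy0 (depth_le_one hj _)]

/-! ### Meshes covering a compact set -/

lemma norm_sub_le_of_mem_face {K : Fin n → ℤ} {x y : E n} (hx : x ∈ M.face K 0)
    (hy : y ∈ M.face K 0) : ‖x - y‖ ≤ √n * (2 * M.ε) := by
  have hε := M.ε_pos
  refine norm_le_sqrt_mul (by positivity) fun i => ?_
  have hx := hx i
  have hy := hy i
  simp only [Pi.zero_apply, if_true] at hx hy
  rw [PiLp.sub_apply]
  rw [abs_le] at hx hy ⊢
  constructor <;> linarith

lemma isCompact_face (K : Fin n → ℤ) (e : Fin n → SignType) : IsCompact (M.face K e) := by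
  refine Metric.isCompact_of_isClosed_isBounded ?_ ?_
  · simp only [face, Set.ofPred_forall]
    refine isClosed_iInter fun i => ?_
    split_ifs
    · exact isClosed_le (by fun_prop) continuous_const
    · exact isClosed_eq (by fun_prop) continuous_const
  · refine Metric.isBounded_iff.2 ⟨√n * (2 * M.ε), fun x hx y hy => ?_⟩
    rw [dist_eq_norm]
    exact M.norm_sub_le_of_mem_face (M.face_subset K e hx) (M.face_subset K e hy)

lemma isCompact_carrier : IsCompact M.carrier :=
  M.cells.isCompact_biUnion fun K _ => M.isCompact_face K 0

lemma exists_covering (T : E n) {ε : ℝ} (hε : 0 < ε) {S : Set (E n)}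
    (hS : Bornology.IsBounded S) :
    ∃ M : Mesh n, M.T = T ∧ M.ε = ε ∧ S ⊆ M.carrier ∧
      ∀ x ∈ M.carrier, ∃ y ∈ S, ‖x - y‖ ≤ √n * (2 * ε) := by
  let M₀ : Mesh n := ⟨T, ε, hε, ∅⟩
  obtain ⟨R, hR⟩ := (Metric.isBounded_iff_subset_closedBall T).1 hS
  have hfin : {K : Fin n → ℤ | (M₀.face K 0 ∩ S).Nonempty}.Finite := by
    refine (Set.Finite.pi' fun _ : Fin n => Set.finite_Icc (-⌈R / ε + 1⌉) ⌈R / ε + 1⌉).subset ?_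
    rintro K ⟨x, hx, hxS⟩ i
    have h1 := M₀.abs_coord_sub_le_one hx i
    have h2 : |M₀.coord x i| ≤ R / ε := by
      rw [coord_apply, abs_div, abs_of_pos M₀.ε_pos]
      gcongr
      have := hR hxS
      rw [mem_closedBall_iff_norm] at this
      exact (abs_apply_le_norm (x - T) i).trans this
    have h3 : |(K i : ℝ)| ≤ R / ε + 1 := by
      rw [abs_le] at h1 h2 ⊢
      constructor <;> linarith
    have h4 := Int.le_ceil (R / ε + 1)
    rw [abs_le] at h3
    constructor
    · have : -(⌈R / ε + 1⌉ : ℝ) ≤ K i := by linarith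
      exact_mod_cast this
    · have : (K i : ℝ) ≤ ⌈R / ε + 1⌉ := by linarith
      exact_mod_cast this
  refine ⟨⟨T, ε, hε, hfin.toFinset⟩, rfl, rfl, fun x hx => ?_, fun x hx => ?_⟩
  · have hmem : x ∈ M₀.face (fun i => round (M₀.coord x i / 2)) 0 :=
      M₀.mem_face_iff.2 fun i => by
        rw [Pi.zero_apply, if_pos rfl]
        exact evenDist_le_one (M₀.coord x i)
    refine mem_iUnion₂.2 ⟨fun i => round (M₀.coord x i / 2), ?_, hmem⟩
    rw [Set.Finite.mem_toFinset]
    exact ⟨x, hmem, hx⟩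
  · obtain ⟨K, hK, hxK⟩ := mem_iUnion₂.1 hx
    rw [Set.Finite.mem_toFinset] at hK
    obtain ⟨y, hy, hyS⟩ := hK
    exact ⟨y, hyS, norm_sub_le_of_mem_face ⟨T, ε, hε, hfin.toFinset⟩ hxK hy⟩

end Mesh

end FracSobolev
end

noncomputable section
namespace FracSobolev
open MeasureTheory Set
open scoped ENNReal Pointwise

/-! ### Integrals of powers of the norm -/

section Measure

variable {n j : ℕ}

lemma lintegral_eq_mul_lintegral_comp_smul {r : ℝ} (hr : 0 < r) {g : E n → ℝ≥0∞}
    (hg : Measurable g) :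
    ∫⁻ x, g x = ENNReal.ofReal r ^ (n : ℝ) * ∫⁻ x, g (r • x) := by
  have h := Measure.map_addHaar_smul (volume : Measure (E n)) hr.ne'
  rw [← lintegral_map hg (measurable_const_smul r), h, lintegral_smul_measure, smul_eq_mul,
    finrank_euclideanSpace_fin, abs_of_pos (by positivity), ← mul_assoc, ENNReal.rpow_natCast,
    ENNReal.ofReal_inv_of_pos (by positivity), ENNReal.ofReal_pow hr.le, ENNReal.mul_inv_cancel,
    one_mul]
  · exact pow_ne_zero _ (by simpa using hr)
  · exact ENNReal.pow_ne_top ENNReal.ofReal_ne_top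

lemma enorm_rpow_eq_ofReal {V : Type*} [NormedAddCommGroup V] {x : V} (hx : x ≠ 0) (a : ℝ) :
    ‖x‖ₑ ^ a = ENNReal.ofReal (‖x‖ ^ a) := by
  rw [← ofReal_norm, ENNReal.ofReal_rpow_of_pos (norm_pos_iff.2 hx)]

/-- The tails of the kernel `|h| ^ (-n-σ)`. -/
lemma exists_lintegral_tail_le {σ : ℝ} (hσ : 0 < σ) :
    ∃ κ : ℝ≥0∞, κ ≠ ∞ ∧ ∀ r : ℝ, 0 < r →
      ∫⁻ h : E n in {h | r ≤ ‖h‖}, ‖h‖ₑ ^ (-((n : ℝ) + σ)) ≤ κ * ENNReal.ofReal r ^ (-σ) := by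
  set q : ℝ := n + σ with hq
  have hq0 : 0 < q := by positivity
  have hms : ∀ r : ℝ, MeasurableSet {h : E n | r ≤ ‖h‖} := fun r =>
    measurableSet_le measurable_const measurable_norm
  refine ⟨∫⁻ h : E n in {h | 1 ≤ ‖h‖}, ‖h‖ₑ ^ (-q), ?_, fun r hr => ?_⟩
  · have hfin := finite_integral_one_add_norm (E := E n) (μ := volume) (r := q)
      (by simpa [hq] using hσ)
    have hle : ∫⁻ h : E n in {h | 1 ≤ ‖h‖}, ‖h‖ₑ ^ (-q) ≤
        ∫⁻ h : E n, ENNReal.ofReal (2 ^ q) * ENNReal.ofReal ((1 + ‖h‖) ^ (-q)) := by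
      refine (setLIntegral_mono' (hms 1) fun h hh => ?_).trans (setLIntegral_le_lintegral _ _)
      have hh' : (1 : ℝ) ≤ ‖h‖ := hh
      have h0 : h ≠ 0 := norm_pos_iff.1 (by linarith)
      rw [enorm_rpow_eq_ofReal h0, ← ENNReal.ofReal_mul (by positivity)]
      refine ENNReal.ofReal_le_ofReal ?_
      calc ‖h‖ ^ (-q) = 2 ^ q * (2 * ‖h‖) ^ (-q) := by
            rw [Real.mul_rpow (by norm_num) (norm_nonneg _), ← mul_assoc,
              ← Real.rpow_add (by norm_num)]
            simp
        _ ≤ 2 ^ q * (1 + ‖h‖) ^ (-q) := by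
            refine mul_le_mul_of_nonneg_left ?_ (by positivity)
            exact Real.rpow_le_rpow_of_nonpos (by positivity) (by linarith) (by linarith)
    refine (hle.trans_lt ?_).ne
    rw [lintegral_const_mul' _ _ ENNReal.ofReal_ne_top]
    exact ENNReal.mul_lt_top ENNReal.ofReal_lt_top hfin
  · rw [← lintegral_indicator (hms r), ← lintegral_indicator (hms 1),
      lintegral_eq_mul_lintegral_comp_smul hr
        ((by fun_prop : Measurable fun h : E n => ‖h‖ₑ ^ (-q)).indicator (hms r))]
    have e : ∀ x : E n, ({h : E n | r ≤ ‖h‖}.indicator (fun h => ‖h‖ₑ ^ (-q)) (r • x)) =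
        ENNReal.ofReal r ^ (-q) * {h : E n | 1 ≤ ‖h‖}.indicator (fun h => ‖h‖ₑ ^ (-q)) x := by
      intro x
      have hiff : r ≤ ‖r • x‖ ↔ 1 ≤ ‖x‖ := by
        rw [norm_smul, Real.norm_eq_abs, abs_of_pos hr]
        exact le_mul_iff_one_le_right hr
      by_cases hx : 1 ≤ ‖x‖
      · have hx0 : x ≠ 0 := norm_pos_iff.1 (by linarith)
        rw [indicator_of_mem (by exact hiff.2 hx), indicator_of_mem (by exact hx),
          enorm_rpow_eq_ofReal (smul_ne_zero hr.ne' hx0), enorm_rpow_eq_ofReal hx0,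
          ENNReal.ofReal_rpow_of_pos hr, ← ENNReal.ofReal_mul (by positivity), norm_smul,
          Real.norm_eq_abs, abs_of_pos hr, Real.mul_rpow hr.le (norm_nonneg _)]
      · rw [indicator_of_notMem (s := {h : E n | r ≤ ‖h‖}) (fun h => hx (hiff.1 h)),
          indicator_of_notMem (s := {h : E n | 1 ≤ ‖h‖}) hx, mul_zero]
    simp_rw [e]
    rw [lintegral_const_mul' _ _ (by
      rw [ENNReal.ofReal_rpow_of_pos hr]; exact ENNReal.ofReal_ne_top), ← mul_assoc,
      ENNReal.ofReal_rpow_of_pos hr, ENNReal.ofReal_rpow_of_pos hr, ENNReal.ofReal_rpow_of_pos hr,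
      ← ENNReal.ofReal_mul (by positivity), ← Real.rpow_add hr, mul_comm]
    rw [show (n : ℝ) + -q = -σ by rw [hq]; ring]

lemma lintegral_ball_enorm_rpow_lt_top (hn : 0 < n) {a : ℝ} (ha : -(n : ℝ) < a) (r : ℝ) :
    ∫⁻ h : E n in Metric.ball 0 r, ‖h‖ₑ ^ a < ∞ := by
  have : Nontrivial (E n) := by
    have : Nonempty (Fin n) := ⟨⟨0, hn⟩⟩
    infer_instance
  have hintg : IntegrableOn (fun h : E n => ‖h‖ ^ a) (Metric.ball 0 r) := by
    rw [integrableOn_fun_norm_addHaar volume (f := fun y => y ^ a), finrank_euclideanSpace_fin]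
    have h1 : IntegrableOn (fun y : ℝ => y ^ ((n : ℝ) - 1 + a)) (Ioo 0 r) := by
      rcases le_total r 0 with hr | hr
      · rw [Ioo_eq_empty (by simpa using hr)]; exact integrableOn_empty
      exact ((intervalIntegrable_iff_integrableOn_Ioc_of_le hr).1
        (intervalIntegral.intervalIntegrable_rpow' (by linarith))).mono_set Ioo_subset_Ioc_self
    refine h1.congr_fun (fun y hy => ?_) measurableSet_Ioo
    simp only
    rw [smul_eq_mul, Real.rpow_add hy.1, ← Real.rpow_natCast, Nat.cast_sub hn, Nat.cast_one]
  refine lt_of_le_of_lt (lintegral_mono_ae ?_) hintg.lintegral_lt_top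
  have : ∀ᵐ h : E n, h ≠ 0 := by
    simp [ae_iff]
  filter_upwards [ae_restrict_of_ae this] with h hh
  exact (enorm_rpow_eq_ofReal hh a).le

/-! ### Averages over a period cell -/

/-- A period cell of the lattice `2 ℤⁿ`. -/
def cell (n : ℕ) : Set (E n) := {z | ∀ i, z i ∈ Ico (0 : ℝ) 2}

lemma cell_eq_preimage : cell n = WithLp.ofLp ⁻¹' (univ.pi fun _ : Fin n => Ico (0 : ℝ) 2) := by
  ext z; simp [cell]

lemma measurableSet_cell : MeasurableSet (cell n) := by
  rw [cell_eq_preimage]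
  exact (PiLp.volume_preserving_ofLp (Fin n)).measurable
    (MeasurableSet.univ_pi fun _ => measurableSet_Ico)

lemma volume_cell : volume (cell n) = 2 ^ n := by
  rw [cell_eq_preimage, (PiLp.volume_preserving_ofLp (Fin n)).measure_preimage
    (MeasurableSet.univ_pi fun _ => measurableSet_Ico).nullMeasurableSet, volume_pi_pi]
  simp

lemma volume_cell_ne_zero : volume (cell n) ≠ 0 := by
  rw [volume_cell]; simp

lemma volume_cell_ne_top : volume (cell n) ≠ ∞ := by
  rw [volume_cell]; simp

/-- The vectors `2 eᵢ`. -/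
def doubleBasis (n : ℕ) : Module.Basis (Fin n) ℝ (E n) :=
  (EuclideanSpace.basisFun (Fin n) ℝ).toBasis.isUnitSMul (w := fun _ => (2 : ℝ))
    fun _ => isUnit_iff_ne_zero.2 two_ne_zero

lemma doubleBasis_repr (z : E n) (i : Fin n) : (doubleBasis n).repr z i = z i / 2 := by
  rw [doubleBasis, Module.Basis.repr_isUnitSMul, Units.smul_def, Units.val_inv_eq_inv_val,
    IsUnit.unit_spec, smul_eq_mul, div_eq_inv_mul]
  rfl

lemma fundamentalDomain_doubleBasis : ZSpan.fundamentalDomain (doubleBasis n) = cell n := by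
  ext z
  simp only [ZSpan.mem_fundamentalDomain, doubleBasis_repr, cell, mem_ofPred_eq, mem_Ico]
  refine forall_congr' fun i => and_congr ?_ ?_
  · constructor <;> intro h <;> linarith
  · constructor <;> intro h <;> linarith

/-- The cell and its translate are both fundamental domains of the lattice 2ℤⁿ, and an invariant
function has the same integral over each. -/
lemma lintegral_cell_comp_add {Φ : E n → ℝ≥0∞}
    (hΦ : ∀ (z : E n) (k : Fin n → ℤ), Φ (z + WithLp.toLp 2 fun i => 2 * (k i : ℝ)) = Φ z)
    (a : E n) : ∫⁻ z in cell n, Φ (a + z) = ∫⁻ z in cell n, Φ z := by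
  have hD := ZSpan.isAddFundamentalDomain' (doubleBasis n) (volume : Measure (E n))
  rw [fundamentalDomain_doubleBasis] at hD
  have hD' : IsAddFundamentalDomain (Submodule.span ℤ (range (doubleBasis n))).toAddSubgroup
      (a +ᵥ cell n) volume := hD.vadd_of_comm a
  have : Countable (Submodule.span ℤ (range (doubleBasis n))).toAddSubgroup :=
    inferInstanceAs (Countable (Submodule.span ℤ (range (doubleBasis n))))
  rw [hD.setLIntegral_eq hD' Φ]
  · exact (measurePreserving_add_left volume a).setLIntegral_comp_emb
      (measurableEmbedding_addLeft a) Φ (cell n)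
  · rintro ⟨g, hg⟩ x
    have hg' := (Module.Basis.mem_span_iff_repr_mem ℤ (doubleBasis n) g).1 hg
    choose k hk using hg'
    have : g = WithLp.toLp 2 fun i => 2 * (k i : ℝ) := by
      ext i
      have h := hk i
      rw [doubleBasis_repr] at h
      simp only [algebraMap_int_eq, eq_intCast] at h
      simp only
      linarith
    change Φ (g + x) = Φ x
    rw [this, add_comm, hΦ]

/-- Averaging over the translates of the grid decouples the grid from the space variable. -/
lemma lintegral_cell_lintegral_comp {Φ : E n → E n → ℝ≥0∞}
    (hm : Measurable (Function.uncurry Φ))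
    (hΦ : ∀ (x z : E n) (k : Fin n → ℤ),
      Φ x (z + WithLp.toLp 2 fun i => 2 * (k i : ℝ)) = Φ x z) (ε : ℝ) :
    ∫⁻ τ in cell n, ∫⁻ x, Φ x (ε⁻¹ • x + τ) = ∫⁻ z in cell n, ∫⁻ x, Φ x z := by
  rw [lintegral_lintegral_swap (f := fun τ x => Φ x (ε⁻¹ • x + τ)),
    lintegral_lintegral_swap (f := fun z x => Φ x z)]
  -- Once x is fixed, ε⁻¹ x only translates the cell in the periodic variable.
  · exact lintegral_congr fun x => lintegral_cell_comp_add (hΦ x) _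
  · exact (hm.comp measurable_swap).aemeasurable
  · exact (Measurable.comp (f := fun p : E n × E n => (p.2, ε⁻¹ • p.2 + p.1)) hm
      (by fun_prop)).aemeasurable

/-! ### The depth vanishes on a null set and has integrable negative powers -/

lemma ae_apply_ne (i : Fin n) (c : ℝ) : ∀ᵐ x : E n, x i ≠ c := by
  have h := Measure.pi_hyperplane (fun _ : Fin n => (volume : Measure ℝ)) i c
  have h2 := (PiLp.volume_preserving_ofLp (Fin n)).measure_preimage (s := {f | f i = c})
    (measurableSet_eq_fun (measurable_pi_apply i) measurable_const).nullMeasurableSet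
  rw [ae_iff]
  simp only [ne_eq, not_not]
  exact h2.trans h

lemma evenDist_eq_zero {a : ℝ} (h : evenDist a = 0) : ∃ k : ℤ, a = 2 * k :=
  ⟨round (a / 2), by
    have := abs_eq_zero.1 h
    linarith⟩

lemma ae_evenDist_ne_zero : ∀ᵐ z : E n, ∀ i, evenDist (z i) ≠ 0 := by
  have : ∀ᵐ z : E n, ∀ i, ∀ k : ℤ, z i ≠ 2 * k :=
    ae_all_iff.2 fun i => ae_all_iff.2 fun k => ae_apply_ne i _
  filter_upwards [this] with z hz i h
  obtain ⟨k, hk⟩ := evenDist_eq_zero h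
  exact hz i k hk

lemma depth_ne_zero_of_forall (hj : j < n) {z : Fin n → ℝ} (h : ∀ i, evenDist (z i) ≠ 0) :
    depth j z ≠ 0 := fun h0 => by
  obtain ⟨A, hA, hz⟩ := (depth_le_iff hj).1 h0.le
  obtain ⟨i, hi⟩ : A.Nonempty := Finset.card_pos.1 (by omega)
  exact h i (le_antisymm (hz i hi) (evenDist_nonneg _))

lemma ae_depth_ne_zero (hj : j < n) : ∀ᵐ z : E n, depth j z ≠ 0 := by
  filter_upwards [ae_evenDist_ne_zero] with z hz using depth_ne_zero_of_forall hj hz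

lemma ae_depth_coord_ne_zero (hj : j < n) (M : Mesh n) : ∀ᵐ x : E n, depth j (M.coord x) ≠ 0 := by
  have hε := M.ε_pos.ne'
  have : ∀ᵐ x : E n, ∀ i, ∀ k : ℤ, x i ≠ M.T i + 2 * k * M.ε :=
    ae_all_iff.2 fun i => ae_all_iff.2 fun k => ae_apply_ne i _
  filter_upwards [this] with x hx
  refine depth_ne_zero_of_forall hj fun i h => ?_
  obtain ⟨k, hk⟩ := evenDist_eq_zero h
  rw [M.coord_apply, div_eq_iff hε] at hk
  exact hx i k (by linarith)

lemma integrableOn_evenDist_rpow {a : ℝ} (ha : a < 1) :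
    IntegrableOn (fun t => evenDist t ^ (-a)) (Ico 0 2) := by
  have h1 : IntegrableOn (fun t : ℝ => t ^ (-a)) (Ioc 0 1) :=
    (intervalIntegrable_iff_integrableOn_Ioc_of_le zero_le_one).1
      (intervalIntegral.intervalIntegrable_rpow' (by linarith))
  have h2 : IntegrableOn (fun t : ℝ => (2 - t) ^ (-a)) (Ioc 1 2) := by
    have h := (intervalIntegral.intervalIntegrable_rpow' (r := -a) (a := 0) (b := 1)
      (by linarith)).comp_sub_left 2
    norm_num at h
    exact (intervalIntegrable_iff_integrableOn_Ioc_of_le (by norm_num)).1 h.symm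
  have h3 : IntegrableOn (fun t => evenDist t ^ (-a)) (Ioc 0 1) :=
    h1.congr_fun (fun t ht => by
      have : |t - 2 * ((0 : ℤ) : ℝ)| = t := by simp [abs_of_pos ht.1]
      simp only
      rw [evenDist_eq (k := 0) (by rw [this]; exact ht.2), this]) measurableSet_Ioc
  have h4 : IntegrableOn (fun t => evenDist t ^ (-a)) (Ioc 1 2) :=
    h2.congr_fun (fun t ht => by
      have : |t - 2 * ((1 : ℤ) : ℝ)| = 2 - t := by
        rw [abs_sub_comm, Int.cast_one, mul_one, abs_of_nonneg (by linarith [ht.2])]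
      simp only
      rw [evenDist_eq (k := 1) (by rw [this]; linarith [ht.1]), this]) measurableSet_Ioc
  have h5 := h3.union h4
  rw [Ioc_union_Ioc_eq_Ioc zero_le_one one_le_two] at h5
  exact h5.congr_set_ae Ico_ae_eq_Ioc

/-- Some j + 1 coordinates have `evenDist` at most the depth, so depth ^ (-σ) is at most the product
of their powers with exponent -σ / (j + 1). Summing over all sets of j + 1 coordinates removes the
dependence on the point, and each factor is integrable over a period because σ / (j + 1) < 1. -/
lemma lintegral_cell_depth_rpow_lt_top (hj : j < n) {σ : ℝ} (hσ0 : 0 < σ) (hσ : σ < j + 1) :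
    ∫⁻ z in cell n, ENNReal.ofReal (depth j z) ^ (-σ) < ∞ := by
  classical
  set a := σ / (j + 1) with ha
  have ha1 : a < 1 := by rw [ha, div_lt_one (by positivity)]; exact hσ
  have haσ : (j + 1 : ℕ) * a = σ := by rw [ha]; push_cast; field_simp
  have ha0 : 0 < a := by positivity
  let w : Finset (Fin n) → Fin n → ℝ → ℝ := fun A i t => if i ∈ A then evenDist t ^ (-a) else 1
  have hintg : ∀ A, IntegrableOn (fun z : Fin n → ℝ => ∏ i, w A i (z i))
      (univ.pi fun _ : Fin n => Ico (0 : ℝ) 2) := fun A => by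
    rw [IntegrableOn, volume_pi, Measure.restrict_pi_pi]
    refine Integrable.fintype_prod (f := w A) fun i => ?_
    by_cases hi : i ∈ A
    · simp only [w, hi, if_true]
      exact integrableOn_evenDist_rpow ha1
    · simp only [w, hi, if_false]
      exact integrable_const _
  have hintg' : IntegrableOn (fun z : E n =>
      ∑ A ∈ Finset.powersetCard (j + 1) Finset.univ, ∏ i, w A i (z i)) (cell n) := by
    refine integrable_finsetSum _ fun A _ => ?_
    rw [cell_eq_preimage]
    exact ((PiLp.volume_preserving_ofLp (Fin n)).integrableOn_comp_preimage
      (MeasurableEquiv.toLp 2 (Fin n → ℝ)).symm.measurableEmbedding).2 (hintg A)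
  refine lt_of_le_of_lt (lintegral_mono_ae ?_) hintg'.lintegral_lt_top
  filter_upwards [ae_restrict_of_ae ae_evenDist_ne_zero] with z hz
  have hpos : ∀ i, 0 < evenDist (z i) := fun i => (evenDist_nonneg _).lt_of_ne' (hz i)
  have hd : 0 < depth j z := (depth_nonneg _ _).lt_of_ne' (depth_ne_zero_of_forall hj hz)
  rw [ENNReal.ofReal_rpow_of_pos hd]
  refine ENNReal.ofReal_le_ofReal ?_
  obtain ⟨A, hA, hAz⟩ := (depth_le_iff hj).1 (le_refl (depth j z))
  have hw : ∀ B i, 0 ≤ w B i (z i) := fun B i => by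
    simp only [w]
    split_ifs
    · exact Real.rpow_nonneg (evenDist_nonneg _) _
    · exact zero_le_one
  refine le_trans ?_ (Finset.single_le_sum (f := fun B => ∏ i, w B i (z i))
    (fun B _ => Finset.prod_nonneg fun i _ => hw B i)
    (Finset.mem_powersetCard.2 ⟨Finset.subset_univ A, hA⟩))
  have e : ∏ i, w A i (z i) = ∏ i ∈ A, evenDist (z i) ^ (-a) := by
    simp only [w]
    rw [Finset.prod_ite_mem, Finset.univ_inter]
  rw [e]
  calc depth j z ^ (-σ) = ∏ i ∈ A, depth j z ^ (-a) := by
        rw [Finset.prod_const, hA, ← Real.rpow_natCast, ← Real.rpow_mul hd.le]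
        congr 1
        rw [← haσ]; ring
    _ ≤ _ := by
        refine Finset.prod_le_prod (fun i _ => by positivity) fun i hi => ?_
        exact Real.rpow_le_rpow_of_nonpos (hpos i) (hAz i hi) (by linarith)

/-- The points with `n - j` coordinates close to the odd integers, a neighbourhood of the
`j`-skeleton of the grid. -/
def nearSkel (j : ℕ) (r : ℝ) : Set (E n) :=
  {z | ∃ B : Finset (Fin n), B.card = n - j ∧ ∀ i ∈ B, 1 - r ≤ evenDist (z i)}

lemma measurableSet_nearSkel (j : ℕ) (r : ℝ) : MeasurableSet (nearSkel j r : Set (E n)) := by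
  have : (nearSkel j r : Set (E n)) = ⋃ B ∈ {B : Finset (Fin n) | B.card = n - j},
      ⋂ i ∈ B, {z | 1 - r ≤ evenDist (z i)} := by
    ext z; simp [nearSkel]
  rw [this]
  refine MeasurableSet.biUnion (Set.to_countable _) fun B _ =>
    MeasurableSet.biInter (Set.to_countable _) fun i _ => ?_
  exact measurableSet_le measurable_const (measurable_evenDist.comp (by fun_prop))

lemma nearSkel_add (j : ℕ) (r : ℝ) (z : E n) (k : Fin n → ℤ) :
    z + (WithLp.toLp 2 fun i => 2 * (k i : ℝ)) ∈ nearSkel j r ↔ z ∈ nearSkel j r := by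
  simp only [nearSkel, mem_ofPred_eq, PiLp.add_apply, evenDist_add]

/-- The only odd integer in [0, 2) is 1, so each choice of n - j coordinates gives a box of side 2r
in those directions and side 2 in the others. -/
lemma volume_cell_inter_nearSkel_le (j : ℕ) (r : ℝ) :
    volume (cell n ∩ nearSkel j r) ≤
      ((Finset.powersetCard (n - j) (Finset.univ : Finset (Fin n))).card * 2 ^ n : ℝ≥0∞) *
        ENNReal.ofReal r ^ (n - j) := by
  classical
  let S : Finset (Fin n) → Set (Fin n → ℝ) := fun B =>
    univ.pi fun i => if i ∈ B then Icc (1 - r) (1 + r) else Ico (0 : ℝ) 2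
  have hSm : ∀ B, MeasurableSet (S B) := fun B => MeasurableSet.univ_pi fun i => by
    split_ifs
    · exact measurableSet_Icc
    · exact measurableSet_Ico
  have hsub : cell n ∩ nearSkel j r ⊆
      ⋃ B ∈ Finset.powersetCard (n - j) (Finset.univ : Finset (Fin n)),
        (WithLp.ofLp ⁻¹' S B : Set (E n)) := by
    rintro z ⟨hz, B, hB, hzB⟩
    refine mem_iUnion₂.2 ⟨B, Finset.mem_powersetCard.2 ⟨Finset.subset_univ _, hB⟩, fun i _ => ?_⟩
    by_cases hi : i ∈ B
    · simp only [hi, if_true]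
      have h0 := evenDist_le (z i) 0
      have h1 := evenDist_le (z i) 1
      have h2 := hzB i hi
      have h3 := hz i
      rw [Int.cast_zero, mul_zero, sub_zero, abs_of_nonneg h3.1] at h0
      rw [Int.cast_one, mul_one, abs_sub_comm, abs_of_nonneg (by linarith [h3.2])] at h1
      constructor <;> linarith
    · simp only [hi, if_false]
      exact hz i
  refine (measure_mono hsub).trans ((measure_biUnion_finset_le _ _).trans ?_)
  rw [mul_assoc, ← nsmul_eq_mul]
  refine Finset.sum_le_card_nsmul _ _ _ fun B hB => ?_
  rw [Finset.mem_powersetCard] at hB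
  rw [(PiLp.volume_preserving_ofLp (Fin n)).measure_preimage (hSm B).nullMeasurableSet,
    volume_pi_pi]
  have : ∀ i, volume (if i ∈ B then Icc (1 - r) (1 + r) else Ico (0 : ℝ) 2) =
      2 * if i ∈ B then ENNReal.ofReal r else 1 := fun i => by
    split_ifs
    · rw [Real.volume_Icc, show 1 + r - (1 - r) = 2 * r by ring,
        ENNReal.ofReal_mul (by norm_num), ENNReal.ofReal_ofNat]
    · simp
  simp_rw [this]
  rw [Finset.prod_mul_distrib, Finset.prod_const, Finset.card_univ, Fintype.card_fin,
    Finset.prod_ite_mem, Finset.univ_inter, Finset.prod_const, hB.2]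

end Measure

end FracSobolev
end

noncomputable section
namespace FracSobolev
open MeasureTheory Set
open scoped ENNReal

/-! ### The `L^p` modulus of continuity -/

section Modulus

variable {n m j : ℕ} {p σ : ℝ}

lemma enorm_add_rpow_le {V : Type*} [NormedAddCommGroup V] (hp : 1 ≤ p) (a b : V) :
    ‖a + b‖ₑ ^ p ≤ 2 ^ (p - 1) * (‖a‖ₑ ^ p + ‖b‖ₑ ^ p) :=
  (ENNReal.rpow_le_rpow (enorm_add_le a b) (by linarith)).trans
    (ENNReal.rpow_add_le_mul_rpow_add_rpow _ _ hp)

lemma enorm_sub_rpow_le {V : Type*} [NormedAddCommGroup V] (hp : 1 ≤ p) (a b : V) :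
    ‖a - b‖ₑ ^ p ≤ 2 ^ (p - 1) * (‖a‖ₑ ^ p + ‖b‖ₑ ^ p) := by
  simpa [sub_eq_add_neg] using enorm_add_rpow_le hp a (-b)

/-- The `p`-th power of the `L^p` norm of the increments of `u` with step `v`. -/
def modp (p : ℝ) (u : E n → E m) (v : E n) : ℝ≥0∞ := ∫⁻ x, ‖u (x + v) - u x‖ₑ ^ p

lemma measurable_modp {u : E n → E m} (hu : Measurable u) : Measurable (modp p u) := by
  unfold modp
  exact Measurable.lintegral_prod_right' (f := fun q : E n × E n => ‖u (q.2 + q.1) - u q.2‖ₑ ^ p)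
    (by fun_prop)

lemma modp_zero (hp : 1 ≤ p) (u : E n → E m) : modp p u 0 = 0 := by
  simp [modp, ENNReal.zero_rpow_of_pos (by linarith : 0 < p)]

lemma modp_add_le (hp : 1 ≤ p) {u : E n → E m} (hu : Measurable u) (v w : E n) :
    modp p u (v + w) ≤ 2 ^ (p - 1) * (modp p u v + modp p u w) := by
  have h1 : modp p u w = ∫⁻ x, ‖u (x + v + w) - u (x + v)‖ₑ ^ p :=
    (lintegral_add_right_eq_self (fun x => ‖u (x + w) - u x‖ₑ ^ p) v).symm
  rw [h1]
  unfold modp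
  rw [← lintegral_add_left (by fun_prop), ← lintegral_const_mul' _ _ (by simp)]
  refine lintegral_mono fun x => ?_
  have h := enorm_add_rpow_le hp (u (x + v) - u x) (u (x + v + w) - u (x + v))
  rw [sub_add_sub_cancel'] at h
  rwa [← add_assoc]

/-- Split v as w + (v - w) and average over w in the ball with diameter [0, v], which is symmetric
under w ↦ v - w and contained in the ball of radius ‖v‖ about 0. A single increment is thereby
bounded by the mean of the smaller ones. -/
lemma exists_modp_le (n : ℕ) (hp : 1 ≤ p) :
    ∃ κ : ℝ≥0∞, κ ≠ ∞ ∧ ∀ {m : ℕ} {u : E n → E m}, Measurable u → ∀ v : E n, v ≠ 0 →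
      modp p u v ≤ κ * ‖v‖ₑ ^ (-(n : ℝ)) * ∫⁻ w in Metric.closedBall 0 ‖v‖, modp p u w := by
  set c := volume (Metric.ball (0 : E n) 1) with hc
  have hc0 : c ≠ 0 := (Metric.measure_ball_pos _ _ one_pos).ne'
  have hct : c ≠ ∞ := measure_ball_lt_top.ne
  refine ⟨2 ^ (n : ℝ) * c⁻¹ * 2 ^ p, ENNReal.mul_ne_top (ENNReal.mul_ne_top (by simp)
    (ENNReal.inv_ne_top.2 hc0)) (by simp), fun {m u} hu v hv => ?_⟩
  have hv0 : 0 < ‖v‖ := norm_pos_iff.2 hv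
  set B := Metric.closedBall ((2 : ℝ)⁻¹ • v) (‖v‖ / 2) with hB
  have hBm : MeasurableSet B := measurableSet_closedBall
  have hvol : volume B = ‖v‖ₑ ^ (n : ℝ) * (2 ^ (n : ℝ))⁻¹ * c := by
    rw [hB, Measure.addHaar_closedBall _ _ (by positivity), finrank_euclideanSpace_fin,
      ENNReal.ofReal_pow (by positivity), ENNReal.ofReal_div_of_pos two_pos, ofReal_norm,
      ENNReal.ofReal_ofNat, ← ENNReal.rpow_natCast,
      ENNReal.div_rpow_of_nonneg _ _ (by positivity), ENNReal.div_eq_inv_mul, mul_comm (_⁻¹)]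
  have hsub : B ⊆ Metric.closedBall 0 ‖v‖ := by
    refine Metric.closedBall_subset_closedBall' ?_
    rw [dist_zero_right, norm_smul, norm_inv, Real.norm_ofNat]
    linarith
  have hrefl : ∀ w, v - w ∈ B ↔ w ∈ B := fun w => by
    rw [hB, Metric.mem_closedBall, Metric.mem_closedBall, dist_eq_norm, dist_eq_norm,
      ← norm_neg]
    have : -(v - w - (2 : ℝ)⁻¹ • v) = w - (2 : ℝ)⁻¹ • v := by module
    rw [this]
  have hswap : ∫⁻ w in B, modp p u (v - w) = ∫⁻ w in B, modp p u w := by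
    rw [← lintegral_indicator hBm, ← lintegral_indicator hBm,
      ← lintegral_sub_left_eq_self (B.indicator (modp p u)) v]
    refine lintegral_congr fun w => ?_
    by_cases hw : w ∈ B
    · rw [indicator_of_mem hw, indicator_of_mem ((hrefl w).2 hw)]
    · rw [indicator_of_notMem hw, indicator_of_notMem (fun h => hw ((hrefl w).1 h))]
  have hmod := measurable_modp (p := p) hu
  have key : volume B * modp p u v ≤ 2 ^ p * ∫⁻ w in Metric.closedBall 0 ‖v‖, modp p u w := by
    calc volume B * modp p u v = ∫⁻ _w in B, modp p u v := by rw [setLIntegral_const, mul_comm]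
      _ ≤ ∫⁻ w in B, 2 ^ (p - 1) * (modp p u w + modp p u (v - w)) := by
          refine lintegral_mono fun w => ?_
          have := modp_add_le hp hu w (v - w)
          rwa [add_sub_cancel] at this
      _ = 2 ^ (p - 1) * (2 * ∫⁻ w in B, modp p u w) := by
          rw [lintegral_const_mul' _ _ (by simp), lintegral_add_left hmod, hswap, two_mul]
      _ = 2 ^ p * ∫⁻ w in B, modp p u w := by
          rw [← mul_assoc]
          congr 1
          nth_rewrite 2 [← ENNReal.rpow_one 2]
          rw [← ENNReal.rpow_add _ _ two_ne_zero (by simp), sub_add_cancel]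
      _ ≤ _ := by gcongr
  have hvb0 : volume B ≠ 0 := (Metric.measure_closedBall_pos _ _ (by positivity)).ne'
  have hvbt : volume B ≠ ∞ := measure_closedBall_lt_top.ne
  rw [mul_comm, ← ENNReal.le_div_iff_mul_le (Or.inl hvb0) (Or.inl hvbt)] at key
  refine key.trans_eq ?_
  have hve : ‖v‖ₑ ^ (n : ℝ) ≠ 0 := by simp [hv]
  have hvt : ‖v‖ₑ ^ (n : ℝ) ≠ ∞ := ENNReal.rpow_ne_top_of_nonneg (by positivity) (by simp)
  have h2e : (2 ^ (n : ℝ) : ℝ≥0∞) ≠ ∞ := ENNReal.rpow_ne_top_of_nonneg (by positivity) (by simp)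
  have h2z : (2 ^ (n : ℝ) : ℝ≥0∞) ≠ 0 := by simp
  rw [ENNReal.div_eq_inv_mul, hvol, ENNReal.mul_inv (Or.inr hct) (Or.inr hc0),
    ENNReal.mul_inv (Or.inl hve) (Or.inl hvt), inv_inv, ENNReal.rpow_neg]
  ring

/-- The `p`-th power of the Gagliardo seminorm on the whole space, restricted to the pairs of
points at distance at most `r`; here `σ = s p`. -/
def localEnergy (p σ : ℝ) (u : E n → E m) (r : ℝ) : ℝ≥0∞ :=
  ∫⁻ w in Metric.closedBall 0 r, modp p u w * ‖w‖ₑ ^ (-((n : ℝ) + σ))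

lemma localEnergy_mono (u : E n → E m) {r r' : ℝ} (h : r ≤ r') :
    localEnergy p σ u r ≤ localEnergy p σ u r' :=
  lintegral_mono_set (Metric.closedBall_subset_closedBall h)

/-- On the ball of radius ‖v‖ the kernel ‖w‖ ^ (-n - σ) is at least its value at v, so the mean of
the increments is at most a multiple of the energy. -/
lemma exists_modp_le_localEnergy (n : ℕ) (hp : 1 ≤ p) (hσ : 0 < σ) :
    ∃ κ : ℝ≥0∞, κ ≠ ∞ ∧ ∀ {m : ℕ} {u : E n → E m}, Measurable u → ∀ v : E n,
      modp p u v ≤ κ * ‖v‖ₑ ^ σ * localEnergy p σ u ‖v‖ := by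
  obtain ⟨κ, hκ, h⟩ := exists_modp_le n hp
  refine ⟨κ, hκ, fun {m u} hu v => ?_⟩
  rcases eq_or_ne v 0 with rfl | hv
  · simp [modp_zero hp]
  have hve : ‖v‖ₑ ≠ 0 := by simpa using hv
  have hvt : ‖v‖ₑ ≠ ∞ := by simp
  refine (h hu v hv).trans ?_
  have h1 : ∫⁻ w in Metric.closedBall 0 ‖v‖, modp p u w ≤
      ‖v‖ₑ ^ ((n : ℝ) + σ) * localEnergy p σ u ‖v‖ := by
    rw [localEnergy, ← lintegral_const_mul' _ _ (by
      exact ENNReal.rpow_ne_top_of_nonneg (by positivity) hvt)]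
    refine setLIntegral_mono' measurableSet_closedBall fun w hw => ?_
    have hwv : ‖w‖ₑ ≤ ‖v‖ₑ := by
      rw [mem_closedBall_zero_iff] at hw
      exact enorm_le_iff_norm_le.2 hw
    have h2 : (1 : ℝ≥0∞) ≤ ‖v‖ₑ ^ ((n : ℝ) + σ) * ‖w‖ₑ ^ (-((n : ℝ) + σ)) := by
      rw [ENNReal.rpow_neg, ← ENNReal.div_eq_inv_mul |>.trans (mul_comm _ _)]
      rw [ENNReal.le_div_iff_mul_le (Or.inr (by
        simp [ENNReal.rpow_eq_zero_iff, hv])) (Or.inl (by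
        exact ENNReal.rpow_ne_top_of_nonneg (by positivity) (by simp))), one_mul]
      exact ENNReal.rpow_le_rpow hwv (by positivity)
    calc modp p u w = modp p u w * 1 := (mul_one _).symm
      _ ≤ modp p u w * (‖v‖ₑ ^ ((n : ℝ) + σ) * ‖w‖ₑ ^ (-((n : ℝ) + σ))) := by gcongr
      _ = _ := by ring
  calc _ ≤ κ * ‖v‖ₑ ^ (-(n : ℝ)) * (‖v‖ₑ ^ ((n : ℝ) + σ) * localEnergy p σ u ‖v‖) := by gcongr
    _ = κ * (‖v‖ₑ ^ (-(n : ℝ)) * ‖v‖ₑ ^ ((n : ℝ) + σ)) * localEnergy p σ u ‖v‖ := by ring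
    _ = _ := by rw [← ENNReal.rpow_add _ _ hve hvt, neg_add_cancel_left]

/-- An energy estimate for random increments `V h z` that are controlled by a random Lipschitz
constant `θ z`. -/
lemma exists_lintegral_modp_le (hn : 0 < n) (hp : 1 ≤ p) (hσ : 0 < σ) :
    ∃ κ : ℝ≥0∞, κ ≠ ∞ ∧ ∀ {m : ℕ} {u : E n → E m}, Measurable u →
      ∀ (ν : Measure (E n)) [SFinite ν] (θ : E n → ℝ) (V : E n → E n → E n) (δ r : ℝ),
      Measurable θ → (∀ h, ∀ᵐ z ∂ν, 0 < θ z ∧ ‖V h z‖ * θ z ≤ ‖h‖) →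
      (∀ h z, ‖V h z‖ ≤ ‖h‖ + r) →
      ∫⁻ h in Metric.ball 0 δ, ‖h‖ₑ ^ (-((n : ℝ) + σ)) * ∫⁻ z, modp p u (V h z) ∂ν ≤
        κ * (∫⁻ z, ENNReal.ofReal (θ z) ^ (-σ) ∂ν) * localEnergy p σ u (δ + r) := by
  obtain ⟨κ₁, hκ₁, hmod⟩ := exists_modp_le n hp
  obtain ⟨κ₂, hκ₂, htail⟩ := exists_lintegral_tail_le (n := n) hσ
  refine ⟨κ₁ * κ₂, ENNReal.mul_ne_top hκ₁ hκ₂, fun {m u} hu ν _ θ V δ r hθ hV hV' => ?_⟩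
  set q : ℝ := n + σ with hq
  have hum := measurable_modp (p := p) hu
  let g : E n → ℝ≥0∞ := (Metric.closedBall (0 : E n) (δ + r)).indicator
    fun w => ‖w‖ₑ ^ (-(n : ℝ)) * modp p u w
  have hg : Measurable g := Measurable.indicator (by fun_prop) measurableSet_closedBall
  -- If ‖w‖ ≤ ‖V h z‖, then the triple (w, z, h) lies in `S`. Replacing the first condition by
  -- membership in `S` eliminates `V`, for which no measurability is assumed, before the integrals
  -- are exchanged.
  let S : Set (E n × E n × E n) := {x | ‖x.1‖ * θ x.2.1 ≤ ‖x.2.2‖}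
  have hS : MeasurableSet S := measurableSet_le (by fun_prop) (by fun_prop)
  let G : E n → E n → E n → ℝ≥0∞ := fun w z h =>
    g w * S.indicator (fun x => ‖x.2.2‖ₑ ^ (-q)) (w, z, h)
  have hG : Measurable fun x : E n × E n × E n => G x.1 x.2.1 x.2.2 :=
    (hg.comp measurable_fst).mul (Measurable.indicator (by fun_prop) hS)
  have hpt : ∀ h ∈ Metric.ball (0 : E n) δ, ∀ᵐ z ∂ν,
      ‖h‖ₑ ^ (-q) * modp p u (V h z) ≤ κ₁ * ∫⁻ w, G w z h := by
    intro h hh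
    filter_upwards [hV h] with z hz
    rcases eq_or_ne (V h z) 0 with h0 | h0
    · rw [h0, modp_zero hp, mul_zero]
      exact zero_le
    refine (mul_le_mul_right (hmod hu _ h0) _).trans ?_
    have hVle : ‖V h z‖ ≤ δ + r := by
      have := hV' h z
      rw [mem_ball_zero_iff] at hh
      linarith
    have hle : ‖V h z‖ₑ ^ (-(n : ℝ)) * ∫⁻ w in Metric.closedBall 0 ‖V h z‖, modp p u w ≤
        ∫⁻ w in Metric.closedBall 0 ‖V h z‖, ‖w‖ₑ ^ (-(n : ℝ)) * modp p u w := by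
      rw [← lintegral_const_mul _ hum]
      refine setLIntegral_mono' measurableSet_closedBall fun w hw => ?_
      rw [mem_closedBall_zero_iff] at hw
      gcongr ?_ * _
      rw [ENNReal.rpow_neg, ENNReal.rpow_neg, ENNReal.inv_le_inv]
      exact ENNReal.rpow_le_rpow (enorm_le_iff_norm_le.2 hw) (by positivity)
    calc ‖h‖ₑ ^ (-q) * (κ₁ * ‖V h z‖ₑ ^ (-(n : ℝ)) *
          ∫⁻ w in Metric.closedBall 0 ‖V h z‖, modp p u w)
        = κ₁ * (‖h‖ₑ ^ (-q) * (‖V h z‖ₑ ^ (-(n : ℝ)) *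
          ∫⁻ w in Metric.closedBall 0 ‖V h z‖, modp p u w)) := by ring
      _ ≤ κ₁ * (‖h‖ₑ ^ (-q) *
          ∫⁻ w in Metric.closedBall 0 ‖V h z‖, ‖w‖ₑ ^ (-(n : ℝ)) * modp p u w) := by gcongr
      _ ≤ κ₁ * ∫⁻ w, G w z h := by
          gcongr
          rw [← lintegral_indicator measurableSet_closedBall,
            ← lintegral_const_mul _ (Measurable.indicator (by fun_prop) measurableSet_closedBall)]
          refine lintegral_mono fun w => ?_
          by_cases hw : w ∈ Metric.closedBall (0 : E n) ‖V h z‖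
          · have hwn : ‖w‖ ≤ ‖V h z‖ := by simpa using hw
            have hw' : w ∈ Metric.closedBall (0 : E n) (δ + r) := by
              rw [mem_closedBall_zero_iff]; linarith
            have hwS : (w, z, h) ∈ S :=
              (mul_le_mul_of_nonneg_right hwn hz.1.le).trans hz.2
            simp only [G, g]
            rw [indicator_of_mem hw, indicator_of_mem hw', indicator_of_mem hwS, mul_comm]
          · rw [indicator_of_notMem hw, mul_zero]
            exact zero_le
  -- Integrating in h first leaves the tail of the kernel beyond ‖w‖ θ z, of order (‖w‖ θ z) ^ (-σ).
  -- With the factor ‖w‖ ^ (-n) in `g` this restores the kernel of the energy.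
  have hinner : ∀ w : E n, w ≠ 0 → ∀ᵐ z ∂ν, ∫⁻ h, G w z h ≤
      g w * (κ₂ * (‖w‖ₑ ^ (-σ) * ENNReal.ofReal (θ z) ^ (-σ))) := by
    intro w hw
    -- The instance h = 0 serves only to provide θ z > 0.
    filter_upwards [hV 0] with z hz
    simp only [G]
    have hm : Measurable fun h => S.indicator (fun x => ‖x.2.2‖ₑ ^ (-q)) (w, z, h) :=
      Measurable.comp (g := S.indicator fun x => ‖x.2.2‖ₑ ^ (-q)) (f := fun h => (w, z, h))
        (Measurable.indicator (by fun_prop) hS) (by fun_prop)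
    rw [lintegral_const_mul _ hm]
    gcongr
    have hw0 : 0 < ‖w‖ := norm_pos_iff.2 hw
    have hpos : 0 < ‖w‖ * θ z := mul_pos hw0 hz.1
    have h1 := htail _ hpos
    rw [← lintegral_indicator (measurableSet_le measurable_const measurable_norm)] at h1
    refine h1.trans_eq ?_
    rw [ENNReal.ofReal_rpow_of_pos hpos, enorm_rpow_eq_ofReal hw, ENNReal.ofReal_rpow_of_pos hz.1,
      ← ENNReal.ofReal_mul (by positivity), Real.mul_rpow hw0.le hz.1.le]
  have hne : ∀ᵐ w : E n, w ≠ 0 := by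
    have : Nontrivial (E n) := by
      have : Nonempty (Fin n) := ⟨⟨0, hn⟩⟩
      infer_instance
    simp [ae_iff]
  have hGwz : ∀ h, Measurable (Function.uncurry fun z w => G w z h) := fun h =>
    hG.comp (f := fun x : E n × E n => (x.2, x.1, h)) (by fun_prop)
  have hGzh : ∀ w, Measurable (Function.uncurry fun z h => G w z h) := fun w =>
    hG.comp (f := fun x : E n × E n => (w, x.1, x.2)) (by fun_prop)
  have hGhw : Measurable (Function.uncurry fun h w => ∫⁻ z, G w z h ∂ν) :=
    Measurable.lintegral_prod_right' (f := fun x : (E n × E n) × E n => G x.1.2 x.2 x.1.1)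
      (hG.comp (f := fun x : (E n × E n) × E n => (x.1.2, x.2, x.1.1)) (by fun_prop))
  calc ∫⁻ h in Metric.ball 0 δ, ‖h‖ₑ ^ (-q) * ∫⁻ z, modp p u (V h z) ∂ν
      ≤ ∫⁻ h in Metric.ball 0 δ, ∫⁻ z, (κ₁ * ∫⁻ w, G w z h) ∂ν := by
        refine setLIntegral_mono' measurableSet_ball fun h hh => ?_
        exact (lintegral_const_mul_le _ _).trans (lintegral_mono_ae (hpt h hh))
    _ ≤ ∫⁻ h, ∫⁻ z, (κ₁ * ∫⁻ w, G w z h) ∂ν := setLIntegral_le_lintegral _ _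
    _ = κ₁ * ∫⁻ w, ∫⁻ z, (∫⁻ h, G w z h) ∂ν := by
        simp_rw [lintegral_const_mul' κ₁ _ hκ₁]
        congr 1
        calc ∫⁻ h, ∫⁻ z, (∫⁻ w, G w z h) ∂ν = ∫⁻ h, ∫⁻ w, ∫⁻ z, G w z h ∂ν :=
              lintegral_congr fun h => lintegral_lintegral_swap (hGwz h).aemeasurable
          _ = ∫⁻ w, ∫⁻ h, ∫⁻ z, G w z h ∂ν := lintegral_lintegral_swap hGhw.aemeasurable
          _ = ∫⁻ w, ∫⁻ z, (∫⁻ h, G w z h) ∂ν :=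
              lintegral_congr fun w => (lintegral_lintegral_swap (hGzh w).aemeasurable).symm
    _ ≤ κ₁ * ∫⁻ w, g w * (κ₂ * (‖w‖ₑ ^ (-σ) * ∫⁻ z, ENNReal.ofReal (θ z) ^ (-σ) ∂ν)) := by
        gcongr κ₁ * ?_
        refine lintegral_mono_ae ?_
        filter_upwards [hne] with w hw
        refine (lintegral_mono_ae (hinner w hw)).trans_eq ?_
        have hm : Measurable fun z => ENNReal.ofReal (θ z) ^ (-σ) := by fun_prop
        rw [lintegral_const_mul _ (by fun_prop), lintegral_const_mul _ (by fun_prop),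
          lintegral_const_mul _ hm]
    _ = _ := by
        generalize (∫⁻ z, ENNReal.ofReal (θ z) ^ (-σ) ∂ν) = Θ
        have : ∀ w, g w * (κ₂ * (‖w‖ₑ ^ (-σ) * Θ)) = κ₂ * Θ * (g w * ‖w‖ₑ ^ (-σ)) := fun w => by
          ring
        simp_rw [this]
        rw [lintegral_const_mul _ (by fun_prop), localEnergy,
          ← lintegral_indicator measurableSet_closedBall]
        have h2 : ∫⁻ w, g w * ‖w‖ₑ ^ (-σ) = ∫⁻ w, (Metric.closedBall (0 : E n) (δ + r)).indicator
            (fun w => modp p u w * ‖w‖ₑ ^ (-q)) w := by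
          refine lintegral_congr_ae ?_
          filter_upwards [hne] with w hw
          simp only [g]
          by_cases hwB : w ∈ Metric.closedBall (0 : E n) (δ + r)
          · rw [indicator_of_mem hwB, indicator_of_mem hwB, hq, neg_add,
              ENNReal.rpow_add _ _ (by simpa using hw) (by simp)]
            ring
          · rw [indicator_of_notMem hwB, indicator_of_notMem hwB, zero_mul]
        rw [h2]
        ring

end Modulus

end FracSobolev
end

noncomputable section
namespace FracSobolev
open MeasureTheory Set
open scoped ENNReal

/-! ### Mollification -/

section Mollify

variable {n m : ℕ} {p σ : ℝ}

/-- Jensen's inequality, in the form that the L¹ norm is at most the L^p norm for a probability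
measure. -/
lemma enorm_integral_rpow_le (hp : 1 ≤ p) (μ : Measure (E n)) [IsProbabilityMeasure μ]
    {G : E n → E m} (hG : AEStronglyMeasurable G μ) :
    ‖∫ t, G t ∂μ‖ₑ ^ p ≤ ∫⁻ t, ‖G t‖ₑ ^ p ∂μ := by
  have hp0 : 0 < p := by linarith
  have h1 : ‖∫ t, G t ∂μ‖ₑ ≤ eLpNorm G (ENNReal.ofReal p) μ := by
    refine (enorm_integral_le_lintegral_enorm G).trans ?_
    rw [← eLpNorm_one_eq_lintegral_enorm]
    exact eLpNorm_le_eLpNorm_of_exponent_le (by simpa using hp) hG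
  refine (ENNReal.rpow_le_rpow h1 hp0.le).trans_eq ?_
  rw [eLpNorm_eq_lintegral_rpow_enorm_toReal (by simpa using hp0) ENNReal.ofReal_ne_top,
    ENNReal.toReal_ofReal hp0.le, ← ENNReal.rpow_mul, one_div, inv_mul_cancel₀ hp0.ne',
    ENNReal.rpow_one]

/-- The convolution of `F` with the probability measure `μ`. -/
def mollify (μ : Measure (E n)) (F : E n → E m) (x : E n) : E m := ∫ t, F (x - t) ∂μ

/-- The measure has a normalised smooth bump as its density. Being a probability measure it is
suited to Jensen's inequality, while the Lipschitz bound comes from putting the increment on the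
bump instead of on F. -/
lemma exists_mollifier (n : ℕ) {ρ : ℝ} (hρ : 0 < ρ) :
    ∃ μ : Measure (E n), IsProbabilityMeasure μ ∧
      (∀ g : E n → ℝ≥0∞, Measurable g →
        ∫⁻ t, g t ∂μ ≤ (volume (Metric.closedBall (0 : E n) (ρ / 2)))⁻¹ *
          ∫⁻ t in Metric.ball 0 ρ, g t) ∧
      μ ≪ volume.restrict (Metric.ball 0 ρ) ∧
      ∀ {m : ℕ} (F : E n → E m), Integrable F → ∃ L, LipschitzWith L (mollify μ F) := by
  let φ : ContDiffBump (0 : E n) := ⟨ρ / 2, ρ, by positivity, by linarith⟩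
  let w : E n → ℝ := φ.normed volume
  have hw0 : ∀ t, 0 ≤ w t := fun t => φ.nonneg_normed t
  have hwc : Continuous w := φ.continuous_normed
  have hwm : Measurable fun t => ENNReal.ofReal (w t) := by fun_prop
  have hwsupp : ∀ t, t ∉ Metric.ball (0 : E n) ρ → w t = 0 := fun t ht => by
    have : t ∉ Function.support w := by rwa [φ.support_normed_eq]
    simpa using this
  have hwle : ∀ t, ENNReal.ofReal (w t) ≤ (volume (Metric.closedBall (0 : E n) (ρ / 2)))⁻¹ *
      (Metric.ball (0 : E n) ρ).indicator 1 t := fun t => by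
    by_cases ht : t ∈ Metric.ball (0 : E n) ρ
    · rw [indicator_of_mem ht, Pi.one_apply, mul_one]
      have h := φ.normed_le_div_measure_closedBall_rIn volume t
      refine (ENNReal.ofReal_le_ofReal h).trans_eq ?_
      have hpos : 0 < volume.real (Metric.closedBall (0 : E n) (ρ / 2)) :=
        ENNReal.toReal_pos (Metric.measure_closedBall_pos _ _ (by positivity)).ne'
          measure_closedBall_lt_top.ne
      change ENNReal.ofReal (1 / volume.real (Metric.closedBall (0 : E n) (ρ / 2))) = _
      rw [one_div, ENNReal.ofReal_inv_of_pos hpos, measureReal_def,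
        ENNReal.ofReal_toReal measure_closedBall_lt_top.ne]
    · rw [hwsupp t ht]
      simp
  have hbound : ∀ g : E n → ℝ≥0∞, Measurable g →
      ∫⁻ t, g t ∂(volume.withDensity fun t => ENNReal.ofReal (w t)) ≤
        (volume (Metric.closedBall (0 : E n) (ρ / 2)))⁻¹ * ∫⁻ t in Metric.ball 0 ρ, g t := by
    intro g hg
    rw [lintegral_withDensity_eq_lintegral_mul _ hwm hg,
      ← lintegral_indicator measurableSet_ball, ← lintegral_const_mul _
        (hg.indicator measurableSet_ball)]
    refine lintegral_mono fun t => ?_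
    refine (mul_le_mul_left (hwle t) (g t)).trans_eq ?_
    by_cases ht : t ∈ Metric.ball (0 : E n) ρ
    · simp only [indicator_of_mem ht, Pi.one_apply, mul_one]
    · simp only [indicator_of_notMem ht, mul_zero, zero_mul]
  refine ⟨volume.withDensity fun t => ENNReal.ofReal (w t), ⟨?_⟩, hbound, ?_, ?_⟩
  · rw [withDensity_apply _ MeasurableSet.univ, setLIntegral_univ,
      ← ofReal_integral_eq_lintegral_ofReal φ.integrable_normed (.of_forall hw0),
      φ.integral_normed, ENNReal.ofReal_one]
  · refine Measure.AbsolutelyContinuous.mk fun s hs h0 => ?_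
    have := hbound (s.indicator 1) (measurable_one.indicator hs)
    rw [lintegral_indicator_one hs, lintegral_indicator_one hs, h0, mul_zero] at this
    exact le_antisymm this zero_le
  · intro m F hF
    obtain ⟨L, hL⟩ := (φ.contDiff_normed (μ := volume) (n := 1)).lipschitzWith_of_hasCompactSupport
      (φ.hasCompactSupport_normed (μ := volume)) (by norm_num)
    have e : ∀ x, mollify (volume.withDensity fun t => ENNReal.ofReal (w t)) F x =
        ∫ t, w (x - t) • F t := fun x => by
      rw [mollify, integral_withDensity_eq_integral_toReal_smul hwm
        (.of_forall fun _ => ENNReal.ofReal_lt_top),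
        ← integral_sub_left_eq_self (fun t => w (x - t) • F t) volume x]
      refine integral_congr_ae (.of_forall fun t => ?_)
      simp only [ENNReal.toReal_ofReal (hw0 t), sub_sub_cancel]
    obtain ⟨C, hC⟩ : ∃ C, ∀ t, ‖w t‖ ≤ C :=
      φ.hasCompactSupport_normed.exists_bound_of_continuous hwc
    have hintg : ∀ x, Integrable fun t => w (x - t) • F t := fun x =>
      hF.bdd_smul C (φ := fun t => w (x - t)) (by fun_prop) (.of_forall fun t => hC _)
    refine ⟨L * (∫ t, ‖F t‖).toNNReal,
      LipschitzWith.of_dist_le_mul fun x y => ?_⟩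
    rw [dist_eq_norm, e, e, ← integral_sub (hintg x) (hintg y)]
    calc ‖∫ t, (w (x - t) • F t - w (y - t) • F t)‖
        ≤ ∫ t, L * dist x y * ‖F t‖ := by
          refine norm_integral_le_of_norm_le (hF.norm.const_mul _) (.of_forall fun t => ?_)
          rw [← sub_smul, norm_smul]
          gcongr
          have := hL.dist_le_mul (x - t) (y - t)
          rwa [dist_sub_right, dist_eq_norm] at this
      _ = _ := by
          rw [integral_const_mul]
          rw [NNReal.coe_mul, Real.coe_toNNReal _ (integral_nonneg fun _ => norm_nonneg _)]
          ring

variable {μ : Measure (E n)} [IsProbabilityMeasure μ] {F : E n → E m}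

lemma integrable_comp_sub (hF : Measurable F) {M : ℝ} (hM : ∀ x, ‖F x‖ ≤ M) (x : E n) :
    Integrable (fun t => F (x - t)) μ :=
  Integrable.of_bound (by fun_prop : Measurable fun t => F (x - t)).aestronglyMeasurable M
    (.of_forall fun _ => hM _)

lemma enorm_mollify_sub_rpow_le (hp : 1 ≤ p) (hF : Measurable F) {M : ℝ} (hM : ∀ x, ‖F x‖ ≤ M)
    (x : E n) (a : E m) :
    ‖mollify μ F x - a‖ₑ ^ p ≤ ∫⁻ t, ‖F (x - t) - a‖ₑ ^ p ∂μ := by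
  have : mollify μ F x - a = ∫ t, (F (x - t) - a) ∂μ := by
    rw [integral_sub (integrable_comp_sub hF hM x) (integrable_const a)]
    simp [mollify]
  rw [this]
  exact enorm_integral_rpow_le hp μ
    (by fun_prop : Measurable fun t => F (x - t) - a).aestronglyMeasurable

/-- By convexity an increment of the average is bounded by the average of the increments of
translates of F, and these all have the same L^p norm. -/
lemma modp_mollify_le (hp : 1 ≤ p) (hF : Measurable F) {M : ℝ} (hM : ∀ x, ‖F x‖ ≤ M) (v : E n) :
    modp p (mollify μ F) v ≤ modp p F v := by
  calc modp p (mollify μ F) v ≤ ∫⁻ x, ∫⁻ t, ‖F (x + v - t) - F (x - t)‖ₑ ^ p ∂μ := by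
        refine lintegral_mono fun x => ?_
        rw [mollify, mollify, ← integral_sub (integrable_comp_sub hF hM _)
          (integrable_comp_sub hF hM _)]
        exact enorm_integral_rpow_le hp μ (by fun_prop :
          Measurable fun t => F (x + v - t) - F (x - t)).aestronglyMeasurable
    _ = ∫⁻ t, (∫⁻ x, ‖F (x + v - t) - F (x - t)‖ₑ ^ p) ∂μ := by
        refine lintegral_lintegral_swap (Measurable.aemeasurable ?_)
        unfold Function.uncurry
        fun_prop
    _ = ∫⁻ _t, modp p F v ∂μ := by
        refine lintegral_congr fun t => ?_
        rw [modp, ← lintegral_sub_right_eq_self (fun x => ‖F (x + v) - F x‖ₑ ^ p) t]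
        refine lintegral_congr fun x => ?_
        rw [sub_add_eq_add_sub]
    _ = modp p F v := by simp

lemma localEnergy_mollify_le (hp : 1 ≤ p) (hF : Measurable F) {M : ℝ} (hM : ∀ x, ‖F x‖ ≤ M)
    (r : ℝ) : localEnergy p σ (mollify μ F) r ≤ localEnergy p σ F r :=
  lintegral_mono fun w => mul_le_mul_left (modp_mollify_le hp hF hM w) _

/-- The density at `y` of the energy of the pairs at distance at most `r`. -/
def energyDensity (p σ : ℝ) (F : E n → E m) (r : ℝ) (y : E n) : ℝ≥0∞ :=
  ∫⁻ h in Metric.closedBall 0 r, ‖F (y + h) - F y‖ₑ ^ p * ‖h‖ₑ ^ (-((n : ℝ) + σ))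

lemma measurable_energyDensity (hF : Measurable F) (r : ℝ) :
    Measurable (energyDensity p σ F r) := by
  unfold energyDensity
  exact Measurable.lintegral_prod_right' (f := fun q : E n × E n =>
    ‖F (q.1 + q.2) - F q.1‖ₑ ^ p * ‖q.2‖ₑ ^ (-((n : ℝ) + σ))) (by fun_prop)

lemma lintegral_energyDensity (hF : Measurable F) (r : ℝ) :
    ∫⁻ y, energyDensity p σ F r y = localEnergy p σ F r := by
  unfold energyDensity localEnergy modp
  rw [lintegral_lintegral_swap (f := fun y h : E n =>
    ‖F (y + h) - F y‖ₑ ^ p * ‖h‖ₑ ^ (-((n : ℝ) + σ)))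
    (Measurable.aemeasurable (by unfold Function.uncurry; fun_prop))]
  exact lintegral_congr fun h => lintegral_mul_const _ (by fun_prop)

/-- Mollifications of maps with values in `N` are close to `N` where the energy is small. -/
lemma infEDist_mollify_rpow_le (hp : 1 ≤ p) (hσ : 0 < σ) (hF : Measurable F) {M : ℝ}
    (hM : ∀ x, ‖F x‖ ≤ M) {ρ : ℝ} (hρ : 0 < ρ) {κ : ℝ≥0∞} (hκt : κ ≠ ∞)
    (hμ : ∀ g : E n → ℝ≥0∞, Measurable g → ∫⁻ t, g t ∂μ ≤ κ * ∫⁻ t in Metric.ball 0 ρ, g t)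
    (hac : μ ≪ volume.restrict (Metric.ball 0 ρ)) {N : Set (E m)} {x : E n}
    (hx : ∀ᵐ y, y ∈ Metric.ball x ρ → F y ∈ N) :
    Metric.infEDist (mollify μ F x) N ^ p ≤ κ ^ 2 * ENNReal.ofReal (2 * ρ) ^ ((n : ℝ) + σ) *
      ∫⁻ y in Metric.ball x ρ, energyDensity p σ F (2 * ρ) y := by
  set q : ℝ := n + σ with hq
  have hq0 : 0 < q := by positivity
  have hae : ∀ᵐ t ∂μ, F (x - t) ∈ N := by
    refine hac.ae_le (?_ : ∀ᵐ t ∂volume.restrict (Metric.ball 0 ρ), F (x - t) ∈ N)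
    rw [ae_restrict_iff' measurableSet_ball]
    have := (volume.measurePreserving_sub_left x).quasiMeasurePreserving.ae hx
    filter_upwards [this] with t ht htb
    refine ht ?_
    rw [Metric.mem_ball, dist_eq_norm, sub_sub_cancel_left, norm_neg]
    simpa using htb
  -- The points x - t and x - t' are at distance at most 2ρ, where the kernel is at least (2ρ) ^
  -- (-q).
  have hinner : ∀ t ∈ Metric.ball (0 : E n) ρ,
      ∫⁻ t' in Metric.ball 0 ρ, ‖F (x - t') - F (x - t)‖ₑ ^ p ≤
        ENNReal.ofReal (2 * ρ) ^ q * energyDensity p σ F (2 * ρ) (x - t) := by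
    intro t ht
    rw [mem_ball_zero_iff] at ht
    rw [energyDensity, ← lintegral_const_mul' _ _ (by
      exact ENNReal.rpow_ne_top_of_nonneg hq0.le ENNReal.ofReal_ne_top),
      ← lintegral_indicator measurableSet_ball, ← lintegral_indicator measurableSet_closedBall,
      ← lintegral_sub_left_eq_self ((Metric.closedBall (0 : E n) (2 * ρ)).indicator _) t]
    refine lintegral_mono fun t' => ?_
    by_cases ht' : t' ∈ Metric.ball (0 : E n) ρ
    · have hmem : t - t' ∈ Metric.closedBall (0 : E n) (2 * ρ) := by
        rw [mem_ball_zero_iff] at ht'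
        rw [mem_closedBall_zero_iff]
        have := norm_sub_le t t'
        linarith
      rw [indicator_of_mem ht', indicator_of_mem hmem, sub_add_sub_cancel]
      have h1 : (1 : ℝ≥0∞) ≤ ENNReal.ofReal (2 * ρ) ^ q * ‖t - t'‖ₑ ^ (-q) := by
        rw [ENNReal.rpow_neg, ← ENNReal.div_eq_inv_mul |>.trans (mul_comm _ _),
          ENNReal.le_div_iff_mul_le (Or.inr (by
            simp [ENNReal.rpow_eq_zero_iff, hρ, hq0.le])) (Or.inl (by
          exact ENNReal.rpow_ne_top_of_nonneg hq0.le (by simp))), one_mul]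
        refine ENNReal.rpow_le_rpow ?_ hq0.le
        rw [← ofReal_norm]
        exact ENNReal.ofReal_le_ofReal (by simpa using hmem)
      calc ‖F (x - t') - F (x - t)‖ₑ ^ p = 1 * ‖F (x - t') - F (x - t)‖ₑ ^ p := (one_mul _).symm
        _ ≤ ENNReal.ofReal (2 * ρ) ^ q * ‖t - t'‖ₑ ^ (-q) * ‖F (x - t') - F (x - t)‖ₑ ^ p := by
            gcongr
        _ = _ := by ring
    · rw [indicator_of_notMem ht']
      exact zero_le
  have hem := measurable_energyDensity (p := p) (σ := σ) hF (2 * ρ)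
  calc Metric.infEDist (mollify μ F x) N ^ p
      = ∫⁻ _t, Metric.infEDist (mollify μ F x) N ^ p ∂μ := by simp
    -- Each value F (x - t) lies in N for almost every t and competes for the distance; averaging
    -- over t as well produces a double integral of increments.
    _ ≤ ∫⁻ t, ∫⁻ t', ‖F (x - t') - F (x - t)‖ₑ ^ p ∂μ ∂μ := by
        refine lintegral_mono_ae ?_
        filter_upwards [hae] with t ht
        refine le_trans (ENNReal.rpow_le_rpow ?_ (by linarith))
          (enorm_mollify_sub_rpow_le hp hF hM x (F (x - t)))
        rw [← edist_eq_enorm_sub]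
        exact Metric.infEDist_le_edist_of_mem ht
    _ ≤ ∫⁻ t, (κ * ∫⁻ t' in Metric.ball 0 ρ, ‖F (x - t') - F (x - t)‖ₑ ^ p) ∂μ :=
        lintegral_mono fun t => hμ _ (by fun_prop)
    _ ≤ κ * ∫⁻ t in Metric.ball 0 ρ, κ * ∫⁻ t' in Metric.ball 0 ρ,
          ‖F (x - t') - F (x - t)‖ₑ ^ p :=
        hμ _ (Measurable.const_mul (Measurable.lintegral_prod_right'
          (f := fun y : E n × E n => ‖F (x - y.2) - F (x - y.1)‖ₑ ^ p) (by fun_prop)) κ)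
    _ ≤ κ * ∫⁻ t in Metric.ball 0 ρ, κ * (ENNReal.ofReal (2 * ρ) ^ q *
          energyDensity p σ F (2 * ρ) (x - t)) := by
        gcongr κ * ?_
        refine setLIntegral_mono' measurableSet_ball fun t ht => ?_
        gcongr
        exact hinner t ht
    _ = κ ^ 2 * ENNReal.ofReal (2 * ρ) ^ q *
          ∫⁻ t in Metric.ball 0 ρ, energyDensity p σ F (2 * ρ) (x - t) := by
        rw [lintegral_const_mul' _ _ hκt, lintegral_const_mul' _ _ (by
          exact ENNReal.rpow_ne_top_of_nonneg hq0.le ENNReal.ofReal_ne_top)]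
        ring
    _ = _ := by
        congr 1
        rw [← lintegral_indicator measurableSet_ball, ← lintegral_indicator measurableSet_ball,
          ← lintegral_sub_left_eq_self ((Metric.ball x ρ).indicator _) x]
        refine lintegral_congr fun t => ?_
        have hiff : x - t ∈ Metric.ball x ρ ↔ t ∈ Metric.ball (0 : E n) ρ := by
          rw [Metric.mem_ball, dist_eq_norm, sub_sub_cancel_left, norm_neg, mem_ball_zero_iff]
        by_cases ht : t ∈ Metric.ball (0 : E n) ρ
        · rw [indicator_of_mem ht, indicator_of_mem (hiff.2 ht)]
        · rw [indicator_of_notMem ht, indicator_of_notMem (fun h => ht (hiff.1 h))]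

end Mollify

end FracSobolev
end

noncomputable section
namespace FracSobolev
open MeasureTheory Set
open scoped ENNReal

/-! ### Averages over the translations of the grid -/

section Average

variable {n m j : ℕ} {p σ : ℝ}

/-- The retraction onto the `j`-skeleton of the grid `-ε τ + 2 ε ℤⁿ + [-ε, ε]ⁿ`. -/
def gridProj (j : ℕ) (ε : ℝ) (τ x : E n) : E n := ε • (skelProj j (ε⁻¹ • x + τ) - τ)

lemma gridProj_eq {ε : ℝ} (hε : ε ≠ 0) (τ x : E n) :
    gridProj j ε τ x = x + ε • (skelProj j (ε⁻¹ • x + τ) - (ε⁻¹ • x + τ)) := by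
  rw [gridProj, smul_sub, smul_sub, smul_add, smul_inv_smul₀ hε]
  abel

lemma gridProj_add_eq {ε : ℝ} (hε : ε ≠ 0) (τ x h : E n) :
    gridProj j ε τ (x + h) =
      x + ε • (skelProj j (ε⁻¹ • x + τ + ε⁻¹ • h) - (ε⁻¹ • x + τ)) := by
  rw [gridProj, smul_sub, smul_sub, smul_add ε _ τ, smul_inv_smul₀ hε,
    show ε⁻¹ • (x + h) + τ = ε⁻¹ • x + τ + ε⁻¹ • h by rw [smul_add]; abel]
  abel

lemma measurable_gridProj (hj : j < n) (ε : ℝ) :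
    Measurable fun x : E n × E n => gridProj j ε x.1 x.2 := by
  have := measurable_skelProj (n := n) hj
  unfold gridProj
  fun_prop

/-- The displacement of the retraction depends only on the position z = ε⁻¹ x + τ relative to the
grid. After averaging, z is independent of x, and a translation in x leaves a single increment of u.
-/
lemma lintegral_cell_modp_gridProj (hj : j < n) {ε : ℝ} (hε : 0 < ε) {u : E n → E m}
    (hu : Measurable u) (h : E n) :
    ∫⁻ τ in cell n, ∫⁻ x, ‖u (gridProj j ε τ (x + h)) - u (gridProj j ε τ x)‖ₑ ^ p =
      ∫⁻ z in cell n, modp p u (ε • (skelProj j (z + ε⁻¹ • h) - skelProj j z)) := by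
  have hsk := measurable_skelProj (n := n) hj
  let Φ : E n → E n → ℝ≥0∞ := fun x z =>
    ‖u (x + ε • (skelProj j (z + ε⁻¹ • h) - z)) - u (x + ε • (skelProj j z - z))‖ₑ ^ p
  have hΦ : Measurable (Function.uncurry Φ) := by
    unfold Function.uncurry
    fun_prop
  have key := lintegral_cell_lintegral_comp hΦ (fun x z k => by
    simp only [Φ]
    rw [add_right_comm, skelProj_add, skelProj_add, add_sub_add_right_eq_sub,
      add_sub_add_right_eq_sub]) ε
  calc _ = ∫⁻ τ in cell n, ∫⁻ x, Φ x (ε⁻¹ • x + τ) := by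
        refine lintegral_congr fun τ => lintegral_congr fun x => ?_
        rw [gridProj_add_eq hε.ne', gridProj_eq hε.ne']
    _ = _ := key
    _ = _ := by
        refine lintegral_congr fun z => ?_
        rw [modp, ← lintegral_add_right_eq_self (fun x => ‖u (x + ε • (skelProj j (z + ε⁻¹ • h) -
          skelProj j z)) - u x‖ₑ ^ p) (ε • (skelProj j z - z))]
        refine lintegral_congr fun x => ?_
        simp only [Φ]
        rw [add_assoc x, ← smul_add, sub_add_sub_cancel']

/-- Composition with the retraction onto the skeleton of a random grid preserves, on average,
the fractional energy. -/
lemma exists_lintegral_cell_energy_le (hj : j < n) (hp : 1 ≤ p) (hσ : 0 < σ) (hσj : σ < j + 1) :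
    ∃ κ : ℝ≥0∞, κ ≠ ∞ ∧ ∀ {m : ℕ} {u : E n → E m}, Measurable u → ∀ ε : ℝ, 0 < ε → ∀ δ : ℝ,
      ∫⁻ τ in cell n, ∫⁻ h in Metric.ball 0 δ, ‖h‖ₑ ^ (-((n : ℝ) + σ)) *
        ∫⁻ x, ‖u (gridProj j ε τ (x + h)) - u (gridProj j ε τ x)‖ₑ ^ p ≤
      κ * localEnergy p σ u (δ + 2 * √n * ε) := by
  have hn : 0 < n := by omega
  obtain ⟨κ, hκ, hmod⟩ := exists_lintegral_modp_le (n := n) hn hp hσ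
  have hs : 0 < 2 * √(n : ℝ) := by positivity
  -- The inverse of the constant in `norm_skelProj_sub_le`, so that θ = c · depth meets the
  -- requirement ‖V h z‖ θ z ≤ ‖h‖. The extra radius 2√n ε arises because the retraction moves each
  -- of the two points by at most √n ε.
  set c : ℝ := (2 * √n)⁻¹ with hc
  have hc0 : 0 < c := by positivity
  refine ⟨κ * (ENNReal.ofReal c ^ (-σ) *
    ∫⁻ z : E n in cell n, ENNReal.ofReal (depth j z) ^ (-σ)),
    ENNReal.mul_ne_top hκ (ENNReal.mul_ne_top ?_
      (lintegral_cell_depth_rpow_lt_top hj hσ hσj).ne), fun {m u} hu ε hε δ => ?_⟩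
  · rw [ENNReal.ofReal_rpow_of_pos hc0]; exact ENNReal.ofReal_ne_top
  have hd := (continuous_depth (n := n) hj).measurable
  have hgp := measurable_gridProj (n := n) hj ε
  have hm3 : Measurable fun y : (E n × E n) × E n =>
      ‖u (gridProj j ε y.1.1 (y.2 + y.1.2)) - u (gridProj j ε y.1.1 y.2)‖ₑ ^ p := by
    have h1 : Measurable fun y : (E n × E n) × E n => gridProj j ε y.1.1 (y.2 + y.1.2) :=
      hgp.comp (f := fun y : (E n × E n) × E n => (y.1.1, y.2 + y.1.2)) (by fun_prop)
    have h2 : Measurable fun y : (E n × E n) × E n => gridProj j ε y.1.1 y.2 :=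
      hgp.comp (f := fun y : (E n × E n) × E n => (y.1.1, y.2)) (by fun_prop)
    fun_prop
  have hm2 := hm3.lintegral_prod_right' (ν := volume)
  rw [lintegral_lintegral_swap (f := fun τ h : E n => ‖h‖ₑ ^ (-((n : ℝ) + σ)) *
        ∫⁻ x, ‖u (gridProj j ε τ (x + h)) - u (gridProj j ε τ x)‖ₑ ^ p)]
  swap
  · exact ((by fun_prop : Measurable fun y : E n × E n => ‖y.2‖ₑ ^ (-((n : ℝ) + σ))).mul
      hm2).aemeasurable
  have e : ∀ h : E n, ∫⁻ τ in cell n, ‖h‖ₑ ^ (-((n : ℝ) + σ)) *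
        ∫⁻ x, ‖u (gridProj j ε τ (x + h)) - u (gridProj j ε τ x)‖ₑ ^ p =
      ‖h‖ₑ ^ (-((n : ℝ) + σ)) *
        ∫⁻ z in cell n, modp p u (ε • (skelProj j (z + ε⁻¹ • h) - skelProj j z)) := fun h => by
    have hm1 : Measurable fun τ =>
        ∫⁻ x, ‖u (gridProj j ε τ (x + h)) - u (gridProj j ε τ x)‖ₑ ^ p :=
      hm2.comp (f := fun τ => (τ, h)) (by fun_prop)
    rw [lintegral_const_mul _ hm1,
      lintegral_cell_modp_gridProj hj hε hu]
  simp_rw [e]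
  refine (hmod hu (volume.restrict (cell n)) (fun z => c * depth j z)
    (fun h z => ε • (skelProj j (z + ε⁻¹ • h) - skelProj j z)) δ (2 * √n * ε) (by fun_prop)
    (fun h => ae_restrict_of_ae ?_) fun h z => ?_).trans_eq ?_
  · have h1 : ∀ᵐ z : E n, depth j (z + ε⁻¹ • h : E n) ≠ 0 :=
      (measurePreserving_add_right volume (ε⁻¹ • h)).quasiMeasurePreserving.ae
        (ae_depth_ne_zero hj)
    filter_upwards [ae_depth_ne_zero hj, h1] with z hz hz'
    have hz0 : 0 < depth j z := (depth_nonneg _ _).lt_of_ne' hz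
    refine ⟨mul_pos hc0 hz0, ?_⟩
    have h2 := norm_skelProj_sub_le hj hz' hz
    rw [add_sub_cancel_left, norm_smul, norm_inv, Real.norm_eq_abs, abs_of_pos hε,
      le_div_iff₀ hz0] at h2
    rw [norm_smul, Real.norm_eq_abs, abs_of_pos hε]
    calc ε * ‖skelProj j (z + ε⁻¹ • h) - skelProj j z‖ * (c * depth j z)
        = ε * c * (‖skelProj j (z + ε⁻¹ • h) - skelProj j z‖ * depth j z) := by ring
      _ ≤ ε * c * (2 * √n * (ε⁻¹ * ‖h‖)) := by gcongr
      _ = ‖h‖ := by rw [hc]; field_simp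
  · have h1 := norm_skelProj_sub_self_le hj (z + ε⁻¹ • h)
    have h2 := norm_skelProj_sub_self_le hj z
    have h3 : skelProj j (z + ε⁻¹ • h) - skelProj j z =
        (skelProj j (z + ε⁻¹ • h) - (z + ε⁻¹ • h)) - (skelProj j z - z) + ε⁻¹ • h := by abel
    have h4 : ‖ε⁻¹ • h‖ = ε⁻¹ * ‖h‖ := by
      rw [norm_smul, norm_inv, Real.norm_eq_abs, abs_of_pos hε]
    rw [norm_smul, Real.norm_eq_abs, abs_of_pos hε, h3]
    calc _ ≤ ε * (√n + √n + ε⁻¹ * ‖h‖) := by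
          gcongr
          refine (norm_add_le _ _).trans (add_le_add ((norm_sub_le _ _).trans
            (add_le_add h1 h2)) h4.le)
      _ = _ := by field_simp; ring
  · congr 2
    rw [← lintegral_const_mul _ (by fun_prop)]
    refine lintegral_congr fun z => ?_
    rw [ENNReal.ofReal_mul hc0.le, ENNReal.mul_rpow_of_ne_top ENNReal.ofReal_ne_top
      ENNReal.ofReal_ne_top]

variable {μ : Measure (E n)} [IsProbabilityMeasure μ] {F : E n → E m}

/-- For a fixed position relative to the grid the retraction is a translation by a vector of length
at most √n ε, and the mollification averages over translations of length less than ρ. Hence only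
increments of F of length at most √n ε + ρ occur. -/
lemma lintegral_cell_gridProj_sub_le (hj : j < n) {ε : ℝ} (hε : 0 < ε) (hp : 1 ≤ p)
    (hF : Measurable F) {M : ℝ} (hM : ∀ x, ‖F x‖ ≤ M) (hu : Measurable (mollify μ F)) {ρ : ℝ}
    (hac : μ ≪ volume.restrict (Metric.ball 0 ρ)) {b : ℝ≥0∞}
    (hb : ∀ v : E n, ‖v‖ ≤ √n * ε + ρ → modp p F v ≤ b) :
    ∫⁻ τ in cell n, ∫⁻ x, ‖mollify μ F (gridProj j ε τ x) - F x‖ₑ ^ p ≤ volume (cell n) * b := by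
  have hsk := measurable_skelProj (n := n) hj
  let Φ : E n → E n → ℝ≥0∞ := fun x z =>
    ‖mollify μ F (x + ε • (skelProj j z - z)) - F x‖ₑ ^ p
  have hΦ : Measurable (Function.uncurry Φ) := by
    unfold Function.uncurry
    fun_prop
  have key := lintegral_cell_lintegral_comp hΦ (fun x z k => by
    simp only [Φ]
    rw [skelProj_add, add_sub_add_right_eq_sub]) ε
  have hball : ∀ᵐ t ∂μ, t ∈ Metric.ball (0 : E n) ρ :=
    hac.ae_le (ae_restrict_mem measurableSet_ball)
  calc _ = ∫⁻ τ in cell n, ∫⁻ x, Φ x (ε⁻¹ • x + τ) := by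
        refine lintegral_congr fun τ => lintegral_congr fun x => ?_
        rw [gridProj_eq hε.ne']
    _ = _ := key
    _ ≤ ∫⁻ _z in cell n, b := by
        refine lintegral_mono fun z => ?_
        set a := ε • (skelProj j z - z) with ha
        have han : ‖a‖ ≤ √n * ε := by
          rw [ha, norm_smul, Real.norm_eq_abs, abs_of_pos hε, mul_comm]
          gcongr
          exact norm_skelProj_sub_self_le hj z
        calc ∫⁻ x, Φ x z ≤ ∫⁻ x, ∫⁻ t, ‖F (x + a - t) - F x‖ₑ ^ p ∂μ :=
              lintegral_mono fun x => enorm_mollify_sub_rpow_le hp hF hM _ _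
          _ = ∫⁻ t, (∫⁻ x, ‖F (x + a - t) - F x‖ₑ ^ p) ∂μ := by
              refine lintegral_lintegral_swap (Measurable.aemeasurable ?_)
              unfold Function.uncurry
              fun_prop
          _ ≤ ∫⁻ _t, b ∂μ := by
              refine lintegral_mono_ae ?_
              filter_upwards [hball] with t ht
              refine le_trans (le_of_eq ?_) (hb (a - t) ?_)
              · simp only [modp, add_sub_assoc]
              · rw [mem_ball_zero_iff] at ht
                have := norm_sub_le a t
                linarith
          _ = b := by simp
    _ = _ := by rw [setLIntegral_const, mul_comm]

/-- Every point of space lies in the neighbourhood of the random skeleton for the same measure of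
translations. -/
lemma lintegral_cell_nearSkel {g : E n → ℝ≥0∞} (hg : Measurable g) (j : ℕ) (r ε : ℝ) :
    ∫⁻ τ in cell n, ∫⁻ y in {y | ε⁻¹ • y + τ ∈ nearSkel j r}, g y =
      volume (cell n ∩ nearSkel j r) * ∫⁻ y, g y := by
  have hS := measurableSet_nearSkel (n := n) j r
  let Φ : E n → E n → ℝ≥0∞ := fun y z => (nearSkel j r).indicator (fun _ => g y) z
  have hΦ : Measurable (Function.uncurry Φ) :=
    Measurable.indicator (f := fun x : E n × E n => g x.1) (by fun_prop) (measurable_snd hS)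
  have key := lintegral_cell_lintegral_comp hΦ (fun y z k => by
    simp only [Φ]
    by_cases hz : z ∈ nearSkel j r
    · rw [indicator_of_mem hz, indicator_of_mem ((nearSkel_add j r z k).2 hz)]
    · rw [indicator_of_notMem hz,
        indicator_of_notMem (fun h => hz ((nearSkel_add j r z k).1 h))]) ε
  calc _ = ∫⁻ τ in cell n, ∫⁻ x, Φ x (ε⁻¹ • x + τ) := by
        refine lintegral_congr fun τ => ?_
        rw [← lintegral_indicator]
        · rfl
        · exact (by fun_prop : Measurable fun y : E n => ε⁻¹ • y + τ) hS
    _ = _ := key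
    _ = ∫⁻ z in cell n, (nearSkel j r).indicator (fun _ => ∫⁻ y, g y) z := by
        refine lintegral_congr fun z => ?_
        by_cases hz : z ∈ nearSkel j r
        · simp only [Φ, indicator_of_mem hz]
        · simp only [Φ, indicator_of_notMem hz, lintegral_zero]
    _ = _ := by
        rw [lintegral_indicator_const hS, Measure.restrict_apply hS, mul_comm, inter_comm]

end Average

end FracSobolev
end

noncomputable section
namespace FracSobolev
open MeasureTheory Set
open scoped ENNReal Topology

/-! ### Extension by a cutoff -/

section Cutoff

variable {n m : ℕ} {p σ : ℝ}

lemma lintegral_lintegral_eq_increment {κ : E n → E n → ℝ≥0∞}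
    (hκ : Measurable (Function.uncurry κ)) :
    ∫⁻ x, ∫⁻ y, κ x y = ∫⁻ h, ∫⁻ x, κ x (x + h) := by
  rw [lintegral_lintegral_swap (f := fun h x => κ x (x + h))
    (hκ.comp (f := fun y : E n × E n => (y.2, y.2 + y.1)) (by fun_prop)).aemeasurable]
  exact lintegral_congr fun x => (lintegral_add_left_eq_self (κ x) x).symm

/-- Absolute continuity of the integral: the balls on which the increments are taken have volume
tending to 0. -/
lemma exists_localEnergy_lt {F : E n → E m}
    (hfin : ∫⁻ w, modp p F w * ‖w‖ₑ ^ (-((n : ℝ) + σ)) ≠ ∞) (hn : 0 < n) {η : ℝ≥0∞}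
    (hη : 0 < η) : ∃ r : ℝ, 0 < r ∧ localEnergy p σ F r < η := by
  have : Nontrivial (E n) := by
    have : Nonempty (Fin n) := ⟨⟨0, hn⟩⟩
    infer_instance
  have hvol : Filter.Tendsto (fun r : ℝ => volume (Metric.closedBall (0 : E n) r)) (𝓝[>] 0)
      (𝓝 0) := by
    have h0 : Filter.Tendsto (fun r : ℝ => ENNReal.ofReal (r ^ n) *
        volume (Metric.ball (0 : E n) 1)) (𝓝 0) (𝓝 (ENNReal.ofReal (0 ^ n) *
          volume (Metric.ball (0 : E n) 1))) :=
      ENNReal.Tendsto.mul_const (ENNReal.tendsto_ofReal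
        ((continuous_pow n).tendsto 0)) (Or.inr measure_ball_lt_top.ne)
    rw [zero_pow hn.ne', ENNReal.ofReal_zero, zero_mul] at h0
    refine (h0.mono_left nhdsWithin_le_nhds).congr' ?_
    filter_upwards [self_mem_nhdsWithin] with r hr
    rw [Measure.addHaar_closedBall _ _ (le_of_lt hr), finrank_euclideanSpace_fin]
  have h := tendsto_setLIntegral_zero hfin hvol
  obtain ⟨r, hr, hr0⟩ := ((h.eventually (gt_mem_nhds hη)).and self_mem_nhdsWithin).exists
  exact ⟨r, hr0, hr⟩

/-- Near 0 the integrand is of order ‖h‖ ^ (p - n - σ), integrable because σ < p; far away it is at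
most the tail of the kernel. -/
lemma lintegral_min_rpow_lt_top (hn : 0 < n) (hp : 1 ≤ p) (hσ : 0 < σ) (hσp : σ < p) {a : ℝ}
    (ha : 0 < a) :
    ∫⁻ h : E n, ENNReal.ofReal (min 1 (‖h‖ / a)) ^ p * ‖h‖ₑ ^ (-((n : ℝ) + σ)) < ∞ := by
  have hp0 : 0 < p := by linarith
  set q : ℝ := n + σ with hq
  obtain ⟨κ, hκ, htail⟩ := exists_lintegral_tail_le (n := n) hσ
  have hnear := lintegral_ball_enorm_rpow_lt_top hn (a := p - q) (by rw [hq]; linarith) 1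
  rw [← lintegral_add_compl _ (measurableSet_ball : MeasurableSet (Metric.ball (0 : E n) 1))]
  refine ENNReal.add_lt_top.2 ⟨?_, ?_⟩
  · have hc : ENNReal.ofReal a⁻¹ ^ p ≠ ∞ :=
      ENNReal.rpow_ne_top_of_nonneg hp0.le ENNReal.ofReal_ne_top
    refine lt_of_le_of_lt (lintegral_mono (g := fun h => ENNReal.ofReal a⁻¹ ^ p * ‖h‖ₑ ^ (p - q))
      fun h => ?_) (by
        rw [lintegral_const_mul' _ _ hc]
        exact ENNReal.mul_lt_top hc.lt_top hnear)
    rcases eq_or_ne h 0 with rfl | h0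
    · simp [ENNReal.zero_rpow_of_pos hp0]
    · have h0' : ‖h‖ₑ ≠ 0 := by simpa using h0
      calc _ ≤ (ENNReal.ofReal a⁻¹ * ‖h‖ₑ) ^ p * ‖h‖ₑ ^ (-q) := by
            gcongr
            rw [← ofReal_norm, ← ENNReal.ofReal_mul (by positivity), ← div_eq_inv_mul]
            exact ENNReal.ofReal_le_ofReal (min_le_right _ _)
        _ = _ := by
            rw [ENNReal.mul_rpow_of_nonneg _ _ hp0.le, mul_assoc,
              ← ENNReal.rpow_add _ _ h0' (by simp), ← sub_eq_add_neg]
  · refine lt_of_le_of_lt ?_ (ENNReal.mul_lt_top hκ.lt_top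
      (ENNReal.rpow_lt_top_of_nonneg (x := ENNReal.ofReal 1) (y := 0) le_rfl
        ENNReal.ofReal_ne_top))
    have h1 := htail 1 one_pos
    rw [ENNReal.ofReal_one, ENNReal.one_rpow] at h1
    rw [ENNReal.rpow_zero]
    refine le_trans ?_ h1
    have hset : (Metric.ball (0 : E n) 1)ᶜ = {h | 1 ≤ ‖h‖} := by
      ext h; simp
    rw [hset]
    refine lintegral_mono fun h => ?_
    refine mul_le_of_le_one_left' (ENNReal.rpow_le_one ?_ hp0.le)
    rw [← ENNReal.ofReal_one]
    exact ENNReal.ofReal_le_ofReal (min_le_left _ _)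

/-- A Lipschitz cutoff, equal to `1` near `S` and to `0` at distance at least `2 a` from `S`. -/
def cutoff (S : Set (E n)) (a : ℝ) (x : E n) : ℝ := max 0 (min 1 (2 - Metric.infDist x S / a))

lemma cutoff_nonneg (S : Set (E n)) (a : ℝ) (x : E n) : 0 ≤ cutoff S a x := le_max_left _ _

lemma cutoff_le_one (S : Set (E n)) (a : ℝ) (x : E n) : cutoff S a x ≤ 1 :=
  max_le zero_le_one (min_le_left _ _)

lemma continuous_cutoff (S : Set (E n)) (a : ℝ) : Continuous (cutoff S a) := by
  have := Metric.continuous_infDist_pt S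
  unfold cutoff
  fun_prop

lemma cutoff_eq_one {S : Set (E n)} {a : ℝ} (ha : 0 < a) {x : E n}
    (hx : Metric.infDist x S ≤ a) : cutoff S a x = 1 := by
  have : Metric.infDist x S / a ≤ 1 := (div_le_one ha).2 hx
  rw [cutoff, min_eq_left (by linarith), max_eq_right zero_le_one]

lemma cutoff_eq_zero {S : Set (E n)} {a : ℝ} (ha : 0 < a) {x : E n}
    (hx : 2 * a ≤ Metric.infDist x S) : cutoff S a x = 0 := by
  have : 2 ≤ Metric.infDist x S / a := (le_div_iff₀ ha).2 hx
  rw [cutoff, max_eq_left ((min_le_right _ _).trans (by linarith))]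

lemma abs_cutoff_sub_le (S : Set (E n)) {a : ℝ} (ha : 0 < a) (x y : E n) :
    |cutoff S a x - cutoff S a y| ≤ min 1 (‖x - y‖ / a) := by
  refine le_min ?_ ?_
  · have h1 := cutoff_nonneg S a x
    have h2 := cutoff_nonneg S a y
    have h3 := cutoff_le_one S a x
    have h4 := cutoff_le_one S a y
    rw [abs_le]; constructor <;> linarith
  · unfold cutoff
    refine (abs_max_sub_max_le_max _ _ _ _).trans ?_
    rw [sub_self, abs_zero]
    refine max_le (by positivity) ((abs_min_sub_min_le_max _ _ _ _).trans ?_)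
    rw [sub_self, abs_zero]
    refine max_le (by positivity) ?_
    rw [sub_sub_sub_cancel_left, ← sub_div, abs_div, abs_of_pos ha, abs_sub_comm]
    gcongr
    have := (Metric.lipschitz_infDist_pt S).dist_le_mul x y
    rwa [NNReal.coe_one, one_mul, Real.dist_eq, dist_eq_norm] at this

/-- Increments of the product of a bounded function supported in `U` with a cutoff. -/
lemma enorm_cutoff_smul_sub_rpow_le (hp : 1 ≤ p) {S U : Set (E n)} {a : ℝ} (ha : 0 < a)
    (hU : ∀ x, x ∉ U → cutoff S a x = 0) {g : E n → E m} {M : ℝ} (hM : ∀ x, ‖g x‖ ≤ M)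
    (x y : E n) :
    ‖cutoff S a x • g x - cutoff S a y • g y‖ₑ ^ p ≤
      2 ^ (p - 1) * (U.indicator (fun x => U.indicator (fun y => ‖g x - g y‖ₑ ^ p) y) x +
        (U.indicator 1 x + U.indicator 1 y) *
          (ENNReal.ofReal M ^ p * ENNReal.ofReal (min 1 (‖x - y‖ / a)) ^ p)) := by
  have hp0 : 0 < p := by linarith
  have h2 : (1 : ℝ≥0∞) ≤ 2 ^ (p - 1) := by
    simpa using ENNReal.rpow_le_rpow_of_exponent_le one_le_two (by linarith : (0 : ℝ) ≤ p - 1)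
  have hkey : ∀ x y z : E n, ‖(cutoff S a x - cutoff S a y) • g z‖ₑ ^ p ≤
      ENNReal.ofReal M ^ p * ENNReal.ofReal (min 1 (‖x - y‖ / a)) ^ p := fun x y z => by
    rw [enorm_smul, mul_comm, ← ENNReal.mul_rpow_of_nonneg _ _ hp0.le]
    refine ENNReal.rpow_le_rpow (mul_le_mul' ?_ ?_) hp0.le
    · rw [← ofReal_norm]; exact ENNReal.ofReal_le_ofReal (hM z)
    · rw [← ofReal_norm]
      exact ENNReal.ofReal_le_ofReal (abs_cutoff_sub_le S ha x y)
  by_cases hx : x ∈ U <;> by_cases hy : y ∈ U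
  · simp only [indicator_of_mem hx, indicator_of_mem hy, Pi.one_apply]
    have e : cutoff S a x • g x - cutoff S a y • g y =
        cutoff S a x • (g x - g y) + (cutoff S a x - cutoff S a y) • g y := by
      rw [smul_sub, sub_smul]; abel
    rw [e]
    refine (enorm_add_rpow_le hp _ _).trans ?_
    gcongr
    · rw [enorm_smul]
      refine mul_le_of_le_one_left' ?_
      rw [← ofReal_norm, Real.norm_eq_abs, abs_of_nonneg (cutoff_nonneg S a x)]
      exact ENNReal.ofReal_le_one.2 (cutoff_le_one S a x)
    · refine (hkey x y y).trans (le_mul_of_one_le_left' ?_)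
      exact le_add_right le_rfl
  · simp only [indicator_of_mem hx, indicator_of_notMem hy, Pi.one_apply]
    have e : cutoff S a x • g x - cutoff S a y • g y = (cutoff S a x - cutoff S a y) • g x := by
      rw [hU y hy]; simp
    rw [e, add_zero, one_mul, zero_add]
    exact (hkey x y x).trans (le_mul_of_one_le_left' h2)
  · simp only [indicator_of_notMem hx, indicator_of_mem hy, Pi.one_apply]
    have e : cutoff S a x • g x - cutoff S a y • g y = (cutoff S a x - cutoff S a y) • g y := by
      rw [hU x hx]; simp
    rw [e, zero_add, zero_add, one_mul]
    exact (hkey x y y).trans (le_mul_of_one_le_left' h2)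
  · rw [hU x hx, hU y hy]
    simp [ENNReal.zero_rpow_of_pos hp0]

/-- A bounded function of finite energy on `U` has, after multiplication by a cutoff, finite
energy on the whole space. -/
lemma lintegral_modp_cutoff_lt_top (hn : 0 < n) (hp : 1 ≤ p) (hσ : 0 < σ) (hσp : σ < p)
    {S U : Set (E n)} {a : ℝ} (ha : 0 < a) (hU : ∀ x, x ∉ U → cutoff S a x = 0)
    (hUm : MeasurableSet U) (hUv : volume U ≠ ∞) {g : E n → E m} (hg : Measurable g) {M : ℝ}
    (hM : ∀ x, ‖g x‖ ≤ M)
    (hfin : ∫⁻ x in U, ∫⁻ y in U, ‖g x - g y‖ₑ ^ p / ‖x - y‖ₑ ^ ((n : ℝ) + σ) ≠ ∞) :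
    ∫⁻ w, modp p (fun x => cutoff S a x • g x) w * ‖w‖ₑ ^ (-((n : ℝ) + σ)) ≠ ∞ := by
  have hp0 : 0 < p := by linarith
  set q : ℝ := n + σ with hq
  let A : E n → E n → ℝ≥0∞ := fun x y =>
    U.indicator (fun x => U.indicator (fun y => ‖g x - g y‖ₑ ^ p) y) x
  have hA : Measurable (Function.uncurry A) := by
    have : Function.uncurry A = (U ×ˢ U).indicator fun y : E n × E n => ‖g y.1 - g y.2‖ₑ ^ p := by
      ext ⟨x, y⟩
      by_cases hx : x ∈ U <;> by_cases hy : y ∈ U <;> simp [A, hx, hy]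
    rw [this]
    exact Measurable.indicator (by fun_prop) (hUm.prod hUm)
  let ψ : E n → ℝ≥0∞ := fun h => ENNReal.ofReal (min 1 (‖h‖ / a)) ^ p
  have hψ : Measurable ψ := by fun_prop
  have h1m : Measurable (U.indicator (1 : E n → ℝ≥0∞)) := measurable_one.indicator hUm
  have hmodle : ∀ h, modp p (fun x => cutoff S a x • g x) h ≤
      2 ^ (p - 1) * ((∫⁻ x, A x (x + h)) + 2 * volume U * (ENNReal.ofReal M ^ p * ψ h)) := by
    intro h
    have hAh : Measurable fun x => A x (x + h) :=
      hA.comp (f := fun x : E n => (x, x + h)) (by fun_prop)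
    calc _ ≤ ∫⁻ x, 2 ^ (p - 1) * (A x (x + h) + (U.indicator 1 x + U.indicator 1 (x + h)) *
          (ENNReal.ofReal M ^ p * ψ h)) := by
          refine lintegral_mono fun x => ?_
          have := enorm_cutoff_smul_sub_rpow_le hp ha hU hM x (x + h)
          rw [sub_add_cancel_left, norm_neg] at this
          refine le_trans (le_of_eq ?_) this
          rw [← enorm_neg, neg_sub]
      _ = _ := by
          rw [lintegral_const_mul' _ _ (by simp), lintegral_add_left hAh,
            lintegral_mul_const _ (by fun_prop), lintegral_add_left h1m,
            lintegral_add_right_eq_self (U.indicator 1) h, lintegral_indicator_one hUm, two_mul]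
  have hE : ∫⁻ h, (∫⁻ x, A x (x + h)) * ‖h‖ₑ ^ (-q) ≠ ∞ := by
    have e := lintegral_lintegral_eq_increment (n := n)
      (κ := fun x y => A x y * ‖x - y‖ₑ ^ (-q))
      (hA.mul (by fun_prop : Measurable fun y : E n × E n => ‖y.1 - y.2‖ₑ ^ (-q)))
    have e2 : ∫⁻ h, ∫⁻ x, A x (x + h) * ‖x - (x + h)‖ₑ ^ (-q) =
        ∫⁻ h, (∫⁻ x, A x (x + h)) * ‖h‖ₑ ^ (-q) := by
      refine lintegral_congr fun h => ?_
      have hAh : Measurable fun x => A x (x + h) :=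
        hA.comp (f := fun x : E n => (x, x + h)) (by fun_prop)
      simp_rw [sub_add_cancel_left, enorm_neg]
      rw [lintegral_mul_const _ hAh]
    rw [← e2, ← e]
    convert hfin using 1
    rw [← lintegral_indicator hUm]
    refine lintegral_congr fun x => ?_
    by_cases hx : x ∈ U
    · rw [indicator_of_mem hx, ← lintegral_indicator hUm]
      refine lintegral_congr fun y => ?_
      by_cases hy : y ∈ U
      · simp only [A, indicator_of_mem hx, indicator_of_mem hy]
        rw [ENNReal.rpow_neg, ENNReal.div_eq_inv_mul, mul_comm]
      · simp only [A, indicator_of_mem hx, indicator_of_notMem hy, zero_mul]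
    · simp only [A, indicator_of_notMem hx, zero_mul, lintegral_zero]
  have hψfin : ∫⁻ h, ψ h * ‖h‖ₑ ^ (-q) ≠ ∞ := (lintegral_min_rpow_lt_top hn hp hσ hσp ha).ne
  have hAm : Measurable fun h => ∫⁻ x, A x (x + h) :=
    Measurable.lintegral_prod_right' (f := fun y : E n × E n => A y.2 (y.2 + y.1))
      (hA.comp (f := fun y : E n × E n => (y.2, y.2 + y.1)) (by fun_prop))
  have hMt : ENNReal.ofReal M ^ p ≠ ∞ := ENNReal.rpow_ne_top_of_nonneg hp0.le ENNReal.ofReal_ne_top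
  refine (lt_of_le_of_lt (lintegral_mono fun h => mul_le_mul_left (hmodle h) _) ?_).ne
  have e3 : ∀ h, 2 ^ (p - 1) * ((∫⁻ x, A x (x + h)) + 2 * volume U *
      (ENNReal.ofReal M ^ p * ψ h)) * ‖h‖ₑ ^ (-q) =
      2 ^ (p - 1) * ((∫⁻ x, A x (x + h)) * ‖h‖ₑ ^ (-q) + 2 * volume U * ENNReal.ofReal M ^ p *
        (ψ h * ‖h‖ₑ ^ (-q))) := fun h => by ring
  refine (lintegral_congr e3).trans_lt ?_
  have h2t : (2 : ℝ≥0∞) ^ (p - 1) ≠ ∞ := by simp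
  rw [lintegral_const_mul' _ _ h2t, lintegral_add_left (by fun_prop),
    lintegral_const_mul' _ _ (ENNReal.mul_ne_top (ENNReal.mul_ne_top (by simp) hUv) hMt)]
  exact ENNReal.mul_lt_top h2t.lt_top (ENNReal.add_lt_top.2 ⟨hE.lt_top, ENNReal.mul_lt_top
    (ENNReal.mul_ne_top (ENNReal.mul_ne_top (by simp) hUv) hMt).lt_top hψfin.lt_top⟩)

/-- Replacing a map on `ω` by a map of finite energy on the whole space. -/
theorem exists_extension {s : ℝ} (hs0 : 0 < s) (hs1 : s < 1) (hn : 0 < n) (hp : 1 ≤ p)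
    {N : Set (E m)} (hNc : IsCompact N) {Ω ω : Set (E n)} (hΩ : Ω.Nonempty)
    (hΩb : Bornology.IsBounded Ω) (hω : IsOpen ω) (hωb : Bornology.IsBounded ω)
    (hΩω : closure Ω ⊆ ω) {f : E n → E m} (hf : MemWsp s p ω N f) :
    ∃ (F : E n → E m) (M a : ℝ), Measurable F ∧ (∀ x, ‖F x‖ ≤ M) ∧ Integrable F ∧ 0 < a ∧
      (∀ x, Metric.infDist x (closure Ω) ≤ a → x ∈ ω) ∧
      (∀ᵐ x, Metric.infDist x (closure Ω) ≤ a → F x = f x ∧ F x ∈ N) ∧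
      ∫⁻ w, modp p F w * ‖w‖ₑ ^ (-((n : ℝ) + s * p)) ≠ ∞ := by
  have hp0 : 0 < p := by linarith
  obtain ⟨hfm, hfin, hfN⟩ := hf
  have hcl : IsCompact (closure Ω) := hΩb.isCompact_closure
  obtain ⟨b, hb, hbω⟩ := hcl.exists_cthickening_subset_open hω hΩω
  have hmem : ∀ x, Metric.infDist x (closure Ω) ≤ b → x ∈ ω := fun x hx => hbω (by
    rw [Metric.cthickening_eq_preimage_infEDist, mem_preimage, mem_Iic]
    rw [ENNReal.le_ofReal_iff_toReal_le (Metric.infEDist_ne_top hΩ.closure) hb.le]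
    exact hx)
  obtain ⟨M, hM⟩ := hNc.isBounded.exists_norm_le
  have hωm := hω.measurableSet
  have hωv : volume ω ≠ ∞ := hωb.measure_lt_top.ne
  set f' := hfm.mk f with hf'
  have hf'm : Measurable f' := hfm.stronglyMeasurable_mk.measurable
  have hff' : f =ᵐ[volume.restrict ω] f' := hfm.ae_eq_mk
  set A : Set (E n) := ω ∩ f' ⁻¹' N with hA
  have hAm : MeasurableSet A := hωm.inter (hf'm hNc.measurableSet)
  set g : E n → E m := A.indicator f' with hg
  have hgm : Measurable g := hf'm.indicator hAm
  have hgf : g =ᵐ[volume.restrict ω] f := by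
    filter_upwards [hff', hfN, ae_restrict_mem hωm] with x hx hxN hxω
    have : x ∈ A := ⟨hxω, by rw [mem_preimage, ← hx]; exact hxN⟩
    rw [hg, indicator_of_mem this, hx]
  have hgM : ∀ x, ‖g x‖ ≤ max M 0 := fun x => by
    by_cases hx : x ∈ A
    · rw [hg, indicator_of_mem hx]; exact (hM _ hx.2).trans (le_max_left _ _)
    · rw [hg, indicator_of_notMem hx, norm_zero]; exact le_max_right _ _
  -- With parameter b / 2 the cutoff is 1 up to distance b / 2 from Ω and vanishes from distance b
  -- on, hence outside ω.
  have ha : 0 < b / 2 := by positivity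
  have hcut : ∀ x, x ∉ ω → cutoff (closure Ω) (b / 2) x = 0 := fun x hx =>
    cutoff_eq_zero ha (by
      by_contra! h
      exact hx (hmem x (by linarith)))
  have hFm : Measurable fun x => cutoff (closure Ω) (b / 2) x • g x :=
    (continuous_cutoff _ _).measurable.smul hgm
  have hFM : ∀ x, ‖cutoff (closure Ω) (b / 2) x • g x‖ ≤ max M 0 := fun x => by
    rw [norm_smul, Real.norm_eq_abs, abs_of_nonneg (cutoff_nonneg _ _ _)]
    exact (mul_le_of_le_one_left (norm_nonneg _) (cutoff_le_one _ _ _)).trans (hgM x)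
  refine ⟨fun x => cutoff (closure Ω) (b / 2) x • g x, max M 0, b / 2, hFm, hFM, ?_, ha,
    fun x hx => hmem x (by linarith), ?_, ?_⟩
  · have h1 : IntegrableOn (fun x => cutoff (closure Ω) (b / 2) x • g x) ω :=
      IntegrableOn.of_bound hωv.lt_top hFm.aestronglyMeasurable (max M 0) (.of_forall hFM)
    refine (integrableOn_iff_integrable_of_support_subset fun x hx => ?_).1 h1
    by_contra hxω
    simp [hcut x hxω] at hx
  · rw [Filter.EventuallyEq, ae_restrict_iff' hωm] at hgf
    rw [ae_restrict_iff' hωm] at hfN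
    filter_upwards [hgf, hfN] with x hx hxN hxd
    have hxω := hmem x (by linarith)
    simp only [cutoff_eq_one ha hxd, one_smul]
    rw [hx hxω]
    exact ⟨rfl, hxN hxω⟩
  · refine lintegral_modp_cutoff_lt_top hn hp (by positivity) (by nlinarith) ha hcut hωm hωv hgm
      hgM ?_
    have hE : gagliardoEnergy s p ω f ≠ ∞ := by
      intro h
      rw [wspNorm, h, ENNReal.top_rpow_of_pos (by positivity), add_top] at hfin
      exact lt_irrefl _ hfin
    convert hE using 1
    rw [gagliardoEnergy]
    refine lintegral_congr_ae ?_
    filter_upwards [hgf] with x hx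
    refine lintegral_congr_ae ?_
    filter_upwards [hgf] with y hy
    rw [hx, hy]

end Cutoff

end FracSobolev
end

noncomputable section
namespace FracSobolev
open MeasureTheory Set
open scoped ENNReal Topology

/-! ### Approximation by piecewise homogeneous maps -/

section Approximation

variable {n m j : ℕ} {s p σ : ℝ}

lemma exists_pos_mul_le {c θ : ℝ≥0∞} (hc : c ≠ ∞) (hθ : 0 < θ) :
    ∃ b : ℝ≥0∞, 0 < b ∧ b ≠ ∞ ∧ c * b ≤ θ := by
  rcases eq_or_ne θ ∞ with rfl | hθt
  · exact ⟨1, one_pos, ENNReal.one_ne_top, le_top⟩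
  refine ⟨θ / (c + 1), ENNReal.div_pos hθ.ne' (ENNReal.add_ne_top.2 ⟨hc, ENNReal.one_ne_top⟩),
    ENNReal.div_ne_top hθt (by simp), ?_⟩
  rw [← mul_div_assoc, mul_comm]
  refine ENNReal.div_le_of_le_mul ?_
  gcongr
  exact le_self_add

/-- Three functions with small integrals are simultaneously small somewhere. -/
lemma exists_forall_le_of_lintegral_le {D : Set (E n)} (hD : MeasurableSet D)
    (hD0 : volume D ≠ 0) (hDt : volume D ≠ ∞) {X₁ X₂ X₃ : E n → ℝ≥0∞} (h₁ : Measurable X₁)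
    (h₂ : Measurable X₂) {b₁ b₂ b₃ : ℝ≥0∞} (hb₁ : b₁ ≠ 0) (hb₂ : b₂ ≠ 0) (hb₃ : b₃ ≠ 0)
    (hb₁t : b₁ ≠ ∞) (hb₂t : b₂ ≠ ∞) (hb₃t : b₃ ≠ ∞)
    (hX₁ : ∫⁻ τ in D, X₁ τ ≤ b₁ * (volume D / 4)) (hX₂ : ∫⁻ τ in D, X₂ τ ≤ b₂ * (volume D / 4))
    (hX₃ : ∫⁻ τ in D, X₃ τ ≤ b₃ * (volume D / 4)) :
    ∃ τ ∈ D, X₁ τ ≤ b₁ ∧ X₂ τ ≤ b₂ ∧ X₃ τ ≤ b₃ := by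
  by_contra! hcon
  have hmul : ∀ {b : ℝ≥0∞} {X : E n → ℝ≥0∞}, b ≠ 0 → b ≠ ∞ →
      ∫⁻ τ in D, X τ ≤ b * (volume D / 4) → ∫⁻ τ in D, X τ * b⁻¹ ≤ volume D / 4 := by
    intro b X hb hbt hX
    rw [lintegral_mul_const' _ _ (ENNReal.inv_ne_top.2 hb)]
    calc _ ≤ b * (volume D / 4) * b⁻¹ := by gcongr
      _ = volume D / 4 * (b * b⁻¹) := by ring
      _ = _ := by rw [ENNReal.mul_inv_cancel hb hbt, mul_one]
  have hone : ∀ {b c : ℝ≥0∞}, b ≠ ∞ → b < c → 1 ≤ c * b⁻¹ := fun {b c} hbt h => by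
    rcases eq_or_ne b 0 with rfl | hb
    · simp [h.ne']
    rw [← ENNReal.mul_inv_cancel hb hbt]
    gcongr
  have hpt : ∀ τ ∈ D, 1 ≤ X₁ τ * b₁⁻¹ + (X₂ τ * b₂⁻¹ + X₃ τ * b₃⁻¹) := by
    intro τ hτ
    by_cases c₁ : X₁ τ ≤ b₁
    · by_cases c₂ : X₂ τ ≤ b₂
      · exact (hone hb₃t (hcon τ hτ c₁ c₂)).trans (le_add_self.trans le_add_self)
      · exact (hone hb₂t (not_le.1 c₂)).trans (le_self_add.trans le_add_self)
    · exact (hone hb₁t (not_le.1 c₁)).trans le_self_add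
  -- Each function exceeds its bound on at most a quarter of `D`, so three quarters at most are
  -- excluded.
  have hlt : volume D / 4 + (volume D / 4 + volume D / 4) < volume D := by
    set v := (volume D).toReal with hv
    have hv0 : 0 < v := ENNReal.toReal_pos hD0 hDt
    have e : volume D = ENNReal.ofReal v := (ENNReal.ofReal_toReal hDt).symm
    have e4 : volume D / 4 = ENNReal.ofReal (v / 4) := by
      rw [e, ENNReal.ofReal_div_of_pos (by norm_num), ENNReal.ofReal_ofNat]
    rw [e4, ← ENNReal.ofReal_add (by positivity) (by positivity),
      ← ENNReal.ofReal_add (by positivity) (by positivity), e]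
    exact (ENNReal.ofReal_lt_ofReal_iff hv0).2 (by linarith)
  refine absurd ?_ (not_le.2 hlt)
  calc volume D = ∫⁻ _τ in D, 1 := by simp
    _ ≤ ∫⁻ τ in D, (X₁ τ * b₁⁻¹ + (X₂ τ * b₂⁻¹ + X₃ τ * b₃⁻¹)) := setLIntegral_mono' hD hpt
    _ = (∫⁻ τ in D, X₁ τ * b₁⁻¹) + ((∫⁻ τ in D, X₂ τ * b₂⁻¹) + ∫⁻ τ in D, X₃ τ * b₃⁻¹) := by
        -- Additivity needs only the first summand to be measurable, so `X₃`, placed last, may be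
        -- arbitrary.
        rw [lintegral_add_left (by fun_prop), lintegral_add_left (by fun_prop)]
    _ ≤ _ := add_le_add (hmul hb₁ hb₁t hX₁) (add_le_add (hmul hb₂ hb₂t hX₂) (hmul hb₃ hb₃t hX₃))

/-- Splitting of the Gagliardo energy into near and far pairs. -/
lemma gagliardoEnergy_le (hs0 : 0 < s) (hp : 1 ≤ p) {U : Set (E n)}
    {w : E n → E m} (hw : AEMeasurable w (volume.restrict U)) {κ : E n → E n → ℝ≥0∞}
    (hκ : Measurable (Function.uncurry κ))
    (hle : ∀ᵐ x ∂volume.restrict U, ∀ᵐ y ∂volume.restrict U, ‖w x - w y‖ₑ ^ p ≤ κ x y) {δ : ℝ}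
    (hδ : 0 < δ) :
    gagliardoEnergy s p U w ≤
      (∫⁻ h in Metric.ball 0 δ, ‖h‖ₑ ^ (-((n : ℝ) + s * p)) * ∫⁻ x, κ x (x + h)) +
        ENNReal.ofReal δ ^ (-((n : ℝ) + s * p)) * 2 ^ p * volume U * ∫⁻ x in U, ‖w x‖ₑ ^ p := by
  have hp0 : 0 < p := by linarith
  set q : ℝ := n + s * p with hq
  have hq0 : 0 < q := by positivity
  let A : E n → E n → ℝ≥0∞ := fun x y =>
    (Metric.ball (0 : E n) δ).indicator (fun h => ‖h‖ₑ ^ (-q)) (y - x) * κ x y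
  have hA : Measurable (Function.uncurry A) := by
    have h1 : Measurable ((Metric.ball (0 : E n) δ).indicator fun h => ‖h‖ₑ ^ (-q)) :=
      Measurable.indicator (by fun_prop) measurableSet_ball
    exact (h1.comp (f := fun y : E n × E n => y.2 - y.1) (by fun_prop)).mul hκ
  -- For pairs at distance at least δ the kernel is at most δ ^ (-q), and 2 ^ (p - 1) comes from the
  -- convexity bound for ‖w x - w y‖ ^ p.
  set c : ℝ≥0∞ := ENNReal.ofReal δ ^ (-q) * 2 ^ (p - 1) with hc
  have hδt : ENNReal.ofReal δ ^ (-q) ≠ ∞ := by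
    rw [ENNReal.ofReal_rpow_of_pos hδ]; exact ENNReal.ofReal_ne_top
  have hct : c ≠ ∞ := ENNReal.mul_ne_top hδt (by simp)
  have hwp : AEMeasurable (fun x => ‖w x‖ₑ ^ p) (volume.restrict U) := hw.enorm.pow_const p
  have hpt : ∀ᵐ x ∂volume.restrict U, ∀ᵐ y ∂volume.restrict U,
      ‖w x - w y‖ₑ ^ p / ‖x - y‖ₑ ^ q ≤ A x y + c * (‖w x‖ₑ ^ p + ‖w y‖ₑ ^ p) := by
    filter_upwards [hle] with x hx
    filter_upwards [hx] with y hxy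
    rw [ENNReal.div_eq_inv_mul, ← ENNReal.rpow_neg]
    by_cases hd : y - x ∈ Metric.ball (0 : E n) δ
    · refine le_add_right ?_
      simp only [A, indicator_of_mem hd]
      rw [← enorm_neg (y - x), neg_sub]
      gcongr
    · refine le_add_left ?_
      rw [hc, mul_assoc]
      refine mul_le_mul' ?_ (enorm_sub_rpow_le hp _ _)
      rw [ENNReal.rpow_neg, ENNReal.rpow_neg, ENNReal.inv_le_inv]
      refine ENNReal.rpow_le_rpow ?_ hq0.le
      rw [← ofReal_norm, norm_sub_rev]
      exact ENNReal.ofReal_le_ofReal (by simpa using hd)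
  calc gagliardoEnergy s p U w
      ≤ ∫⁻ x in U, ∫⁻ y in U, (A x y + c * (‖w x‖ₑ ^ p + ‖w y‖ₑ ^ p)) := by
        refine lintegral_mono_ae ?_
        filter_upwards [hpt] with x hx using lintegral_mono_ae hx
    _ = ∫⁻ x in U, ((∫⁻ y in U, A x y) +
          c * (volume U * ‖w x‖ₑ ^ p + ∫⁻ y in U, ‖w y‖ₑ ^ p)) := by
        refine lintegral_congr fun x => ?_
        have hAx : Measurable fun y => A x y :=
          hA.comp (f := fun y : E n => (x, y)) (by fun_prop)
        rw [lintegral_add_left hAx,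
          lintegral_const_mul' _ _ hct, lintegral_add_left measurable_const, setLIntegral_const,
          mul_comm (‖w x‖ₑ ^ p)]
    _ = (∫⁻ x in U, ∫⁻ y in U, A x y) + c * (2 * volume U * ∫⁻ y in U, ‖w y‖ₑ ^ p) := by
        have hAU : Measurable fun x => ∫⁻ y in U, A x y :=
          hA.lintegral_prod_right' (ν := volume.restrict U)
        rw [lintegral_add_left hAU,
          lintegral_const_mul' _ _ hct, lintegral_add_right _ measurable_const,
          lintegral_const_mul'' _ hwp, setLIntegral_const]
        ring
    _ ≤ _ := by
        refine add_le_add ?_ (le_of_eq ?_)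
        · calc ∫⁻ x in U, ∫⁻ y in U, A x y ≤ ∫⁻ x, ∫⁻ y, A x y :=
                (setLIntegral_le_lintegral _ _).trans
                  (lintegral_mono fun x => setLIntegral_le_lintegral _ _)
            _ = ∫⁻ h, ∫⁻ x, A x (x + h) := lintegral_lintegral_eq_increment hA
            _ = _ := by
              rw [← lintegral_indicator measurableSet_ball]
              refine lintegral_congr fun h => ?_
              simp only [A, add_sub_cancel_left]
              have hκh : Measurable fun x => κ x (x + h) :=
                hκ.comp (f := fun x : E n => (x, x + h)) (by fun_prop)
              rw [lintegral_const_mul _ hκh]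
              by_cases hh : h ∈ Metric.ball (0 : E n) δ
              · rw [indicator_of_mem hh, indicator_of_mem hh]
              · rw [indicator_of_notMem hh, indicator_of_notMem hh, zero_mul]
        · have : (2 : ℝ≥0∞) ^ p = 2 ^ (p - 1) * 2 := by
            nth_rewrite 3 [← ENNReal.rpow_one 2]
            rw [← ENNReal.rpow_add _ _ two_ne_zero (by simp), sub_add_cancel]
          rw [hc, this]
          ring

lemma wspNorm_le {U : Set (E n)} {w : E n → E m} (hp : 1 ≤ p) {η : ℝ≥0∞}
    (h₁ : ∫⁻ x in U, ‖w x‖ₑ ^ p ≤ (η / 2) ^ p) (h₂ : gagliardoEnergy s p U w ≤ (η / 2) ^ p) :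
    wspNorm s p U w ≤ η := by
  have hp0 : 0 < p := by linarith
  have e : ((η / 2) ^ p) ^ (1 / p) = η / 2 := by
    rw [← ENNReal.rpow_mul, mul_one_div_cancel hp0.ne', ENNReal.rpow_one]
  rw [wspNorm, ← ENNReal.add_halves η]
  refine add_le_add ?_ ?_
  · rw [eLpNorm_eq_lintegral_rpow_enorm_toReal (by simpa using hp0) ENNReal.ofReal_ne_top,
      ENNReal.toReal_ofReal hp0.le, ← e]
    exact ENNReal.rpow_le_rpow h₁ (by positivity)
  · rw [← e]
    exact ENNReal.rpow_le_rpow h₂ (by positivity)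

lemma gagliardoEnergy_congr_ae {U : Set (E n)} {v w : E n → E m}
    (h : v =ᵐ[volume.restrict U] w) : gagliardoEnergy s p U v = gagliardoEnergy s p U w := by
  refine lintegral_congr_ae ?_
  filter_upwards [h] with x hx
  refine lintegral_congr_ae ?_
  filter_upwards [h] with y hy
  rw [hx, hy]

/-- The scale invariant constant in the comparison of the distance to the target with the energy
near the `j`-skeleton. -/
lemma exists_mollifier_const_le (n : ℕ) (hjn : j ≤ n) (hjσ : j ≤ σ) {ε : ℝ} (hε : 0 < ε) :
    ∃ κ : ℝ≥0∞, κ ≠ ∞ ∧ ∀ ρ : ℝ, 0 < ρ → ρ ≤ 1 →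
      (volume (Metric.closedBall (0 : E n) (ρ / 2)))⁻¹ ^ 2 *
        ENNReal.ofReal (2 * ρ) ^ ((n : ℝ) + σ) * ENNReal.ofReal (ρ / ε) ^ (n - j) ≤ κ := by
  set v := volume (Metric.ball (0 : E n) 1) with hv
  have hv0 : v ≠ 0 := (Metric.measure_ball_pos _ _ one_pos).ne'
  refine ⟨v⁻¹ ^ 2 * ENNReal.ofReal (2 ^ (2 * n) * 2 ^ ((n : ℝ) + σ) * (ε ^ (n - j))⁻¹),
    ENNReal.mul_ne_top (ENNReal.pow_ne_top (ENNReal.inv_ne_top.2 hv0)) ENNReal.ofReal_ne_top,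
    fun ρ hρ hρ1 => ?_⟩
  rw [Measure.addHaar_closedBall _ _ (by positivity), finrank_euclideanSpace_fin, ← hv,
    ENNReal.mul_inv (Or.inr measure_ball_lt_top.ne) (Or.inr hv0),
    ← ENNReal.ofReal_inv_of_pos (by positivity), mul_pow, ← ENNReal.ofReal_pow (by positivity),
    ENNReal.ofReal_rpow_of_pos (by positivity), ← ENNReal.ofReal_pow (by positivity),
    mul_comm (ENNReal.ofReal _) (v⁻¹ ^ 2), mul_assoc, mul_assoc,
    ← ENNReal.ofReal_mul (by positivity), ← ENNReal.ofReal_mul (by positivity)]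
  refine mul_le_mul_right (ENNReal.ofReal_le_ofReal ?_) _
  have h1 : (ρ : ℝ) ^ (n - j) = ρ ^ ((n : ℝ) - j) := by
    rw [← Real.rpow_natCast, Nat.cast_sub hjn]
  have h2 : (ρ ^ n)⁻¹ = ρ ^ (-(n : ℝ)) := by
    rw [Real.rpow_neg hρ.le, Real.rpow_natCast]
  -- The exponents -2n from the two normalisations, n + σ from the kernel and n - j from the
  -- neighbourhood of the skeleton add up to σ - j.
  have h3 : (ρ ^ n)⁻¹ * (ρ ^ n)⁻¹ * ρ ^ ((n : ℝ) + σ) * ρ ^ (n - j) = ρ ^ (σ - j) := by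
    rw [h1, h2, ← Real.rpow_add hρ, ← Real.rpow_add hρ, ← Real.rpow_add hρ]
    congr 1
    ring
  have h4 : ρ ^ (σ - j) ≤ 1 := Real.rpow_le_one hρ.le hρ1 (by linarith)
  calc (((ρ / 2) ^ n)⁻¹) ^ 2 * ((2 * ρ) ^ ((n : ℝ) + σ) * (ρ / ε) ^ (n - j))
      = (2 ^ (2 * n) * 2 ^ ((n : ℝ) + σ) * (ε ^ (n - j))⁻¹) *
        ((ρ ^ n)⁻¹ * (ρ ^ n)⁻¹ * ρ ^ ((n : ℝ) + σ) * ρ ^ (n - j)) := by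
        rw [Real.mul_rpow (by norm_num) hρ.le, div_pow, div_pow, pow_mul']
        field_simp
    _ ≤ _ := by
        rw [h3]
        exact mul_le_of_le_one_right (by positivity) h4

lemma measurable_lintegral_energy_gridProj (hj : j < n) (ε δ : ℝ) {u : E n → E m}
    (hu : Measurable u) :
    Measurable fun τ : E n => ∫⁻ h in Metric.ball 0 δ, ‖h‖ₑ ^ (-((n : ℝ) + σ)) *
      ∫⁻ x, ‖u (gridProj j ε τ (x + h)) - u (gridProj j ε τ x)‖ₑ ^ p := by
  have hgp := measurable_gridProj (n := n) hj ε
  have hm3 : Measurable fun y : (E n × E n) × E n =>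
      ‖u (gridProj j ε y.1.1 (y.2 + y.1.2)) - u (gridProj j ε y.1.1 y.2)‖ₑ ^ p := by
    have h1 : Measurable fun y : (E n × E n) × E n => gridProj j ε y.1.1 (y.2 + y.1.2) :=
      hgp.comp (f := fun y : (E n × E n) × E n => (y.1.1, y.2 + y.1.2)) (by fun_prop)
    have h2 : Measurable fun y : (E n × E n) × E n => gridProj j ε y.1.1 y.2 :=
      hgp.comp (f := fun y : (E n × E n) × E n => (y.1.1, y.2)) (by fun_prop)
    fun_prop
  have hm2 := hm3.lintegral_prod_right' (ν := volume)
  exact Measurable.lintegral_prod_right' (f := fun y : E n × E n => ‖y.2‖ₑ ^ (-((n : ℝ) + σ)) *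
    ∫⁻ x, ‖u (gridProj j ε y.1 (x + y.2)) - u (gridProj j ε y.1 x)‖ₑ ^ p)
    ((by fun_prop : Measurable fun y : E n × E n => ‖y.2‖ₑ ^ (-((n : ℝ) + σ))).mul hm2)

namespace Mesh

variable (M : Mesh n) {τ : E n}

lemma coord_of_T_eq (hT : M.T = -(M.ε • τ)) (x : E n) : M.coord x = M.ε⁻¹ • x + τ := by
  rw [coord, hT, sub_neg_eq_add, smul_add, inv_smul_smul₀ M.ε_pos.ne']

lemma proj_of_T_eq (hT : M.T = -(M.ε • τ)) (x : E n) : M.proj j x = gridProj j M.ε τ x := by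
  rw [proj, M.coord_of_T_eq hT, gridProj, hT, smul_sub]
  abel

lemma ball_subset_nearSkel (hT : M.T = -(M.ε • τ)) {x : E n} (hx : x ∈ M.skeleton j) {ρ : ℝ}
    {y : E n} (hy : y ∈ Metric.ball x ρ) : M.ε⁻¹ • y + τ ∈ nearSkel j (ρ / M.ε) := by
  have hε := M.ε_pos
  obtain ⟨B, hB, hBx⟩ := M.exists_evenDist_eq_one_of_mem_skeleton hx
  refine ⟨B, hB, fun i hi => ?_⟩
  rw [← M.coord_of_T_eq hT]
  have h1 := evenDist_le_add (M.coord x i) (M.coord y i)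
  rw [hBx i hi] at h1
  have h2 : |M.coord x i - M.coord y i| ≤ ρ / M.ε := by
    have h3 := abs_apply_le_norm (M.coord x - M.coord y) i
    rw [M.coord_sub_coord, norm_smul, norm_inv, Real.norm_eq_abs, abs_of_pos hε] at h3
    rw [Metric.mem_ball, dist_comm, dist_eq_norm] at hy
    refine (le_of_eq (by rw [← M.coord_sub_coord]; rfl)).trans (h3.trans ?_)
    rw [div_eq_inv_mul]
    gcongr
  linarith

lemma measurable_coord : Measurable M.coord := by
  unfold coord
  fun_prop

lemma measurable_proj (hj : j < n) : Measurable (M.proj j) := by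
  have h1 := measurable_skelProj (n := n) hj
  have h2 := M.measurable_coord
  unfold proj
  fun_prop

end Mesh

end Approximation

end FracSobolev
end

noncomputable section
namespace FracSobolev
open MeasureTheory Set
open scoped ENNReal Topology

/-! ### The choice of the scales and of the position of the grid. -/

section Construction

variable {n m j : ℕ} {s p σ : ℝ}

/-- The choice of the mesh size, of the mollification scale and of the position of the grid. -/
lemma exists_grid (hj : j < n) (hp : 1 ≤ p) (hσ : 0 < σ) (hjσ : j ≤ σ) (hσj : σ < j + 1)
    {F : E n → E m} (hF : Measurable F) {M : ℝ} (hM : ∀ x, ‖F x‖ ≤ M) (hFi : Integrable F)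
    (hfin : ∫⁻ w, modp p F w * ‖w‖ₑ ^ (-((n : ℝ) + σ)) ≠ ∞) (N : Set (E m)) {a d : ℝ}
    (ha : 0 < a) (hd : 0 < d) {c θ : ℝ≥0∞} (hc : c ≠ ∞) (hθ : 0 < θ) (hθt : θ ≠ ∞) :
    ∃ δ ε ρ : ℝ, ∃ τ : E n, ∃ u : E n → E m, 0 < δ ∧ 0 < ε ∧ √n * (2 * ε) ≤ a ∧ ρ ≤ a ∧
      (∃ L, LipschitzWith L u) ∧
      ∫⁻ h in Metric.ball 0 δ, ‖h‖ₑ ^ (-((n : ℝ) + σ)) *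
        ∫⁻ x, ‖u (gridProj j ε τ (x + h)) - u (gridProj j ε τ x)‖ₑ ^ p ≤ θ ∧
      localEnergy p σ F δ ≤ θ ∧
      ∫⁻ x, ‖u (gridProj j ε τ x) - F x‖ₑ ^ p ≤ θ ∧
      ENNReal.ofReal δ ^ (-((n : ℝ) + σ)) * c *
        ∫⁻ x, ‖u (gridProj j ε τ x) - F x‖ₑ ^ p ≤ θ ∧
      ∀ x, (∀ᵐ y, y ∈ Metric.ball x ρ → F y ∈ N) →
        (∀ y ∈ Metric.ball x ρ, ε⁻¹ • y + τ ∈ nearSkel j (ρ / ε)) →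
        Metric.infEDist (u x) N ≤ ENNReal.ofReal d := by
  have hn : 0 < n := by omega
  have hp0 : 0 < p := by linarith
  have hV0 : volume (cell n) ≠ 0 := volume_cell_ne_zero
  have hVt : volume (cell n) ≠ ∞ := volume_cell_ne_top
  have hV4 : 0 < volume (cell n) / 4 := ENNReal.div_pos hV0 (by simp)
  have hsn : 0 < √(n : ℝ) := by positivity
  obtain ⟨κ₁, hκ₁, hE⟩ := exists_lintegral_cell_energy_le (n := n) hj hp hσ hσj
  obtain ⟨e, he0, -, he⟩ := exists_pos_mul_le hκ₁ (ENNReal.mul_pos hθ.ne' hV4.ne')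
  obtain ⟨r, hr, hre⟩ := exists_localEnergy_lt hfin hn (lt_min he0 hθ)
  -- Half of r is kept in reserve: ε will satisfy 2√n ε ≤ δ, so the enlarged radius δ + 2√n ε in the
  -- energy estimate does not exceed r.
  set δ := r / 2 with hδ
  have hδ0 : 0 < δ := by positivity
  have hδt : ENNReal.ofReal δ ^ (-((n : ℝ) + σ)) ≠ ∞ := by
    rw [ENNReal.ofReal_rpow_of_pos hδ0]; exact ENNReal.ofReal_ne_top
  -- The budget b for the L^p distance must be at most θ both by itself and after multiplication by
  -- the far-pair constant δ ^ (-n - σ) c; hence the sum with 1.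
  obtain ⟨b, hb0, hbt, hb⟩ := exists_pos_mul_le (ENNReal.add_ne_top.2
    ⟨ENNReal.mul_ne_top hδt hc, ENNReal.one_ne_top⟩) hθ
  rw [add_mul, one_mul] at hb
  obtain ⟨κ₂, hκ₂, hmod⟩ := exists_modp_le_localEnergy n hp hσ
  obtain ⟨e₂, he₂0, -, he₂⟩ := exists_pos_mul_le hκ₂
    (ENNReal.div_pos hb0.ne' (by simp : (4 : ℝ≥0∞) ≠ ∞))
  obtain ⟨r₂, hr₂, hre₂⟩ := exists_localEnergy_lt hfin hn he₂0
  have hmodb : ∀ v : E n, ‖v‖ ≤ min r₂ 1 → modp p F v ≤ b / 4 := fun v hv => by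
    refine (hmod hF v).trans (le_trans ?_ he₂)
    have h1 : ‖v‖ₑ ^ σ ≤ 1 := by
      refine ENNReal.rpow_le_one ?_ hσ.le
      rw [← ofReal_norm]
      exact ENNReal.ofReal_le_one.2 (hv.trans (min_le_right _ _))
    calc κ₂ * ‖v‖ₑ ^ σ * localEnergy p σ F ‖v‖ ≤ κ₂ * 1 * e₂ := by
          gcongr
          exact (localEnergy_mono F (hv.trans (min_le_left _ _))).trans hre₂.le
      _ = κ₂ * e₂ := by rw [mul_one]
  set t := min (δ / 2) (min (min r₂ 1 / 2) (a / 2)) with ht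
  have ht0 : 0 < t := by positivity
  have ht1 : t ≤ δ / 2 := min_le_left _ _
  have ht2 : t ≤ min r₂ 1 / 2 := (min_le_right _ _).trans (min_le_left _ _)
  have ht3 : t ≤ a / 2 := (min_le_right _ _).trans (min_le_right _ _)
  set ε := t / √n with hε
  have hε0 : 0 < ε := by positivity
  have hsε : √(n : ℝ) * ε = t := by rw [hε]; field_simp
  -- This constant depends on ε but not on ρ. With ε fixed, ρ can be taken so small that the energy
  -- on pairs at distance at most 2ρ absorbs it.
  obtain ⟨κ₃, hκ₃, hcst⟩ := exists_mollifier_const_le (σ := σ) n hj.le hjσ hε0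
  set c₄ : ℝ≥0∞ := (Finset.powersetCard (n - j) (Finset.univ : Finset (Fin n))).card * 2 ^ n
    with hc₄
  have hc₄t : c₄ ≠ ∞ := ENNReal.mul_ne_top (by simp) (by simp)
  set D : ℝ≥0∞ := ENNReal.ofReal d ^ p with hD
  have hD0 : 0 < D := ENNReal.rpow_pos (by simpa using hd) ENNReal.ofReal_ne_top
  have hDt : D ≠ ∞ := ENNReal.rpow_ne_top_of_nonneg hp0.le ENNReal.ofReal_ne_top
  obtain ⟨e₃, he₃0, -, he₃⟩ := exists_pos_mul_le (ENNReal.mul_ne_top hκ₃ hc₄t)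
    (ENNReal.mul_pos hD0.ne' hV4.ne')
  obtain ⟨r₃, hr₃, hre₃⟩ := exists_localEnergy_lt hfin hn he₃0
  set ρ := min 1 (min (min r₂ 1 / 2) (min a (r₃ / 2))) with hρ
  have hρ0 : 0 < ρ := by positivity
  have hρ1 : ρ ≤ 1 := min_le_left _ _
  have hρ2 : ρ ≤ min r₂ 1 / 2 := (min_le_right _ _).trans (min_le_left _ _)
  have hρ3 : ρ ≤ a := (min_le_right _ _).trans ((min_le_right _ _).trans (min_le_left _ _))
  have hρ4 : ρ ≤ r₃ / 2 := (min_le_right _ _).trans ((min_le_right _ _).trans (min_le_right _ _))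
  obtain ⟨μ, hμp, hμ, hac, hlip⟩ := exists_mollifier n hρ0
  set κρ := (volume (Metric.closedBall (0 : E n) (ρ / 2)))⁻¹ with hκρ
  have hκρt : κρ ≠ ∞ := ENNReal.inv_ne_top.2
    (Metric.measure_closedBall_pos _ _ (by positivity)).ne'
  have hκρ0 : κρ ≠ 0 := ENNReal.inv_ne_zero.2 measure_closedBall_lt_top.ne
  set A : ℝ≥0∞ := κρ ^ 2 * ENNReal.ofReal (2 * ρ) ^ ((n : ℝ) + σ) with hA
  have hA0 : A ≠ 0 := mul_ne_zero (pow_ne_zero _ hκρ0)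
    (ENNReal.rpow_pos (by simpa using hρ0) ENNReal.ofReal_ne_top).ne'
  have hAt : A ≠ ∞ := ENNReal.mul_ne_top (ENNReal.pow_ne_top hκρt)
    (ENNReal.rpow_ne_top_of_nonneg (by positivity) ENNReal.ofReal_ne_top)
  obtain ⟨L, hL⟩ := hlip F hFi
  have hu : Measurable (mollify μ F) := hL.continuous.measurable
  have hI₁ : ∫⁻ τ in cell n, ∫⁻ h in Metric.ball 0 δ, ‖h‖ₑ ^ (-((n : ℝ) + σ)) *
      ∫⁻ x, ‖mollify μ F (gridProj j ε τ (x + h)) - mollify μ F (gridProj j ε τ x)‖ₑ ^ p ≤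
      θ * (volume (cell n) / 4) := by
    refine (hE hu ε hε0 δ).trans (le_trans ?_ he)
    gcongr
    refine (localEnergy_mollify_le hp hF hM _).trans ((localEnergy_mono F ?_).trans
      (hre.le.trans (min_le_left _ _)))
    rw [mul_assoc, hsε]
    linarith
  have hI₂ : ∫⁻ τ in cell n, ∫⁻ x, ‖mollify μ F (gridProj j ε τ x) - F x‖ₑ ^ p ≤
      b * (volume (cell n) / 4) := by
    refine (lintegral_cell_gridProj_sub_le hj hε0 hp hF hM hu hac (b := b / 4)
      fun v hv => hmodb v (hv.trans ?_)).trans_eq ?_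
    · rw [hsε]; linarith
    · rw [div_eq_mul_inv, div_eq_mul_inv]; ring
  -- The budget is D / A because the distance estimate multiplies the integral by `A`, and D = d ^ p
  -- is the target.
  have hI₃ : ∫⁻ τ in cell n, ∫⁻ y in {y | ε⁻¹ • y + τ ∈ nearSkel j (ρ / ε)},
      energyDensity p σ F (2 * ρ) y ≤ D / A * (volume (cell n) / 4) := by
    rw [lintegral_cell_nearSkel (measurable_energyDensity hF _), lintegral_energyDensity hF,
      ENNReal.mul_comm_div, ← mul_div_assoc, ← mul_div_assoc,
      ENNReal.le_div_iff_mul_le (Or.inl hA0) (Or.inl hAt)]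
    calc volume (cell n ∩ nearSkel j (ρ / ε)) * localEnergy p σ F (2 * ρ) * A
        ≤ (c₄ * ENNReal.ofReal (ρ / ε) ^ (n - j)) * e₃ * A := by
          gcongr
          · exact volume_cell_inter_nearSkel_le j _
          · exact (localEnergy_mono F (by linarith)).trans hre₃.le
      _ = A * ENNReal.ofReal (ρ / ε) ^ (n - j) * c₄ * e₃ := by ring
      _ ≤ κ₃ * c₄ * e₃ := by
          gcongr
          exact hcst ρ hρ0 hρ1
      _ ≤ _ := by simpa [mul_div_assoc] using he₃
  have hX₂ : Measurable fun τ : E n => ∫⁻ x, ‖mollify μ F (gridProj j ε τ x) - F x‖ₑ ^ p := by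
    have hgp : Measurable fun y : E n × E n => gridProj j ε y.1 y.2 := measurable_gridProj hj ε
    exact Measurable.lintegral_prod_right' (f := fun y : E n × E n =>
      ‖mollify μ F (gridProj j ε y.1 y.2) - F y.2‖ₑ ^ p) (by fun_prop)
  obtain ⟨τ, -, h₁, h₂, h₃⟩ := exists_forall_le_of_lintegral_le measurableSet_cell hV0 hVt
    (measurable_lintegral_energy_gridProj (σ := σ) hj ε δ hu) hX₂ hθ.ne' hb0.ne'
    (ENNReal.div_pos hD0.ne' hAt).ne' hθt hbt (ENNReal.div_ne_top hDt hA0) hI₁ hI₂ hI₃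
  refine ⟨δ, ε, ρ, τ, mollify μ F, hδ0, hε0, by linarith, hρ3, ⟨L, hL⟩, h₁,
    (localEnergy_mono F (by linarith)).trans (hre.le.trans (min_le_right _ _)),
    h₂.trans (le_add_self.trans hb), ?_, fun x hx hnear => ?_⟩
  · exact (mul_le_mul_right h₂ _).trans (le_self_add.trans hb)
  · rw [← ENNReal.rpow_le_rpow_iff hp0]
    refine (infEDist_mollify_rpow_le hp hσ hF hM hρ0 hκρt hμ hac hx).trans ?_
    calc A * ∫⁻ y in Metric.ball x ρ, energyDensity p σ F (2 * ρ) y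
        ≤ A * (D / A) := by
          gcongr
          exact (lintegral_mono_set hnear).trans h₃
      _ ≤ D := ENNReal.mul_div_le

end Construction

end FracSobolev
end

noncomputable section
namespace FracSobolev
open MeasureTheory Set
open scoped ENNReal Topology

/-! ### The approximating maps and their convergence. -/

section Approximation

variable {n m j : ℕ} {s p σ : ℝ}

lemma lintegral_ball_near_le {δ : ℝ} {v F : E n → E m} (hv : Measurable v)
    (c₁ c₂ : ℝ≥0∞) (hc₁ : c₁ ≠ ∞) (hc₂ : c₂ ≠ ∞) :
    ∫⁻ h in Metric.ball 0 δ, ‖h‖ₑ ^ (-((n : ℝ) + σ)) *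
        ∫⁻ x, c₁ * (c₂ * ‖v (x + h) - v x‖ₑ ^ p + ‖F (x + h) - F x‖ₑ ^ p) ≤
      c₁ * (c₂ * (∫⁻ h in Metric.ball 0 δ, ‖h‖ₑ ^ (-((n : ℝ) + σ)) *
        ∫⁻ x, ‖v (x + h) - v x‖ₑ ^ p) + localEnergy p σ F δ) := by
  have hm := measurable_modp (p := p) hv
  have e : ∀ h : E n, ‖h‖ₑ ^ (-((n : ℝ) + σ)) *
      ∫⁻ x, c₁ * (c₂ * ‖v (x + h) - v x‖ₑ ^ p + ‖F (x + h) - F x‖ₑ ^ p) =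
      c₁ * (c₂ * (‖h‖ₑ ^ (-((n : ℝ) + σ)) * modp p v h) +
        modp p F h * ‖h‖ₑ ^ (-((n : ℝ) + σ))) := fun h => by
    rw [lintegral_const_mul' _ _ hc₁, lintegral_add_left (by fun_prop),
      lintegral_const_mul' _ _ hc₂]
    unfold modp
    ring
  simp only [e]
  rw [lintegral_const_mul' _ _ hc₁, lintegral_add_left (by fun_prop),
    lintegral_const_mul' _ _ hc₂, localEnergy]
  gcongr
  · exact le_rfl
  · exact Metric.ball_subset_closedBall

/-- A map with values in a compact manifold is approximated by piecewise homogeneous maps. -/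
lemma exists_piecewiseHomogeneous_wspNorm_le {d : ℕ} (hs0 : 0 < s) (hs1 : s < 1) (hp : 1 ≤ p)
    (hspn : s * p < n) {N : Set (E m)} (hNc : IsCompact N) (hN : IsSmoothSubmanifold d N)
    {Ω ω : Set (E n)} (hΩ : Ω.Nonempty) (hΩb : Bornology.IsBounded Ω) (hω : IsOpen ω)
    (hωb : Bornology.IsBounded ω) (hΩω : closure Ω ⊆ ω) {f : E n → E m} (hf : MemWsp s p ω N f)
    {η : ℝ≥0∞} (hη : 0 < η) (hηt : η ≠ ∞) :
    ∃ (C : Mesh n) (g : E n → E m), closure Ω ⊆ C.carrier ∧ C.carrier ⊆ ω ∧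
      MapsTo g C.carrier N ∧ C.IsPiecewiseHomogeneous ⌊s * p⌋₊ g ∧ MemWsp s p C.carrier N g ∧
      wspNorm s p Ω (fun x => g x - f x) ≤ η ∧
      ∃ L, LipschitzOnWith L g (C.skeleton ⌊s * p⌋₊) := by
  have hp0 : 0 < p := by linarith
  have hσ : 0 < s * p := by positivity
  set j := ⌊s * p⌋₊ with hjdef
  have hjσ : (j : ℝ) ≤ s * p := Nat.floor_le hσ.le
  have hσj : s * p < j + 1 := Nat.lt_floor_add_one _
  have hj : j < n := by exact_mod_cast hjσ.trans_lt hspn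
  have hne : N.Nonempty := by
    have hpos : volume ω ≠ 0 := (hω.measure_pos volume
      (hΩ.mono (subset_closure.trans hΩω))).ne'
    have : (ae (volume.restrict ω)).NeBot := by
      rw [ae_neBot]; simpa using hpos
    obtain ⟨x, hx⟩ := hf.2.2.exists
    exact ⟨_, hx⟩
  obtain ⟨F, B, a, hF, hB, hFi, ha, haω, hFf, hfin⟩ :=
    exists_extension hs0 hs1 (by omega) hp hNc hΩ hΩb hω hωb hΩω hf
  obtain ⟨d₀, hd₀, π, hπm, hπN, hπL, hπ⟩ := exists_lipschitz_retraction hNc hne hN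
  obtain ⟨o, ho⟩ := hne
  have h2t : ∀ t : ℝ, (2 : ℝ≥0∞) ^ t ≠ ∞ := fun t => by simp
  have hΩt : volume Ω ≠ ∞ := hΩb.measure_lt_top.ne
  -- The constant collects all the multiples of θ below: near pairs, far pairs and the L^p norm.
  obtain ⟨θ, hθ0, hθt, hθ⟩ := exists_pos_mul_le
    (c := 2 ^ (p - 1) * (2 ^ p + 1) + 1 + 2 ^ p) (θ := (η / 2) ^ p)
    (by simp [ENNReal.mul_eq_top, h2t])
    (ENNReal.rpow_pos (ENNReal.div_pos hη.ne' (by simp)) (ENNReal.div_ne_top hηt (by simp)))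
  obtain ⟨δ, ε, ρ, τ, u, hδ, hε, hεa, hρa, ⟨L, hL⟩, hX₁, hFδ, hX₂, hX₂δ, hdist⟩ :=
    -- With a / 2 for both the cube diameter and ρ, the ρ-balls about points of the mesh stay within
    -- distance a of Ω, where F takes values in N. In c, one factor 2 ^ p and the volume come from
    -- the far-pair term, the other from ‖g - F‖ ≤ 2 ‖v - F‖.
    exists_grid hj hp hσ hjσ hσj hF hB hFi hfin N (half_pos ha) hd₀
      (c := 2 ^ p * volume Ω * 2 ^ p)
      (ENNReal.mul_ne_top (ENNReal.mul_ne_top (h2t _) hΩt) (h2t _)) hθ0 hθt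
  have hu : Measurable u := hL.continuous.measurable
  obtain ⟨C, hCT, hCε, hΩC, hCΩ⟩ := Mesh.exists_covering (-(ε • τ)) hε hΩb.closure
  have hCT' : C.T = -(C.ε • τ) := by rw [hCT, hCε]
  have hproj : ∀ x, C.proj j x = gridProj j ε τ x := fun x => by
    rw [C.proj_of_T_eq hCT', hCε]
  have hnear : ∀ x ∈ C.carrier, Metric.infDist x (closure Ω) ≤ a / 2 := fun x hx => by
    obtain ⟨y, hy, hxy⟩ := hCΩ x hx
    exact (Metric.infDist_le_dist_of_mem hy).trans (by rw [dist_eq_norm]; linarith)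
  have hskel : ∀ x ∈ C.skeleton j, Metric.infDist (u x) N ≤ d₀ := fun x hx => by
    refine ENNReal.toReal_le_of_le_ofReal hd₀.le (hdist x ?_ fun y hy => ?_)
    · filter_upwards [hFf] with y hy hyx
      refine (hy ?_).2
      have h1 := hnear x (C.skeleton_subset_carrier j hx)
      have h2 : Metric.infDist y (closure Ω) ≤ Metric.infDist x (closure Ω) + dist y x :=
        Metric.infDist_le_infDist_add_dist
      have h3 := Metric.mem_ball.1 hyx
      linarith
    · rw [← hCε]
      exact C.ball_subset_nearSkel hCT' hx hy
  set v : E n → E m := fun x => u (gridProj j ε τ x) with hv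
  have hvm : Measurable v := by
    have : v = fun x => u (C.proj j x) := funext fun x => by rw [hproj]
    rw [this]
    exact hu.comp (C.measurable_proj hj)
  -- Where the depth vanishes the retraction does not land in the skeleton; a constant value in N
  -- keeps g homogeneous and N-valued at every point.
  set g : E n → E m := fun x => if depth j (C.coord x) = 0 then o else π (u (C.proj j x)) with hg
  have hgN : ∀ x, g x ∈ N := fun x => by
    simp only [hg]
    split_ifs
    exacts [ho, hπN _]
  have hgm : Measurable g :=
    Measurable.ite (((continuous_depth hj).measurable.comp C.measurable_coord)
      (measurableSet_singleton 0)) measurable_const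
      (hπm.comp (hu.comp (C.measurable_proj hj)))
  have hgv : ∀ᵐ x ∂volume.restrict C.carrier, g x = π (v x) ∧ Metric.infDist (v x) N ≤ d₀ := by
    refine (ae_restrict_iff' C.isCompact_carrier.measurableSet).2 ?_
    filter_upwards [ae_depth_coord_ne_zero hj C] with x hx hxC
    obtain ⟨K, hK, hxK⟩ := mem_iUnion₂.1 hxC
    simp only [hg, if_neg hx, hv, ← hproj]
    exact ⟨trivial, hskel _ (C.proj_mem_skeleton hj hK hxK hx)⟩
  have hgg : ∀ {x y}, (g x = π (v x) ∧ Metric.infDist (v x) N ≤ d₀) →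
      (g y = π (v y) ∧ Metric.infDist (v y) N ≤ d₀) →
      ‖g x - g y‖ₑ ^ p ≤ 2 ^ p * ‖v y - v x‖ₑ ^ p := fun {x y} hx hy => by
    rw [← ENNReal.mul_rpow_of_nonneg _ _ hp0.le, hx.1, hy.1, ← edist_eq_enorm_sub,
      ← edist_eq_enorm_sub, edist_comm (v y)]
    exact ENNReal.rpow_le_rpow (hπL hx.2 hy.2) hp0.le
  have hmeas : ∀ c₁ c₂ : ℝ≥0∞, Measurable (Function.uncurry fun x y : E n =>
      c₁ * (c₂ * ‖v y - v x‖ₑ ^ p + ‖F y - F x‖ₑ ^ p)) := fun c₁ c₂ => by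
    unfold Function.uncurry
    fun_prop
  have hΩsub : Ω ⊆ C.carrier := subset_closure.trans hΩC
  have hCω : C.carrier ⊆ ω := fun x hx => haω x ((hnear x hx).trans (by linarith))
  refine ⟨C, g, hΩC, hCω, fun x _ => hgN x, C.isPiecewiseHomogeneous_comp_proj j
    (fun y => π (u y)) o, ⟨hgm.aestronglyMeasurable, ?_, .of_forall hgN⟩, ?_, 2 * L, ?_⟩
  · obtain ⟨R, hR⟩ := hNc.isBounded.exists_norm_le
    have hfinC : ∫⁻ x in C.carrier, ‖g x‖ₑ ^ p < ∞ := by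
      refine lt_of_le_of_lt (lintegral_mono (g := fun _ => ENNReal.ofReal R ^ p) fun x => ?_) ?_
      · refine ENNReal.rpow_le_rpow ?_ hp0.le
        rw [← ofReal_norm]
        exact ENNReal.ofReal_le_ofReal (hR _ (hgN x))
      · rw [setLIntegral_const]
        exact ENNReal.mul_lt_top (ENNReal.rpow_lt_top_of_nonneg hp0.le ENNReal.ofReal_ne_top)
          C.isCompact_carrier.measure_lt_top
    have hen := gagliardoEnergy_le hs0 hp hgm.aemeasurable (hmeas 1 (2 ^ p)) (by
      filter_upwards [hgv] with x hx
      filter_upwards [hgv] with y hy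
      rw [one_mul]
      exact (hgg hx hy).trans le_self_add) hδ
    rw [wspNorm]
    refine ENNReal.add_lt_top.2 ⟨?_, ENNReal.rpow_lt_top_of_nonneg (by positivity) ?_⟩
    · rw [eLpNorm_eq_lintegral_rpow_enorm_toReal (by simpa using hp0) ENNReal.ofReal_ne_top,
        ENNReal.toReal_ofReal hp0.le]
      exact ENNReal.rpow_lt_top_of_nonneg (by positivity) hfinC.ne
    · refine ne_top_of_le_ne_top ?_ (hen.trans (add_le_add_left
        (lintegral_ball_near_le hvm 1 (2 ^ p) ENNReal.one_ne_top (h2t p)) _))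
      refine ENNReal.add_ne_top.2 ⟨ENNReal.mul_ne_top ENNReal.one_ne_top (ENNReal.add_ne_top.2
        ⟨ENNReal.mul_ne_top (h2t p) (ne_top_of_le_ne_top hθt hX₁), ne_top_of_le_ne_top hθt hFδ⟩),
        ENNReal.mul_ne_top (ENNReal.mul_ne_top (ENNReal.mul_ne_top ?_ (h2t p))
          C.isCompact_carrier.measure_lt_top.ne) hfinC.ne⟩
      rw [ENNReal.ofReal_rpow_of_pos hδ]
      exact ENNReal.ofReal_ne_top
  · have hFΩ : ∀ᵐ x ∂volume.restrict Ω, F x = f x ∧ F x ∈ N := by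
      refine ae_restrict_of_ae_restrict_of_subset subset_closure
        ((ae_restrict_iff' isClosed_closure.measurableSet).2 ?_)
      filter_upwards [hFf] with x hx hxΩ
      exact hx (by rw [Metric.infDist_zero_of_mem hxΩ]; exact ha.le)
    have hgvΩ := ae_restrict_of_ae_restrict_of_subset hΩsub hgv
    have hcongr : (fun x => g x - f x) =ᵐ[volume.restrict Ω] fun x => g x - F x := by
      filter_upwards [hFΩ] with x hx
      rw [hx.1]
    have hLp : ∫⁻ x in Ω, ‖g x - F x‖ₑ ^ p ≤ 2 ^ p * ∫⁻ x, ‖v x - F x‖ₑ ^ p := by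
      rw [← lintegral_const_mul' _ _ (h2t p)]
      refine (lintegral_mono_ae ?_).trans (setLIntegral_le_lintegral Ω _)
      filter_upwards [hFΩ, hgvΩ] with x hx hgx
      rw [← ENNReal.mul_rpow_of_nonneg _ _ hp0.le, hgx.1]
      refine ENNReal.rpow_le_rpow ?_ hp0.le
      -- Since F x lies in N, it is no closer to v x than the nearest point π (v x).
      calc ‖π (v x) - F x‖ₑ = ‖(π (v x) - v x) + (v x - F x)‖ₑ := by rw [sub_add_sub_cancel]
        _ ≤ ‖π (v x) - v x‖ₑ + ‖v x - F x‖ₑ := enorm_add_le _ _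
        _ ≤ ‖v x - F x‖ₑ + ‖v x - F x‖ₑ := by
            gcongr
            rw [← ofReal_norm, ← ofReal_norm, norm_sub_rev]
            exact ENNReal.ofReal_le_ofReal (hπ _ hgx.2 _ hx.2)
        _ = 2 * ‖v x - F x‖ₑ := (two_mul _).symm
    refine wspNorm_le hp ?_ ?_
    · calc ∫⁻ x in Ω, ‖g x - f x‖ₑ ^ p = ∫⁻ x in Ω, ‖g x - F x‖ₑ ^ p :=
            lintegral_congr_ae (hcongr.mono fun x hx => by simp only [hx])
        _ ≤ 2 ^ p * θ := hLp.trans (by gcongr)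
        _ ≤ (2 ^ (p - 1) * (2 ^ p + 1) + 1 + 2 ^ p) * θ := by
            gcongr
            exact le_add_self
        _ ≤ _ := hθ
    · rw [gagliardoEnergy_congr_ae hcongr]
      -- For near pairs the increments of g and of F are bounded separately, without cancellation;
      -- the L^p closeness of g to F enters only through the far pairs.
      have hen := gagliardoEnergy_le hs0 hp (hgm.sub hF).aemeasurable
        (hmeas (2 ^ (p - 1)) (2 ^ p)) (by
          filter_upwards [hgvΩ] with x hx
          filter_upwards [hgvΩ] with y hy
          rw [Pi.sub_apply, Pi.sub_apply, sub_sub_sub_comm]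
          refine (enorm_sub_rpow_le hp _ _).trans ?_
          gcongr
          · exact hgg hx hy
          · rw [← edist_eq_enorm_sub, ← edist_eq_enorm_sub, edist_comm]) hδ
      refine hen.trans ?_
      calc _ ≤ 2 ^ (p - 1) * (2 ^ p * θ + θ) + θ := by
            refine add_le_add ((lintegral_ball_near_le hvm _ _ (h2t _) (h2t _)).trans ?_)
              (le_trans ?_ hX₂δ)
            · gcongr
            · rw [mul_assoc (ENNReal.ofReal δ ^ _), mul_assoc (ENNReal.ofReal δ ^ _),
                mul_assoc (ENNReal.ofReal δ ^ _), mul_assoc (2 ^ p * volume Ω)]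
              gcongr
              exact hLp
        _ = (2 ^ (p - 1) * (2 ^ p + 1) + 1) * θ := by ring
        _ ≤ (2 ^ (p - 1) * (2 ^ p + 1) + 1 + 2 ^ p) * θ :=
            mul_le_mul_left le_self_add _
        _ ≤ _ := hθ
  · have hcomp : LipschitzOnWith (2 * L) (fun x => π (u x)) (C.skeleton j) :=
      hπL.comp (hL.lipschitzOnWith (s := C.skeleton j)) hskel
    have hgs : ∀ x ∈ C.skeleton j, g x = π (u x) := fun x hx => by
      simp only [hg, C.depth_coord_of_mem_skeleton hj hx, one_ne_zero, if_false,
        C.proj_of_mem_skeleton hj hx]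
    intro x hx y hy
    rw [hgs x hx, hgs y hy]
    exact hcomp hx hy

end Approximation

end FracSobolev
end

theorem theorem1p6 {n m d : ℕ} (s p : ℝ) (hs0 : 0 < s) (hs1 : s < 1) (hp : 1 ≤ p)
    (hsp1 : 1 ≤ s * p) (hspn : s * p < n)
    (N : Set (FracSobolev.E m)) (hNc : IsCompact N) (hN : FracSobolev.IsSmoothSubmanifold d N)
    (Ω ω : Set (FracSobolev.E n)) (hΩ : IsOpen Ω) (hΩb : Bornology.IsBounded Ω)
    (hω : IsOpen ω) (hωb : Bornology.IsBounded ω) (hΩω : closure Ω ⊆ ω)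
    (f : FracSobolev.E n → FracSobolev.E m) (hf : FracSobolev.MemWsp s p ω N f) :
    ∃ (C : ℕ → FracSobolev.Mesh n) (fk : ℕ → FracSobolev.E n → FracSobolev.E m),
      (∀ k, closure Ω ⊆ (C k).carrier ∧ (C k).carrier ⊆ ω) ∧
      (∀ k, Set.MapsTo (fk k) (C k).carrier N) ∧
      (∀ k, (C k).IsPiecewiseHomogeneous ⌊s * p⌋₊ (fk k)) ∧
      (∀ k, FracSobolev.MemWsp s p (C k).carrier N (fk k)) ∧
      Filter.Tendsto (fun k => FracSobolev.wspNorm s p Ω (fun x => fk k x - f x))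
        Filter.atTop (nhds 0) ∧
      (∀ k, ∃ L : NNReal, LipschitzOnWith L (fk k) ((C k).skeleton ⌊s * p⌋₊)) := by
  -- The distance to Ω is meaningful only for nonempty Ω; otherwise the empty mesh serves.
  rcases Ω.eq_empty_or_nonempty with rfl | hne
  · have hp0 : 0 < p := by linarith
    have h0 : ∀ u : FracSobolev.E n → FracSobolev.E m, FracSobolev.wspNorm s p ∅ u = 0 :=
      fun u => by simp [FracSobolev.wspNorm, FracSobolev.gagliardoEnergy, hp0]
    let C₀ : FracSobolev.Mesh n := ⟨0, 1, one_pos, ∅⟩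
    have hC : C₀.carrier = ∅ := by simp [C₀, FracSobolev.Mesh.carrier]
    refine ⟨fun _ => C₀, fun _ _ => 0, fun _ => ?_, fun _ => ?_, fun _ K hK => ?_, fun _ => ?_,
      ?_, fun _ => ⟨0, ?_⟩⟩
    · simp [hC]
    · simp only [hC]
      exact Set.mapsTo_empty _ _
    · simp [C₀] at hK
    · simp only [hC]
      exact ⟨MeasureTheory.aestronglyMeasurable_const, by simp [h0], by simp⟩
    · simp only [h0]
      exact tendsto_const_nhds
    · exact (LipschitzWith.const 0).lipschitzOnWith
  · have key := fun k : ℕ => FracSobolev.exists_piecewiseHomogeneous_wspNorm_le hs0 hs1 hp hspn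
      hNc hN hne hΩb hω hωb hΩω hf (η := ((k : ENNReal) + 1)⁻¹) (by simp) (by simp)
    choose C g h₁ h₂ h₃ h₄ h₅ h₆ h₇ using key
    refine ⟨C, g, fun k => ⟨h₁ k, h₂ k⟩, h₃, h₄, h₅, ?_, h₇⟩
    refine tendsto_of_tendsto_of_tendsto_of_le_of_le tendsto_const_nhds ?_ (fun _ => zero_le) h₆
    have := (Filter.tendsto_add_atTop_iff_nat 1).2 ENNReal.tendsto_inv_nat_nhds_zero
    simpa using this
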